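/- **Setting.** Let $F$ be a totally real number field of degree $n$, with a fixed ordering $\sigma_1,\dots,\sigma_n$ of its embeddings into $\mathbb R$. Put $U_v=\mathbb R_{>0}$ for archimedean $v$, $U_v=\mathcal O_v^*$ for finite $v$, and $U^S=\prod_{v\notin S}U_v$. Let $S=S_1\sqcup S_2$ be a finite set of nonarchimedean places of $F$, with $S_1=\{v_1,\dots,v_r\}$ ordered ($r\ge 0$). For a finite set $T$ of nonarchimedean places, $(\mathbb A^T)^*$ denotes the ideles of $F$ without components at $T$. For disjoint finite sets of places $\Sigma_1,\Sigma_2$ and a topological abelian group $A$ let $\mathcal C_c(\Sigma_1,A)^{\Sigma_2}$ (resp. $\mathcal C(\Sigma_1,A)^{\Sigma_2}$) be the group of continuous functions with compact support (resp. all continuous functions) $(\mathbb A^{\Sigma_2})^*/U^{\Sigma_1\cup\Sigma_2}\to A$; we omit $\Sigma_2$ if it is empty. Let $\mathcal C_c(S_1,S_2,A)=C_c\big(\prod_{i}F_{v_i}\times(\mathbb A^{S_1})^*/U^S,A\big)$. The group $F^*$ acts by $(xf)(y)=f(x^{-1}y)$. For $T\subseteq S$ the pairing $(\psi,\phi)\mapsto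 \phi\cdot\psi$, $(\phi\cdot\psi)(x)=\phi(xU^{T})\psi(x)$, of $\mathcal C(S\setminus T,A)^T$ with $\mathcal C_c(\emptyset,\mathbb Z)^T$ into $\mathcal C_c(S\setminus T,A)^T$ defines cap products. All (co)homology is group (co)homology of $F^*$ or its subgroups; the cap product of an $i$-cochain $f$ with a chain is $$f\cap(m\otimes[g_1|\cdots|g_k])=(g_1\cdots g_i)^{-1}\langle f(g_1,\dots,g_i),m\rangle\otimes[g_{i+1}|\cdots|g_k],$$ and the cup product of $1$-cochains is $(z_1\cup\dots\cup z_r)(g_1,\dots,g_r)=\bigotimes_i g_1\cdots g_{i-1}z_i(g_i)$. **The classes $\vartheta^T$.** Let $T$ be $\emptyset$ or $S_1$, with $t=\# T$, let $E_{T,+}$ be the group of totally positive $T$-units (free abelian of rank $m=n+t-1$), and let $\varepsilon_1,\dots,\varepsilon_m$ be a basis of it which is positively oriented, i.e. the determinant of the matrix with rows $(\mathrm{ord}_{v_j}(\varepsilon_i))_i$ for $v_j\in T$ (in order), followed by $(\log\sigma_l(\varepsilon_i))_i$, $1\le l\le n-1$, is positive. Let $\eta_T\in H_m(E_{T,+},\mathbb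 Z)$ be the class of $\sum_{\pi\in\mathfrak S_m}\mathrm{sgn}(\pi)[\varepsilon_{\pi(1)}|\cdots|\varepsilon_{\pi(m)}]$, let $\mathcal F$ be a (finite) fundamental domain for the action of $F^*/E_{T,+}$ on $(\mathbb A^T)^*/U^T$, and let $\vartheta^T\in H_m(F^*,\mathcal C_c(\emptyset,\mathbb Z)^T)$ be the image of $\eta_T$ under the map induced by $E_{T,+}\subseteq F^*$ and $\mathbb Z\to\mathcal C_c(\emptyset,\mathbb Z)^T$, $1\mapsto 1_{\mathcal F}$. Write $\vartheta=\vartheta^{\emptyset}$. **The cocycles.** For a finite place $v$ and a continuous homomorphism $\psi:F_v^*\to A$ let $c_\psi$ be the class of the $1$-cocycle $$z_\psi(x)(y)=1_{x\mathcal O_v}(y)\,\psi(x)+\big((1_{\mathcal O_v}-1_{x\mathcal O_v})\psi\big)_!(y)$$ with values in $C_c(F_v,A)$, restricted to $F^*$, where $(\cdot)_!$ denotes extension by zero. **Hypotheses.** Let $R$ be a commutative locally profinite (locally compact, totally disconnected, Hausdorff) topological ring and let $\chi:\mathbb A_F^*\to R^*$ be a continuous homomorphism that is trivial on $F^*$ and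 on $U^S$. Let $\mathfrak a$ and $\mathfrak a_1,\dots,\mathfrak a_r\subseteq\mathfrak a$ be closed ideals of $R$ such that $\chi_{v_i}(x)\equiv1\bmod\mathfrak a_i$ for all $x\in F_{v_i}^*$ and all $i$, and suppose that $\mathfrak a\cdot\mathfrak a_1\cdots\mathfrak a_r=0$. Put $\bar R=R/\mathfrak a$ and $\bar{\mathfrak a}_i=\mathfrak a_i/\mathfrak a\mathfrak a_i$ (with the quotient topologies, ideals carrying the subspace topology), and let $d\chi_{v_i}:F_{v_i}^*\to\bar{\mathfrak a}_i$ be the homomorphism $x\mapsto\chi_{v_i}(x)-1\bmod\mathfrak a\mathfrak a_i$. Let $$\kappa\in H_{n-1}(F^*,\mathcal C_c(S_1,S_2,R))$$ be the image of $\chi\cap\vartheta\in H_{n-1}(F^*,\mathcal C_c(S,R))$ under extension by zero along $\mathbb A^*/U^S\subseteq\prod_iF_{v_i}\times(\mathbb A^{S_1})^*/U^S$, and let $$\bar\kappa=\bar\chi^{S_1}\cap\vartheta^{S_1}\in H_{n+r-1}(F^*,\mathcal C_c(S_2,\bar R)^{S_1}),$$ where $\bar\chi^{S_1}$ is the restriction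 of $\chi\bmod\mathfrak a$ to $(\mathbb A^{S_1})^*$, an $F^*$-invariant element of $\mathcal C(S_2,\bar R)^{S_1}$. Multiplication $\bar R\times\bar{\mathfrak a}_1\times\dots\times\bar{\mathfrak a}_r\to\mathfrak a_1\cdots\mathfrak a_r$ induces a pairing of $\bigotimes_iC_c(F_{v_i},\bar{\mathfrak a}_i)$ with $\mathcal C_c(S_2,\bar R)^{S_1}$ into $\mathcal C_c(S_1,S_2,\mathfrak a_1\cdots\mathfrak a_r)$, hence a cap product. Let $\iota:\mathcal C_c(S_1,S_2,\mathfrak a_1\cdots\mathfrak a_r)\hookrightarrow\mathcal C_c(S_1,S_2,R)$ be the inclusion. **Proposition.** For all choices of bases and fundamental domains as above, $$\kappa=\iota_*\big((c_{d\chi_{v_1}}\cup\dots\cup c_{d\chi_{v_r}})\cap\bar\kappa\big).$$ In particular $\kappa=0$ if $\mathfrak a_1\cdots\mathfrak a_r=0$. -/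

import Mathlib

open CategoryTheory
open scoped CompactlySupported

namespace HeckeClasses

section GroupHomology

variable {k G : Type} [CommRing k] [Group G]

/-- `x` is an inhomogeneous `m`-cycle. -/
def IsCycle {N : Rep.{0} k G} {m : ℕ} (x : (Fin m → G) →₀ N) : Prop :=
  ∀ j, (groupHomology.inhomogeneousChains N).d m j x = 0

/-- `f` is an inhomogeneous `m`-cocycle. -/
def IsCocycle {M : Rep.{0} k G} {m : ℕ} (f : (Fin m → G) → M) : Prop :=
  inhomogeneousCochains.d M m f = 0

/-- The homology class of a cycle. -/
noncomputable def homologyClass {N : Rep.{0} k G} {m : ℕ} (x : (Fin m → G) →₀ N)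
    (hx : IsCycle x) : groupHomology N m :=
  groupHomology.π N m (groupHomology.cyclesMk m _ rfl x (hx _))

/-- The cohomology class of a cocycle. -/
noncomputable def cohomologyClass {M : Rep.{0} k G} {m : ℕ} (f : (Fin m → G) → M)
    (hf : IsCocycle f) : groupCohomology M m :=
  groupCohomology.π M m (groupCohomology.cocyclesMk f hf)

theorem exists_cycle {N : Rep.{0} k G} {m : ℕ} (x : groupHomology N m) :
    ∃ (y : (Fin m → G) →₀ N) (hy : IsCycle y), homologyClass y hy = x := by
  induction x using groupHomology_induction_on with
  | h y =>
    have hy : IsCycle (groupHomology.iCycles N m y) := by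
      intro k
      have := (groupHomology.inhomogeneousChains N).iCycles_d m k
      exact congrArg (fun f => f.hom y) this
    refine ⟨_, hy, ?_⟩
    unfold homologyClass
    congr 1
    apply (ModuleCat.mono_iff_injective (groupHomology.iCycles N m)).1 inferInstance
    exact groupHomology.iCycles_mk rfl _ (hy _)

theorem exists_cocycle {M : Rep.{0} k G} {m : ℕ} (x : groupCohomology M m) :
    ∃ (y : (Fin m → G) → M) (hy : IsCocycle y), cohomologyClass y hy = x := by
  induction x using groupCohomology_induction_on with
  | h y =>
    have hy : IsCocycle (groupCohomology.iCocycles M m y) := by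
      have := (groupCohomology.inhomogeneousCochains M).iCycles_d m (m + 1)
      rw [groupCohomology.inhomogeneousCochains.d_def] at this
      exact congrArg (fun f => f.hom y) this
    refine ⟨_, hy, ?_⟩
    unfold cohomologyClass
    congr 1
    apply (ModuleCat.mono_iff_injective (groupCohomology.iCocycles M m)).1 inferInstance
    exact groupCohomology.iCocycles_mk _ hy

theorem homologyClass_eq_iff {N : Rep.{0} k G} {m : ℕ} (x y : (Fin m → G) →₀ N)
    (hx : IsCycle x) (hy : IsCycle y) :
    homologyClass x hx = homologyClass y hy ↔
      ∃ z : (Fin (m + 1) → G) →₀ N, groupHomology.inhomogeneousChains.d N m z = x - y := by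
  let K := groupHomology.inhomogeneousChains N
  have hex : (ShortComplex.mk _ _ (K.toCycles_comp_homologyπ (m + 1) m)).Exact :=
    ShortComplex.exact_of_g_is_cokernel _ (K.homologyIsCokernel (m + 1) m (by simp))
  rw [ShortComplex.moduleCat_exact_iff] at hex
  have hinj : Function.Injective (groupHomology.iCycles N m) :=
    (ModuleCat.mono_iff_injective (groupHomology.iCycles N m)).1 inferInstance
  have hti : ∀ z, groupHomology.iCycles N m (K.toCycles (m + 1) m z) =
      groupHomology.inhomogeneousChains.d N m z := by
    intro z
    have := K.toCycles_i (m + 1) m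
    rw [groupHomology.inhomogeneousChains.d_def] at this
    exact congrArg (fun f => f.hom z) this
  have hsub : groupHomology.iCycles N m
      (groupHomology.cyclesMk m _ rfl x (hx _) - groupHomology.cyclesMk m _ rfl y (hy _)) =
      x - y := by
    rw [map_sub]
    exact congrArg₂ _ (groupHomology.iCycles_mk rfl _ (hx _)) (groupHomology.iCycles_mk rfl _ (hy _))
  unfold homologyClass
  rw [← sub_eq_zero, ← map_sub]
  constructor
  · intro h
    obtain ⟨z, hz⟩ := hex _ h
    refine ⟨z, ?_⟩
    rw [← hti, ← hsub]
    exact congrArg _ hz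
  · rintro ⟨z, hz⟩
    have : K.toCycles (m + 1) m z =
        groupHomology.cyclesMk m _ rfl x (hx _) - groupHomology.cyclesMk m _ rfl y (hy _) := by
      apply hinj
      rw [hti, hsub, hz]
    rw [← this]
    exact congrArg (fun f => f.hom z) (K.toCycles_comp_homologyπ (m + 1) m)

theorem cohomologyClass_eq_iff {M : Rep.{0} k G} {m : ℕ} (x y : (Fin (m + 1) → G) → M)
    (hx : IsCocycle x) (hy : IsCocycle y) :
    cohomologyClass x hx = cohomologyClass y hy ↔
      ∃ z : (Fin m → G) → M, inhomogeneousCochains.d M m z = x - y := by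
  let K := groupCohomology.inhomogeneousCochains M
  have hex : (ShortComplex.mk _ _ (K.toCycles_comp_homologyπ m (m + 1))).Exact :=
    ShortComplex.exact_of_g_is_cokernel _ (K.homologyIsCokernel m (m + 1) (by simp))
  rw [ShortComplex.moduleCat_exact_iff] at hex
  have hinj : Function.Injective (groupCohomology.iCocycles M (m + 1)) :=
    (ModuleCat.mono_iff_injective (groupCohomology.iCocycles M (m + 1))).1 inferInstance
  have hti : ∀ z, groupCohomology.iCocycles M (m + 1) (K.toCycles m (m + 1) z) =
      inhomogeneousCochains.d M m z := by
    intro z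
    have := K.toCycles_i m (m + 1)
    rw [groupCohomology.inhomogeneousCochains.d_def] at this
    exact congrArg (fun f => f.hom z) this
  have hsub : groupCohomology.iCocycles M (m + 1)
      (groupCohomology.cocyclesMk x hx - groupCohomology.cocyclesMk y hy) = x - y := by
    rw [map_sub]
    exact congrArg₂ _ (groupCohomology.iCocycles_mk _ hx) (groupCohomology.iCocycles_mk _ hy)
  unfold cohomologyClass
  rw [← sub_eq_zero, ← map_sub]
  constructor
  · intro h
    obtain ⟨z, hz⟩ := hex _ h
    refine ⟨z, ?_⟩
    rw [← hti, ← hsub]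
    exact congrArg _ hz
  · rintro ⟨z, hz⟩
    have : K.toCycles m (m + 1) z =
        groupCohomology.cocyclesMk x hx - groupCohomology.cocyclesMk y hy := by
      apply hinj
      rw [hti, hsub, hz]
    rw [← this]
    exact congrArg (fun f => f.hom z) (K.toCycles_comp_homologyπ m (m + 1))

theorem cohomologyClass_zero_eq_iff {M : Rep.{0} k G} (x y : (Fin 0 → G) → M)
    (hx : IsCocycle x) (hy : IsCocycle y) :
    cohomologyClass x hx = cohomologyClass y hy ↔ x = y := by
  let K := groupCohomology.inhomogeneousCochains M
  have hex : IsIso (K.homologyπ 0) := by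
    apply K.isIso_homologyπ _ 0 rfl
    simp
  have hinj : Function.Injective (groupCohomology.π M 0) :=
    ((ModuleCat.mono_iff_injective _).1 (inferInstance : Mono (K.homologyπ 0)))
  constructor
  · intro h
    have := hinj h
    have h2 := congrArg (groupCohomology.iCocycles M 0) this
    exact (groupCohomology.iCocycles_mk _ hx).symm.trans (h2.trans (groupCohomology.iCocycles_mk _ hy))
  · rintro rfl; rfl


/-- An equivariant bilinear pairing of `G`-modules. -/
structure Pairing (M N P : Rep.{0} k G) where
  toFun : M →ₗ[k] N →ₗ[k] P
  equivariant : ∀ g m n, toFun (M.ρ g m) (N.ρ g n) = P.ρ g (toFun m n)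

variable {M N P : Rep.{0} k G}

/-- The cap product of a cochain with a chain, given on generators by
`f ∩ (n ⊗ [g₁|…|gₘ]) = (g₁⋯gᵢ)⁻¹ ⟨f(g₁, …, gᵢ), n⟩ ⊗ [gᵢ₊₁|…|gₘ]`. -/
noncomputable def capChain (B : Pairing M N P) {i j m : ℕ} (h : i + j = m)
    (f : (Fin i → G) → M) : ((Fin m → G) →₀ N) →ₗ[k] ((Fin j → G) →₀ P) :=
  Finsupp.lsum k fun g : Fin m → G =>
    Finsupp.lsingle (fun l : Fin j => g ⟨i + l, by omega⟩) ∘ₗ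
      P.ρ (List.ofFn fun k : Fin i => g ⟨k, by omega⟩).prod⁻¹ ∘ₗ
        B.toFun (f fun k : Fin i => g ⟨k, by omega⟩)

theorem capChain_single (B : Pairing M N P) {i j m : ℕ} (h : i + j = m)
    (f : (Fin i → G) → M) (g : Fin m → G) (n : N) :
    capChain B h f (Finsupp.single g n) =
      Finsupp.single (fun l : Fin j => g ⟨i + l, by omega⟩)
        (P.ρ (List.ofFn fun k : Fin i => g ⟨k, by omega⟩).prod⁻¹
          (B.toFun (f fun k : Fin i => g ⟨k, by omega⟩) n)) := by
  simp [capChain]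

/-- The differential on inhomogeneous chains, as a linear map. -/
noncomputable def dChain (N : Rep.{0} k G) (m : ℕ) :
    ((Fin (m + 1) → G) →₀ N) →ₗ[k] ((Fin m → G) →₀ N) :=
  (groupHomology.inhomogeneousChains.d N m).hom

/-- The differential on inhomogeneous cochains, as a linear map. -/
noncomputable def dCochain (M : Rep.{0} k G) (m : ℕ) :
    ((Fin m → G) → M) →ₗ[k] ((Fin (m + 1) → G) → M) :=
  (inhomogeneousCochains.d M m).hom

theorem dChain_single (m : ℕ) (g : Fin (m + 1) → G) (n : N) :
    dChain N m (Finsupp.single g n) = Finsupp.single (fun i => g i.succ) (N.ρ (g 0)⁻¹ n) +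
      ∑ l : Fin (m + 1), (-1 : k) ^ ((l : ℕ) + 1) •
        Finsupp.single (Fin.contractNth l (· * ·) g) n :=
  groupHomology.inhomogeneousChains.d_single m g n

theorem dCochain_apply (m : ℕ) (f : (Fin m → G) → M) (g : Fin (m + 1) → G) :
    dCochain M m f g = M.ρ (g 0) (f fun i => g i.succ) +
      ∑ l : Fin (m + 1), (-1 : k) ^ ((l : ℕ) + 1) • f (Fin.contractNth l (· * ·) g) :=
  inhomogeneousCochains.d_hom_apply M m f g

theorem prod_contractNth {i : ℕ} (g : Fin (i + 1) → G) (l : Fin i) :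
    (List.ofFn (Fin.contractNth l.castSucc (· * ·) g)).prod = (List.ofFn g).prod := by
  induction i with
  | zero => exact l.elim0
  | succ i ih =>
    rw [List.ofFn_succ, List.ofFn_succ (f := g), List.prod_cons, List.prod_cons]
    refine Fin.cases ?_ (fun l => ?_) l
    · rw [List.ofFn_succ (f := fun l : Fin (i + 1) => g l.succ), List.prod_cons, ← mul_assoc]
      congr 1
    · have := ih (fun l => g l.succ) l
      rw [← this]
      congr 3
      ext q
      simp [Fin.contractNth]

/-- The Leibniz rule `f ∩ ∂x = δf ∩ x + (-1)ⁱ ∂(f ∩ x)`. -/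
theorem capChain_d (B : Pairing M N P) {i j m : ℕ} (h : i + j = m)
    (f : (Fin i → G) → M) (x : (Fin (m + 1) → G) →₀ N) :
    capChain B h f (dChain N m x) =
      capChain B (show (i + 1) + j = m + 1 by omega) (dCochain M i f) x +
      (-1 : k) ^ i • dChain P j (capChain B (show i + (j + 1) = m + 1 by omega) f x) := by
  subst h
  induction x using Finsupp.induction_linear with
  | zero => simp
  | add x y hx hy => simp only [map_add, hx, hy, smul_add]; abel
  | single g n =>
    have key1 : ∀ q : Fin i, capChain B (rfl : i + j = i + j) f
        (Finsupp.single (Fin.contractNth (⟨q, by omega⟩ : Fin (i + j + 1)) (· * ·) g) n) =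
        Finsupp.single (fun l : Fin j => g ⟨i + 1 + l, by omega⟩)
          (P.ρ (List.ofFn fun q : Fin (i + 1) => g ⟨q, by omega⟩).prod⁻¹
            (B.toFun (f (Fin.contractNth q.castSucc (· * ·)
              fun q : Fin (i + 1) => g ⟨q, by omega⟩)) n)) := by
      intro q
      have e : (fun l : Fin i => Fin.contractNth (⟨q, by omega⟩ : Fin (i + j + 1)) (· * ·) g
          ⟨l, by omega⟩) = Fin.contractNth q.castSucc (· * ·)
            fun q : Fin (i + 1) => g ⟨q, by omega⟩ := by
        ext l
        simp [Fin.contractNth]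
      rw [capChain_single, e, prod_contractNth]
      congr 1
      ext l
      rw [Fin.contractNth_apply_of_gt]
      · congr 1
        ext
        simp
        omega
      · simp
        omega
    have key2 : ∀ q : Fin (j + 1), capChain B (rfl : i + j = i + j) f
        (Finsupp.single (Fin.contractNth (⟨i + q, by omega⟩ : Fin (i + j + 1)) (· * ·) g) n) =
        Finsupp.single (Fin.contractNth q (· * ·) fun l : Fin (j + 1) => g ⟨i + l, by omega⟩)
          (P.ρ (List.ofFn fun q : Fin i => g ⟨q, by omega⟩).prod⁻¹
            (B.toFun (f fun q : Fin i => g ⟨q, by omega⟩) n)) := by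
      intro q
      have e : (fun l : Fin i => Fin.contractNth (⟨i + q, by omega⟩ : Fin (i + j + 1)) (· * ·) g
          ⟨l, by omega⟩) = fun q : Fin i => g ⟨q, by omega⟩ := by
        ext l
        rw [Fin.contractNth_apply_of_lt]
        · rfl
        · simp
          omega
      rw [capChain_single, e]
      congr 1
      ext l
      simp [Fin.contractNth]
      rfl
    have e3 : Fin.contractNth (Fin.last i) (· * ·) (fun q : Fin (i + 1) => g ⟨q, by omega⟩) =
        fun q : Fin i => g ⟨q, by omega⟩ := by
      ext l
      rw [Fin.contractNth_apply_of_lt]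
      · rfl
      · simp
    have hs : (∑ q : Fin (i + j + 1), (-1 : k) ^ ((q : ℕ) + 1) •
        Finsupp.single (Fin.contractNth q (· * ·) g) n) =
        (∑ q : Fin i, (-1 : k) ^ ((q : ℕ) + 1) •
          Finsupp.single (Fin.contractNth (⟨q, by omega⟩ : Fin (i + j + 1)) (· * ·) g) n) +
        ∑ q : Fin (j + 1), (-1 : k) ^ (i + (q : ℕ) + 1) •
          Finsupp.single (Fin.contractNth (⟨i + q, by omega⟩ : Fin (i + j + 1)) (· * ·) g) n :=
      Fin.sum_univ_add (a := i) (b := j + 1) (fun q : Fin (i + j + 1) => (-1 : k) ^ ((q : ℕ) + 1) •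
        Finsupp.single (Fin.contractNth q (· * ·) g) n)
    have e5 : (P.ρ (List.ofFn fun q : Fin i => g (Fin.succ ⟨q, by omega⟩)).prod⁻¹)
        (B.toFun (f fun q : Fin i => g (Fin.succ ⟨q, by omega⟩)) (N.ρ (g 0)⁻¹ n)) =
        P.ρ (List.ofFn fun q : Fin (i + 1) => g ⟨q, by omega⟩).prod⁻¹
          (B.toFun (M.ρ (g 0) (f fun q : Fin i => g (Fin.succ ⟨q, by omega⟩))) n) := by
      rw [List.ofFn_succ, List.prod_cons, mul_inv_rev, map_mul]
      change _ = (P.ρ _) ((P.ρ _) _)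
      congr 1
      change _ = (P.ρ (g 0)⁻¹) _
      rw [← B.equivariant]
      simp
    have e6 : (P.ρ (g ⟨i, by omega⟩)⁻¹) (P.ρ (List.ofFn fun q : Fin i => g ⟨q, by omega⟩).prod⁻¹
            (B.toFun (f fun q : Fin i => g ⟨q, by omega⟩) n)) =
        P.ρ (List.ofFn fun q : Fin (i + 1) => g ⟨q, by omega⟩).prod⁻¹
          (B.toFun (f fun q : Fin i => g ⟨q, by omega⟩) n) := by
      rw [List.ofFn_succ', List.concat_eq_append, List.prod_append, List.prod_singleton, mul_inv_rev, map_mul]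
      rfl
    have c1 : capChain B (rfl : i + j = i + j) f (dChain N (i + j) (Finsupp.single g n)) =
        Finsupp.single (fun l : Fin j => g ⟨i + 1 + l, by omega⟩)
          (P.ρ (List.ofFn fun q : Fin (i + 1) => g ⟨q, by omega⟩).prod⁻¹
          (B.toFun (M.ρ (g 0) (f fun q : Fin i => g (Fin.succ ⟨q, by omega⟩))) n)) +
        ((∑ q : Fin i, (-1 : k) ^ ((q : ℕ) + 1) •
          Finsupp.single (fun l : Fin j => g ⟨i + 1 + l, by omega⟩)
          (P.ρ (List.ofFn fun q : Fin (i + 1) => g ⟨q, by omega⟩).prod⁻¹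
            (B.toFun (f (Fin.contractNth q.castSucc (· * ·)
              fun q : Fin (i + 1) => g ⟨q, by omega⟩)) n))) +
        ∑ q : Fin (j + 1), (-1 : k) ^ (i + (q : ℕ) + 1) •
          Finsupp.single (Fin.contractNth q (· * ·) fun l : Fin (j + 1) => g ⟨i + l, by omega⟩)
          (P.ρ (List.ofFn fun q : Fin i => g ⟨q, by omega⟩).prod⁻¹
            (B.toFun (f fun q : Fin i => g ⟨q, by omega⟩) n))) := by
      rw [dChain_single, hs]
      simp only [map_add, map_sum, map_smul, key1, key2]
      rw [capChain_single, e5]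
      congr 2
      ext l
      congr 1
      ext
      simp
      omega
    have c2 : capChain B (show (i + 1) + j = i + j + 1 by omega) (dCochain M i f)
          (Finsupp.single g n) =
        Finsupp.single (fun l : Fin j => g ⟨i + 1 + l, by omega⟩)
          (P.ρ (List.ofFn fun q : Fin (i + 1) => g ⟨q, by omega⟩).prod⁻¹
          (B.toFun (M.ρ (g 0) (f fun q : Fin i => g (Fin.succ ⟨q, by omega⟩))) n)) +
        ((∑ q : Fin i, (-1 : k) ^ ((q : ℕ) + 1) •
          Finsupp.single (fun l : Fin j => g ⟨i + 1 + l, by omega⟩)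
          (P.ρ (List.ofFn fun q : Fin (i + 1) => g ⟨q, by omega⟩).prod⁻¹
            (B.toFun (f (Fin.contractNth q.castSucc (· * ·)
              fun q : Fin (i + 1) => g ⟨q, by omega⟩)) n))) +
        (-1 : k) ^ (i + 1) • Finsupp.single (fun l : Fin j => g ⟨i + 1 + l, by omega⟩)
          (P.ρ (List.ofFn fun q : Fin (i + 1) => g ⟨q, by omega⟩).prod⁻¹
          (B.toFun (f fun q : Fin i => g ⟨q, by omega⟩) n))) := by
      rw [capChain_single, dCochain_apply, Fin.sum_univ_castSucc, e3]
      simp only [map_add, map_sum, map_smul, LinearMap.add_apply, LinearMap.sum_apply,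
        LinearMap.smul_apply, Finsupp.single_add, Finsupp.single_finsetSum, Finsupp.smul_single,
        Fin.val_castSucc, Fin.val_last]
      rfl
    have c3 : dChain P j (capChain B (show i + (j + 1) = i + j + 1 by omega) f
          (Finsupp.single g n)) =
        Finsupp.single (fun l : Fin j => g ⟨i + 1 + l, by omega⟩)
          (P.ρ (List.ofFn fun q : Fin (i + 1) => g ⟨q, by omega⟩).prod⁻¹
          (B.toFun (f fun q : Fin i => g ⟨q, by omega⟩) n)) +
        ∑ q : Fin (j + 1), (-1 : k) ^ ((q : ℕ) + 1) •
          Finsupp.single (Fin.contractNth q (· * ·) fun l : Fin (j + 1) => g ⟨i + l, by omega⟩)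
          (P.ρ (List.ofFn fun q : Fin i => g ⟨q, by omega⟩).prod⁻¹
            (B.toFun (f fun q : Fin i => g ⟨q, by omega⟩) n)) := by
      rw [capChain_single, dChain_single]
      congr 1
      rw [← e6]
      congr 1
      ext l
      congr 1
      ext
      simp
      omega
    rw [c1, c2, c3]
    have c4 : ∀ q : ℕ, (-1 : k) ^ (i + q + 1) = (-1 : k) ^ i * (-1 : k) ^ (q + 1) := by
      intro q; ring
    simp only [smul_add, Finset.smul_sum, smul_smul, c4, pow_succ]
    rw [mul_neg_one, neg_smul]
    abel

theorem IsCycle.dChain_eq {N : Rep.{0} k G} {m : ℕ} {x : (Fin (m + 1) → G) →₀ N}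
    (hx : IsCycle x) : dChain N m x = 0 := by
  have := hx m
  rwa [groupHomology.inhomogeneousChains.d_def] at this

theorem isCycle_of_dChain_eq {N : Rep.{0} k G} {m : ℕ} {x : (Fin (m + 1) → G) →₀ N}
    (hx : dChain N m x = 0) : IsCycle x := by
  intro j
  by_cases h : m = j
  · subst h
    rw [groupHomology.inhomogeneousChains.d_def]
    exact hx
  · rw [HomologicalComplex.shape _ _ _ (by simpa using fun h2 => h h2.symm)]
    rfl

theorem isCycle_zero {N : Rep.{0} k G} (x : (Fin 0 → G) →₀ N) : IsCycle x := by
  intro j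
  rw [HomologicalComplex.shape _ _ _ (by simp)]
  rfl

theorem IsCocycle.cap (B : Pairing M N P) {i j m : ℕ} (h : i + j = m)
    {f : (Fin i → G) → M} {x : (Fin m → G) →₀ N} (hf : IsCocycle f) (hx : IsCycle x) :
    IsCycle (capChain B h f x) := by
  cases j with
  | zero => exact isCycle_zero _
  | succ j =>
    obtain ⟨m, rfl⟩ : ∃ m', m = m' + 1 := ⟨i + j, by omega⟩
    apply isCycle_of_dChain_eq
    have := capChain_d B (show i + j = m by omega) f x
    rw [hx.dChain_eq, show dCochain M i f = 0 from hf] at this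
    have h0 : capChain B (show i + 1 + j = m + 1 by omega) (0 : (Fin (i + 1) → G) → M) x = 0 := by
      have : capChain B (show i + 1 + j = m + 1 by omega) (0 : (Fin (i + 1) → G) → M) = 0 := by
        ext g n : 2
        simp [capChain]
      rw [this]; rfl
    rw [h0, map_zero, zero_add] at this
    have h1 : (-1 : k) ^ i • (-1 : k) ^ i • dChain P j (capChain B h f x) = 0 := by
      rw [← this, smul_zero]
    rwa [smul_smul, ← mul_pow, neg_one_mul, neg_neg, one_pow, one_smul] at h1

/-- The cap product `Hⁱ(G, M) × H_m(G, N) → H_j(G, P)`, for `i + j = m`, attached to an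
equivariant pairing, computed on representing (co)cycles. -/
noncomputable def cap (B : Pairing M N P) {i j m : ℕ} (h : i + j = m)
    (c : groupCohomology M i) (x : groupHomology N m) : groupHomology P j :=
  homologyClass
    (capChain B h (exists_cocycle c).choose (exists_cycle x).choose)
    ((exists_cocycle c).choose_spec.choose.cap B h (exists_cycle x).choose_spec.choose)

theorem capChain_sub_left (B : Pairing M N P) {i j m : ℕ} (h : i + j = m)
    (f f' : (Fin i → G) → M) (x : (Fin m → G) →₀ N) :
    capChain B h (f - f') x = capChain B h f x - capChain B h f' x := by
  induction x using Finsupp.induction_linear with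
  | zero => simp
  | add x y hx hy => simp only [map_add, hx, hy]; abel
  | single g n => simp [capChain_single]

theorem capChain_zero_left (B : Pairing M N P) {i j m : ℕ} (h : i + j = m)
    (x : (Fin m → G) →₀ N) : capChain B h (0 : (Fin i → G) → M) x = 0 := by
  have := capChain_sub_left B h 0 0 x
  rwa [sub_zero, sub_self] at this

theorem homologyClass_capChain_eq (B : Pairing M N P) {i j m : ℕ} (h : i + j = m)
    (f f' : (Fin i → G) → M) (x x' : (Fin m → G) →₀ N) (hf : IsCocycle f) (hx : IsCycle x)
    (hf' : IsCocycle f') (hx' : IsCycle x')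
    (hf2 : cohomologyClass f' hf' = cohomologyClass f hf)
    (hx2 : homologyClass x' hx' = homologyClass x hx) :
    homologyClass (capChain B h f' x') (hf'.cap B h hx') =
      homologyClass (capChain B h f x) (hf.cap B h hx) := by
  rw [homologyClass_eq_iff]
  obtain ⟨y, hy⟩ := (homologyClass_eq_iff _ _ _ _).1 hx2
  have hy' : dChain N m y = x' - x := hy
  have l2 := capChain_d B h f' y
  rw [show dCochain M i f' = 0 from hf', hy', capChain_zero_left, zero_add, map_sub] at l2
  have l1 : ∃ z, dChain P j z = capChain B h f' x - capChain B h f x := by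
    cases i with
    | zero =>
      have := (cohomologyClass_zero_eq_iff _ _ _ _).1 hf2
      subst this
      exact ⟨0, by simp⟩
    | succ i =>
      obtain ⟨e, he⟩ := (cohomologyClass_eq_iff _ _ _ _).1 hf2
      have he' : dCochain M i e = f' - f := he
      obtain ⟨m, rfl⟩ : ∃ m', m = m' + 1 := ⟨i + j, by omega⟩
      have l3 := capChain_d B (show i + j = m by omega) e x
      rw [hx.dChain_eq, he', capChain_sub_left, map_zero] at l3
      refine ⟨-((-1 : k) ^ i • capChain B (show i + (j + 1) = m + 1 by omega) e x), ?_⟩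
      rw [map_neg, map_smul]
      exact (eq_neg_of_add_eq_zero_left l3.symm).symm
  obtain ⟨z, hz⟩ := l1
  refine ⟨z + (-1 : k) ^ i • capChain B (show i + (j + 1) = m + 1 by omega) f' y, ?_⟩
  change dChain P j _ = _
  rw [map_add, map_smul, hz, ← l2]
  abel

/-- The cap product does not depend on the representing (co)cycles. -/
theorem cap_mk (B : Pairing M N P) {i j m : ℕ} (h : i + j = m)
    (f : (Fin i → G) → M) (x : (Fin m → G) →₀ N) (hf : IsCocycle f) (hx : IsCycle x) :
    cap B h (cohomologyClass f hf) (homologyClass x hx) =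
      homologyClass (capChain B h f x) (hf.cap B h hx) :=
  homologyClass_capChain_eq B h _ _ _ _ _ _ _ _
    (exists_cocycle (cohomologyClass f hf)).choose_spec.choose_spec
    (exists_cycle (homologyClass x hx)).choose_spec.choose_spec

end GroupHomology

section Cup

variable {k G : Type} [CommRing k] [Group G]

/-- The tensor product of finitely many `G`-modules, with the diagonal action. -/
noncomputable def tensorRep {r : ℕ} (M : Fin r → Rep.{0} k G) : Rep.{0} k G :=
  Rep.of (X := PiTensorProduct k fun i => M i)
    { toFun := fun g => PiTensorProduct.map fun i => (M i).ρ g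
      map_one' := by
        simp only [map_one]
        exact PiTensorProduct.map_id
      map_mul' := fun g h => by
        simp only [map_mul]
        exact PiTensorProduct.map_comp _ _ }

theorem lift_map_equivariant {r : ℕ} {M : Fin r → Type} {N P : Type} [∀ i, AddCommGroup (M i)]
    [∀ i, Module k (M i)] [AddCommGroup N] [Module k N] [AddCommGroup P] [Module k P]
    (b : MultilinearMap k M (N →ₗ[k] P)) (u : ∀ i, M i →ₗ[k] M i) (v : N →ₗ[k] N) (w : P →ₗ[k] P)
    (h : ∀ f n, b (fun i => u i (f i)) (v n) = w (b f n)) (m : PiTensorProduct k M) (n : N) :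
    PiTensorProduct.lift b (PiTensorProduct.map u m) (v n) = w (PiTensorProduct.lift b m n) := by
  induction m using PiTensorProduct.induction_on with
  | smul_tprod c f => simp [h]
  | add m m' hm hm' => simp only [map_add, LinearMap.add_apply, hm, hm']

/-- The equivariant pairing `(⨂ᵢ Mᵢ) × N → P` attached to an equivariant multilinear map
`∏ᵢ Mᵢ × N → P`. -/
noncomputable def tensorPairing {r : ℕ} (M : Fin r → Rep.{0} k G) (N P : Rep.{0} k G)
    (b : (∀ i, M i) → N → P)
    (update_add : ∀ f i (x y : M i) n, b (Function.update f i (x + y)) n =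
      b (Function.update f i x) n + b (Function.update f i y) n)
    (update_smul : ∀ f i (c : k) (x : M i) n, b (Function.update f i (c • x)) n =
      c • b (Function.update f i x) n)
    (add_right : ∀ f n n', b f (n + n') = b f n + b f n')
    (smul_right : ∀ f (c : k) n, b f (c • n) = c • b f n)
    (equivariant : ∀ g f n, b (fun i => (M i).ρ g (f i)) (N.ρ g n) = P.ρ g (b f n)) :
    Pairing (tensorRep M) N P where
  toFun := PiTensorProduct.lift
    { toFun := fun f =>
        { toFun := b f
          map_add' := add_right f
          map_smul' := smul_right f }
      map_update_add' := by
        intro inst f i x y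
        obtain rfl : inst = instDecidableEqFin r := Subsingleton.elim _ _
        exact LinearMap.ext fun n => update_add f i x y n
      map_update_smul' := by
        intro inst f i c x
        obtain rfl : inst = instDecidableEqFin r := Subsingleton.elim _ _
        exact LinearMap.ext fun n => update_smul f i c x n }
  equivariant g m n :=
    lift_map_equivariant _ (fun i => (M i).ρ g) (N.ρ g) (P.ρ g) (fun f n => equivariant g f n) m n

/-- The cup product of `1`-cochains `z₁, …, z_r`:
`(z₁ ∪ … ∪ z_r)(g₁, …, g_r) = ⨂ᵢ g₁⋯gᵢ₋₁ zᵢ(gᵢ)`. -/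
noncomputable def cupOne {r : ℕ} {M : Fin r → Rep.{0} k G} (z : ∀ i, G → M i) :
    (Fin r → G) → tensorRep M :=
  fun g => PiTensorProduct.tprod k fun i => (M i).ρ (Fin.partialProd g i.castSucc) (z i (g i))

theorem isCocycle_cupOne {r : ℕ} {M : Fin r → Rep.{0} k G} (z : ∀ i, G → M i)
    (hz : ∀ i g h, z i (g * h) = z i g + (M i).ρ g (z i h)) : IsCocycle (cupOne z) := by
  funext g
  let A : ℕ → tensorRep M := fun q => PiTensorProduct.tprod k fun i : Fin r =>
    if (i : ℕ) < q then (M i).ρ (Fin.partialProd g i.castSucc.castSucc) (z i (g i.castSucc))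
      else (M i).ρ (Fin.partialProd g i.succ.castSucc) (z i (g i.succ))
  have h0 : (tensorRep M).ρ (g 0) (cupOne z fun i => g i.succ) = A 0 := by
    refine (PiTensorProduct.map_tprod _ _).trans ?_
    simp only [A]
    congr 1
    funext i
    simp only [not_lt_zero, if_false]
    rw [← Module.End.mul_apply, ← map_mul]
    congr 2
    rw [← Fin.succ_castSucc, Fin.partialProd_succ']
    rfl
  have hl : ∀ q : Fin r, cupOne z (Fin.contractNth q.castSucc (· * ·) g) = A q + A (q + 1) := by
    intro q
    have hP : ∀ i : Fin r, Fin.partialProd (Fin.contractNth q.castSucc (· * ·) g) i.castSucc =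
        if (i : ℕ) ≤ q then Fin.partialProd g i.castSucc.castSucc
          else Fin.partialProd g i.succ.castSucc := by
      intro i
      have := congrFun (Fin.partialProd_contractNth g q.castSucc) i.castSucc
      refine this.trans ?_
      simp only [Function.comp]
      split_ifs with h
      · rw [Fin.succAbove_of_castSucc_lt]
        exact Fin.lt_def.2 (Nat.lt_succ_of_le h)
      · rw [Fin.succAbove_of_le_castSucc]
        · rfl
        · exact Fin.le_def.2 (Nat.lt_of_not_le h)
    let f : ∀ i : Fin r, M i := fun i =>
      if (i : ℕ) < q then (M i).ρ (Fin.partialProd g i.castSucc.castSucc) (z i (g i.castSucc))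
        else (M i).ρ (Fin.partialProd g i.succ.castSucc) (z i (g i.succ))
    have e1 : (fun i => (M i).ρ (Fin.partialProd (Fin.contractNth q.castSucc (· * ·) g) i.castSucc)
        (z i (Fin.contractNth q.castSucc (· * ·) g i))) = Function.update f q
          ((M q).ρ (Fin.partialProd g q.succ.castSucc) (z q (g q.succ)) +
          (M q).ρ (Fin.partialProd g q.castSucc.castSucc) (z q (g q.castSucc))) := by
      funext i
      rw [hP]
      rcases lt_trichotomy i q with h | h | h
      · rw [Function.update_of_ne h.ne, if_pos (Fin.le_def.1 h.le), Fin.contractNth_apply_of_lt _ _ _ _ (by simpa using h)]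
        simp only [f]
        rw [if_pos (by simpa using h)]
      · subst h
        rw [Function.update_self, if_pos le_rfl, Fin.contractNth_apply_of_eq _ _ _ _ (by simp), hz, map_add,
          ← Module.End.mul_apply, ← map_mul, add_comm, ← Fin.succ_castSucc, Fin.partialProd_succ]
      · rw [Function.update_of_ne h.ne', if_neg (not_le.2 (Fin.lt_def.1 h)), Fin.contractNth_apply_of_gt _ _ _ _ (by simpa using h)]
        simp only [f]
        rw [if_neg (by simpa using h.le)]
    unfold cupOne
    rw [e1, MultilinearMap.map_update_add]
    congr 1
    · simp only [A]
      congr 1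
      funext i
      rcases eq_or_ne i q with h | h
      · subst h
        simp
      · rw [Function.update_of_ne h]
    · simp only [A]
      congr 1
      funext i
      rcases eq_or_ne i q with h | h
      · subst h
        simp
      · rw [Function.update_of_ne h]
        simp only [f]
        have : (i : ℕ) < q ↔ (i : ℕ) < q + 1 := by
          have : (i : ℕ) ≠ q := fun h' => h (Fin.ext h')
          omega
        simp only [this]
  have hr : cupOne z (Fin.contractNth (Fin.last r) (· * ·) g) = A r := by
    unfold cupOne
    simp only [A]
    congr 1
    funext i
    have := congrFun (Fin.partialProd_contractNth g (Fin.last r)) i.castSucc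
    rw [this, if_pos i.2, Fin.contractNth_apply_of_lt _ _ _ _ (by simp)]
    simp only [Function.comp]
    rw [Fin.succAbove_of_castSucc_lt]
    simp [Fin.lt_def]
  have ht : ∀ q : ℕ, ∑ l : Fin q, (-1 : k) ^ ((l : ℕ) + 1) • (A l + A (l + 1)) =
      (-1 : k) ^ q • A q - A 0 := by
    intro q
    induction q with
    | zero => simp
    | succ q ih =>
      rw [Fin.sum_univ_castSucc]
      simp only [Fin.val_castSucc, Fin.val_last]
      rw [ih, pow_succ, mul_neg_one, smul_add, neg_smul]
      abel
  change dCochain (tensorRep M) r (cupOne z) g = 0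
  rw [dCochain_apply, Fin.sum_univ_castSucc, h0, hr]
  simp only [hl, Fin.val_castSucc, Fin.val_last, ht]
  rw [pow_succ, mul_neg_one, neg_smul]
  abel

end Cup

section Fundamental

variable {k E : Type} [CommRing k] [CommGroup E]

/-- For `ε₁, …, ε_m ∈ E` the chain `∑_π sgn(π) n ⊗ [ε_{π(1)} | … | ε_{π(m)}]`. -/
noncomputable def fundamentalChain (N : Rep.{0} k E) (n : N) {m : ℕ} (ε : Fin m → E) :
    (Fin m → E) →₀ N :=
  ∑ π : Equiv.Perm (Fin m), (((Equiv.Perm.sign π : ℤˣ) : ℤ) : k) •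
    Finsupp.single (fun i => ε (π i)) n

theorem isCycle_fundamentalChain {N : Rep.{0} k E} {n : N} (hn : ∀ g, N.ρ g n = n) {m : ℕ}
    (ε : Fin m → E) : IsCycle (fundamentalChain N n ε) := by
  cases m with
  | zero => exact isCycle_zero _
  | succ m =>
    apply isCycle_of_dChain_eq
    have h1 : ∀ (g : Fin (m + 1) → E), dChain N m (Finsupp.single g n) =
        Finsupp.single (fun i => g i.succ) n +
          ∑ l : Fin (m + 1), (-1 : k) ^ ((l : ℕ) + 1) •
            Finsupp.single (Fin.contractNth l (· * ·) g) n := fun g => by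
      rw [dChain_single, hn]
    let s : Equiv.Perm (Fin (m + 1)) → k := fun π => (((Equiv.Perm.sign π : ℤˣ) : ℤ) : k)
    have hsm : ∀ π ρ, s (π * ρ) = s π * s ρ := fun π ρ => by simp [s]
    change dChain N m (∑ π : Equiv.Perm (Fin (m + 1)), s π •
      Finsupp.single (fun i => ε (π i)) n) = 0
    rw [map_sum]
    simp only [map_smul, h1, Fin.sum_univ_castSucc, Finset.sum_add_distrib, smul_add,
      Finset.smul_sum, smul_comm (s _)]
    rw [Finset.sum_comm]
    have hmid : ∀ q : Fin m, ∑ π : Equiv.Perm (Fin (m + 1)), (-1 : k) ^ ((q.castSucc : ℕ) + 1) •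
        s π • Finsupp.single (Fin.contractNth q.castSucc (· * ·) fun i => ε (π i)) n = 0 := by
      intro q
      have hsw : ∀ π : Equiv.Perm (Fin (m + 1)),
          Fin.contractNth q.castSucc (· * ·) (fun i => ε ((π * Equiv.swap q.castSucc q.succ) i)) =
          Fin.contractNth q.castSucc (· * ·) (fun i => ε (π i)) := by
        intro π
        funext i
        rcases lt_trichotomy i q with h | h | h
        · rw [Fin.contractNth_apply_of_lt _ _ _ _ (by simpa using h),
            Fin.contractNth_apply_of_lt _ _ _ _ (by simpa using h), Equiv.Perm.mul_apply,
            Equiv.swap_apply_of_ne_of_ne]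
          · simpa using h.ne
          · intro h2
            have := congrArg Fin.val h2
            simp at this
            have h3 : (i : ℕ) < q := h
            omega
        · subst h
          rw [Fin.contractNth_apply_of_eq _ _ _ _ (by simp),
            Fin.contractNth_apply_of_eq _ _ _ _ (by simp), Equiv.Perm.mul_apply,
            Equiv.Perm.mul_apply, Equiv.swap_apply_left, Equiv.swap_apply_right, mul_comm]
        · rw [Fin.contractNth_apply_of_gt _ _ _ _ (by simpa using h),
            Fin.contractNth_apply_of_gt _ _ _ _ (by simpa using h), Equiv.Perm.mul_apply,
            Equiv.swap_apply_of_ne_of_ne]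
          · intro h2
            have := congrArg Fin.val h2
            simp at this
            have h3 : (q : ℕ) < i := h
            omega
          · simpa using h.ne'
      refine Finset.sum_involution (fun π _ => π * Equiv.swap q.castSucc q.succ) ?_ ?_ ?_ ?_
      · intro π _
        rw [hsw, hsm, ← smul_add, ← add_smul]
        have : s (Equiv.swap q.castSucc q.succ) = -1 := by
          simp only [s]
          rw [Equiv.Perm.sign_swap (by
            intro h; have := congrArg Fin.val h; simp at this)]
          simp
        rw [this]
        simp
      · intro π _ _ h
        have := Equiv.congr_fun (mul_eq_left.1 h) q.castSucc
        rw [Equiv.swap_apply_left] at this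
        simpa using congrArg Fin.val this
      · simp
      · intro π _
        simp [mul_assoc]
    rw [Finset.sum_eq_zero fun q _ => hmid q, zero_add, ← Finset.smul_sum]
    have hrot : ∑ π : Equiv.Perm (Fin (m + 1)),
        s π • Finsupp.single (Fin.contractNth (Fin.last m) (· * ·) fun i => ε (π i)) n =
        (-1 : k) ^ m • ∑ π : Equiv.Perm (Fin (m + 1)),
        s π • Finsupp.single (fun i : Fin m => ε (π i.succ)) n := by
      conv_lhs => rw [← Equiv.sum_comp (Equiv.mulRight (finRotate (m + 1)))]
      rw [Finset.smul_sum]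
      refine Finset.sum_congr rfl fun π _ => ?_
      have : (Fin.contractNth (Fin.last m) (· * ·) fun i => ε ((π * finRotate (m + 1)) i)) =
          fun i : Fin m => ε (π i.succ) := by
        funext i
        rw [Fin.contractNth_apply_of_lt _ _ _ _ (by simp), Equiv.Perm.mul_apply]
        congr 2
        rw [finRotate_apply]
        simp
      rw [Equiv.coe_mulRight, this, hsm, smul_smul, mul_comm]
      congr 2
      simp [s, sign_finRotate]
    rw [hrot, smul_smul, Fin.val_last, pow_succ, mul_neg_one, neg_mul, ← mul_pow]
    simp

end Fundamental

section FunctionModules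

variable (G X A : Type) [Group G] [TopologicalSpace X] [MulAction G X] [ContinuousConstSMul G X]
  [AddCommGroup A] [TopologicalSpace A] [IsTopologicalAddGroup A]

/-- The translate of a compactly supported function: `(g f)(x) = f(g⁻¹ x)`. -/
def ccTranslate {G X A : Type} [Group G] [TopologicalSpace X] [MulAction G X]
    [ContinuousConstSMul G X] [AddCommGroup A] [TopologicalSpace A] (g : G) (f : C_c(X, A)) :
    C_c(X, A) where
  toFun x := f (g⁻¹ • x)
  continuous_toFun := f.continuous.comp (continuous_const_smul g⁻¹)
  hasCompactSupport' := f.hasCompactSupport.comp_homeomorph (Homeomorph.smul g⁻¹)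

/-- The `G`-module `C_c(X, A)` of continuous functions with compact support. -/
noncomputable def ccRep : Rep.{0} ℤ G :=
  Rep.of (X := C_c(X, A))
    { toFun := fun g =>
        { toFun := ccTranslate g
          map_add' := fun _ _ => rfl
          map_smul' := fun _ _ => rfl }
      map_one' := by
        ext f x
        exact congrArg f (by simp)
      map_mul' := fun g h => by
        ext f x
        exact congrArg f (by rw [mul_inv_rev, mul_smul]) }

/-- The `G`-module `C(X, A)` of continuous functions. -/
noncomputable def cRep : Rep.{0} ℤ G :=
  Rep.of (X := C(X, A))
    { toFun := fun g =>
        { toFun := fun f => ⟨fun x => f (g⁻¹ • x), f.continuous.comp (continuous_const_smul g⁻¹)⟩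
          map_add' := fun _ _ => rfl
          map_smul' := fun _ _ => rfl }
      map_one' := by
        ext f x
        exact congrArg f (by simp)
      map_mul' := fun g h => by
        ext f x
        exact congrArg f (by rw [mul_inv_rev, mul_smul]) }

variable {G X A}

/-- The map `C_c(X, A) → C_c(X, B)` induced by a continuous homomorphism `A → B`. -/
noncomputable def ccMap {B : Type} [AddCommGroup B] [TopologicalSpace B] [IsTopologicalAddGroup B]
    (φ : A →+ B) (hφ : Continuous φ) : ccRep G X A ⟶ ccRep G X B :=
  Rep.ofHom ⟨
    { toFun := fun f : C_c(X, A) => (⟨⟨fun x => φ (f x), hφ.comp f.continuous⟩,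
        f.hasCompactSupport.comp_left (map_zero φ)⟩ : C_c(X, B))
      map_add' := fun f g => CompactlySupportedContinuousMap.ext fun x => map_add φ (f x) (g x)
      map_smul' := fun n f => CompactlySupportedContinuousMap.ext fun x => map_zsmul φ n (f x) },
    fun _ => rfl⟩

/-- Extension by zero along an open embedding. -/
noncomputable def extendZero {U : Type} [TopologicalSpace U] [T2Space X] (j : U → X)
    (hj : Topology.IsOpenEmbedding j) (f : C_c(U, A)) : C_c(X, A) where
  toFun := Function.extend j f 0
  continuous_toFun := by
    have hK : IsCompact (j '' tsupport f) := f.hasCompactSupport.image hj.continuous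
    rw [continuous_iff_continuousAt]
    intro x
    by_cases hx : x ∈ Set.range j
    · obtain ⟨u, rfl⟩ := hx
      rw [← hj.continuousAt_iff, Function.extend_comp hj.injective]
      exact f.continuous.continuousAt
    · have : Function.extend j f 0 =ᶠ[nhds x] fun _ => 0 := by
        filter_upwards [hK.isClosed.isOpen_compl.mem_nhds
          (show x ∈ (j '' tsupport f)ᶜ from fun h => hx (Set.image_subset_range _ _ h))] with y hy
        by_cases hy' : ∃ u, j u = y
        · obtain ⟨u, rfl⟩ := hy'
          rw [hj.injective.extend_apply]
          exact image_eq_zero_of_notMem_tsupport fun h => hy ⟨u, h, rfl⟩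
        · rw [Function.extend_apply' _ _ _ hy']
          rfl
      exact (continuousAt_const (y := (0 : A))).congr this.symm
  hasCompactSupport' := by
    have hK : IsCompact (j '' tsupport f) := f.hasCompactSupport.image hj.continuous
    refine hK.of_isClosed_subset isClosed_closure (closure_minimal ?_ hK.isClosed)
    intro y hy
    by_cases hy' : ∃ u, j u = y
    · obtain ⟨u, rfl⟩ := hy'
      rw [Function.mem_support, hj.injective.extend_apply] at hy
      exact ⟨u, subset_tsupport _ hy, rfl⟩
    · exact absurd (Function.extend_apply' _ _ _ hy') hy

theorem extendZero_apply {U : Type} [TopologicalSpace U] [T2Space X] {j : U → X}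
    (hj : Topology.IsOpenEmbedding j) (f : C_c(U, A)) (u : U) :
    extendZero j hj f (j u) = f u := hj.injective.extend_apply _ _ _

theorem extendZero_apply' {U : Type} [TopologicalSpace U] [T2Space X] {j : U → X}
    (hj : Topology.IsOpenEmbedding j) (f : C_c(U, A)) {x : X} (hx : x ∉ Set.range j) :
    extendZero j hj f x = 0 := Function.extend_apply' _ _ _ hx

/-- Extension by zero along an equivariant open embedding, as a map of `G`-modules. -/
noncomputable def extendZeroHom {U : Type} [TopologicalSpace U] [MulAction G U]
    [ContinuousConstSMul G U] [T2Space X] (j : U → X) (hj : Topology.IsOpenEmbedding j)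
    (hG : ∀ (g : G) u, j (g • u) = g • j u) : ccRep G U A ⟶ ccRep G X A :=
  Rep.ofHom ⟨
    { toFun := fun f : C_c(U, A) => (extendZero j hj f : C_c(X, A))
      map_add' := fun f g => CompactlySupportedContinuousMap.ext fun x => by
        change extendZero j hj (f + g) x = extendZero j hj f x + extendZero j hj g x
        by_cases hx : x ∈ Set.range j
        · obtain ⟨u, rfl⟩ := hx
          simp [extendZero_apply]
        · simp [extendZero_apply' hj _ hx]
      map_smul' := fun n f => CompactlySupportedContinuousMap.ext fun x => by
        change extendZero j hj (n • f) x = n • extendZero j hj f x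
        by_cases hx : x ∈ Set.range j
        · obtain ⟨u, rfl⟩ := hx
          simp [extendZero_apply]
        · simp [extendZero_apply' hj _ hx] },
    fun g => LinearMap.ext fun f => CompactlySupportedContinuousMap.ext fun x => by
      change extendZero j hj (ccTranslate g f) x = extendZero j hj f (g⁻¹ • x)
      by_cases hx : x ∈ Set.range j
      · obtain ⟨u, rfl⟩ := hx
        rw [← hG, extendZero_apply, extendZero_apply]
        rfl
      · rw [extendZero_apply' hj _ hx, extendZero_apply' hj]
        rintro ⟨u, hu⟩
        exact hx ⟨g • u, by rw [hG, hu, smul_inv_smul]⟩⟩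

/-- The pairing `C(X, A) × C_c(Z, ℤ) → C_c(X, A)`, `(ψ, φ) ↦ (x ↦ φ(π x) ψ(x))`, attached to a
proper equivariant map `π : X → Z`. -/
noncomputable def properPairing {Z : Type} [TopologicalSpace Z] [MulAction G Z]
    [ContinuousConstSMul G Z] (A : Type) [AddCommGroup A] [TopologicalSpace A]
    [IsTopologicalAddGroup A] (π : X → Z) (hπ : IsProperMap π)
    (hG : ∀ (g : G) x, π (g • x) = g • π x) :
    Pairing (cRep G X A) (ccRep G Z ℤ) (ccRep G X A) where
  toFun := LinearMap.mk₂ ℤ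
    (fun (ψ : C(X, A)) (φ : C_c(Z, ℤ)) => (⟨⟨fun x => φ (π x) • ψ x,
        (φ.continuous.comp hπ.continuous).smul ψ.continuous⟩, by
          refine (hπ.isCompact_preimage φ.hasCompactSupport).of_isClosed_subset isClosed_closure
            (closure_minimal ?_ (isClosed_closure.preimage hπ.continuous))
          intro x hx
          refine subset_tsupport _ ?_
          rw [Function.mem_support]
          intro h
          apply hx
          change φ (π x) • ψ x = 0
          rw [h, zero_smul]⟩ : C_c(X, A)))
    (fun _ _ _ => CompactlySupportedContinuousMap.ext fun _ => smul_add _ _ _)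
    (fun c (ψ : C(X, A)) (φ : C_c(Z, ℤ)) => CompactlySupportedContinuousMap.ext fun x =>
      smul_comm (φ (π x)) c (ψ x))
    (fun _ _ _ => CompactlySupportedContinuousMap.ext fun _ => add_smul _ _ _)
    (fun _ _ _ => CompactlySupportedContinuousMap.ext fun _ => mul_smul _ _ _)
  equivariant := fun g (m : C(X, A)) (n : C_c(Z, ℤ)) =>
    CompactlySupportedContinuousMap.ext fun x => by
      change n (g⁻¹ • π x) • m (g⁻¹ • x) = n (π (g⁻¹ • x)) • m (g⁻¹ • x)
      rw [hG]

/-- A continuous map `A₀ × A₁ × ⋯ × A_r → B` that is additive in each variable. -/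
structure ContinuousMultiadditive {r : ℕ} (A₀ : Type) (A : Fin r → Type) (B : Type)
    [AddCommGroup A₀] [∀ i, AddCommGroup (A i)] [AddCommGroup B] [TopologicalSpace A₀]
    [∀ i, TopologicalSpace (A i)] [TopologicalSpace B] where
  toFun : A₀ → (∀ i, A i) → B
  add_left : ∀ x x' y, toFun (x + x') y = toFun x y + toFun x' y
  update_add : ∀ x y i (a a' : A i), toFun x (Function.update y i (a + a')) =
    toFun x (Function.update y i a) + toFun x (Function.update y i a')
  continuous : Continuous fun p : A₀ × ∀ i, A i => toFun p.1 p.2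

section

variable {r : ℕ} {A₀ : Type} {A : Fin r → Type} {B : Type}
    [AddCommGroup A₀] [∀ i, AddCommGroup (A i)] [AddCommGroup B] [TopologicalSpace A₀]
    [∀ i, TopologicalSpace (A i)] [TopologicalSpace B]

theorem ContinuousMultiadditive.zero_left (μ : ContinuousMultiadditive A₀ A B) (y : ∀ i, A i) :
    μ.toFun 0 y = 0 := by
  have := μ.add_left 0 0 y
  rwa [add_zero, left_eq_add] at this

theorem ContinuousMultiadditive.zsmul_left (μ : ContinuousMultiadditive A₀ A B) (c : ℤ) (x : A₀)
    (y : ∀ i, A i) : μ.toFun (c • x) y = c • μ.toFun x y :=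
  map_zsmul (AddMonoidHom.mk' (fun a => μ.toFun a y) fun a b => μ.add_left a b y) c x

theorem ContinuousMultiadditive.update_zsmul (μ : ContinuousMultiadditive A₀ A B) (x : A₀)
    (y : ∀ i, A i) (i : Fin r) (c : ℤ) (a : A i) :
    μ.toFun x (Function.update y i (c • a)) = c • μ.toFun x (Function.update y i a) :=
  map_zsmul (AddMonoidHom.mk' (fun a => μ.toFun x (Function.update y i a))
    (μ.update_add x y i)) c a

theorem ContinuousMultiadditive.eq_zero (μ : ContinuousMultiadditive A₀ A B) (x : A₀)
    (y : ∀ i, A i) (i : Fin r) (hy : y i = 0) : μ.toFun x y = 0 := by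
  have := μ.update_add x y i 0 0
  rwa [add_zero, left_eq_add, ← hy, Function.update_eq_self] at this

variable {X : Fin r → Type} {Y : Type} [∀ i, TopologicalSpace (X i)] [TopologicalSpace Y]
  [IsTopologicalAddGroup A₀] [∀ i, IsTopologicalAddGroup (A i)] [IsTopologicalAddGroup B]

/-- The function `(x₁, …, x_r, y) ↦ μ(φ(y), f₁(x₁), …, f_r(x_r))`. -/
noncomputable def externalProduct (μ : ContinuousMultiadditive A₀ A B) (f : ∀ i, C_c(X i, A i))
    (φ : C_c(Y, A₀)) : C_c((∀ i, X i) × Y, B) where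
  toFun p := μ.toFun (φ p.2) fun i => f i (p.1 i)
  continuous_toFun := μ.continuous.comp ((φ.continuous.comp continuous_snd).prodMk
    (continuous_pi fun i => (f i).continuous.comp ((continuous_apply i).comp continuous_fst)))
  hasCompactSupport' := by
    refine ((isCompact_univ_pi fun i => (f i).hasCompactSupport).prod
      φ.hasCompactSupport).of_isClosed_subset isClosed_closure (closure_minimal ?_
        ((isClosed_set_pi fun i _ => isClosed_closure).prod isClosed_closure))
    intro p hp
    refine ⟨fun i _ => subset_tsupport _ fun h => hp ?_, subset_tsupport _ fun h => hp ?_⟩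
    · exact μ.eq_zero _ _ i h
    · change μ.toFun (φ p.2) _ = 0
      rw [h, μ.zero_left]

theorem eval_update (f : ∀ i, C_c(X i, A i)) (i : Fin r) (b : C_c(X i, A i)) (x : ∀ i, X i) :
    (fun l => (Function.update f i b l) (x l)) =
      Function.update (fun l => f l (x l)) i (b (x i)) :=
  funext fun l => Function.apply_update (fun l (b : C_c(X l, A l)) => b (x l)) f i b l

theorem externalProduct_update_add (μ : ContinuousMultiadditive A₀ A B) (f : ∀ i, C_c(X i, A i))
    (i : Fin r) (a a' : C_c(X i, A i)) (φ : C_c(Y, A₀)) :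
    externalProduct μ (Function.update f i (a + a')) φ =
      externalProduct μ (Function.update f i a) φ + externalProduct μ (Function.update f i a') φ :=
  CompactlySupportedContinuousMap.ext fun p => by
    change μ.toFun _ _ = μ.toFun _ _ + μ.toFun _ _
    rw [eval_update, eval_update, eval_update]
    exact μ.update_add _ _ _ _ _

theorem externalProduct_update_zsmul (μ : ContinuousMultiadditive A₀ A B)
    (f : ∀ i, C_c(X i, A i)) (i : Fin r) (c : ℤ) (a : C_c(X i, A i)) (φ : C_c(Y, A₀)) :
    externalProduct μ (Function.update f i (c • a)) φ =
      c • externalProduct μ (Function.update f i a) φ :=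
  CompactlySupportedContinuousMap.ext fun p => by
    change μ.toFun _ _ = c • μ.toFun _ _
    rw [eval_update, eval_update]
    exact μ.update_zsmul _ _ _ _ _

variable [∀ i, MulAction G (X i)] [∀ i, ContinuousConstSMul G (X i)] [MulAction G Y]
  [ContinuousConstSMul G Y]

/-- The pairing `(⨂ᵢ C_c(Xᵢ, Aᵢ)) × C_c(Y, A₀) → C_c(∏ᵢ Xᵢ × Y, B)`,
`(⨂ᵢ fᵢ, φ) ↦ ((x₁, …, x_r, y) ↦ μ(φ(y), f₁(x₁), …, f_r(x_r)))`. -/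
noncomputable def externalPairing (μ : ContinuousMultiadditive A₀ A B) :
    Pairing (tensorRep fun i => ccRep G (X i) (A i)) (ccRep G Y A₀)
      (ccRep G ((∀ i, X i) × Y) B) :=
  tensorPairing (fun i => ccRep G (X i) (A i)) (ccRep G Y A₀) (ccRep G ((∀ i, X i) × Y) B)
    (externalProduct μ)
    (externalProduct_update_add μ) (externalProduct_update_zsmul μ)
    (fun f φ φ' => CompactlySupportedContinuousMap.ext fun p => μ.add_left _ _ _)
    (fun f c φ => CompactlySupportedContinuousMap.ext fun p => μ.zsmul_left c _ _)
    (fun _ _ _ => rfl)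

end

end FunctionModules

open NumberField IsDedekindDomain HeightOneSpectrum

section Ideles

variable (F : Type) [Field F] [NumberField F]

/-- The idele group of `F`. -/
abbrev Idele : Type := (AdeleRing (𝓞 F) F)ˣ

variable {F}

/-- The component of an idele at a nonarchimedean place. -/
noncomputable def finComp (v : HeightOneSpectrum (𝓞 F)) : Idele F →* (v.adicCompletion F)ˣ :=
  Units.map
    { toFun := fun x => x.2 v
      map_one' := rfl
      map_mul' := fun _ _ => rfl }

/-- The component of an idele at an archimedean place. -/
noncomputable def infComp (w : InfinitePlace F) : Idele F →* w.Completionˣ :=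
  Units.map
    { toFun := fun x => x.1 w
      map_one' := rfl
      map_mul' := fun _ _ => rfl }

theorem continuous_finComp (v : HeightOneSpectrum (𝓞 F)) : Continuous (finComp v) :=
  Continuous.units_map _ ((RestrictedProduct.continuous_eval v).comp continuous_snd)

theorem continuous_infComp (w : InfinitePlace F) : Continuous (infComp w) :=
  Continuous.units_map _ ((continuous_apply w).comp continuous_fst)

theorem idele_ext {x y : Idele F} (h : ∀ v, finComp v x = finComp v y)
    (h' : ∀ w, infComp w x = infComp w y) : x = y :=
  Units.ext (Prod.ext (funext fun w => congrArg Units.val (h' w))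
    (FiniteAdeleRing.ext (K := F) fun v => congrArg Units.val (h v)))

/-- The embedding of `F` into the ideles. -/
noncomputable def principal : Fˣ →* Idele F := Units.map (algebraMap F (AdeleRing (𝓞 F) F))

open Classical in
/-- The idele with component `a` at `v` and `1` elsewhere, as an element of the adele ring. -/
noncomputable def singleAdele (v : HeightOneSpectrum (𝓞 F)) :
    v.adicCompletion F →* AdeleRing (𝓞 F) F where
  toFun a := ((1 : InfiniteAdeleRing F), (RestrictedProduct.mulSingle
    (fun v : HeightOneSpectrum (𝓞 F) => v.adicCompletionIntegers F) v a : FiniteAdeleRing (𝓞 F) F))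
  map_one' := Prod.ext rfl (RestrictedProduct.mulSingle_one _ v)
  map_mul' a b := Prod.ext (mul_one (1 : InfiniteAdeleRing F)).symm
    (RestrictedProduct.mulSingle_mul _ v a b)

open Classical in
theorem continuous_singleAdele (v : HeightOneSpectrum (𝓞 F)) : Continuous (singleAdele v) := by
  refine continuous_const.prodMk ?_
  have h : Filter.cofinite ≤ Filter.principal ({v}ᶜ : Set (HeightOneSpectrum (𝓞 F))) :=
    Filter.le_principal_iff.2 (Set.finite_singleton v).compl_mem_cofinite
  have hc := RestrictedProduct.continuous_inclusion
    (R := fun v : HeightOneSpectrum (𝓞 F) => v.adicCompletion F)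
    (A := fun v : HeightOneSpectrum (𝓞 F) => (v.adicCompletionIntegers F : Set _)) h
  have hg : ∀ a : v.adicCompletion F, ∀ᶠ w in Filter.principal ({v}ᶜ : Set (HeightOneSpectrum (𝓞 F))),
      (Pi.mulSingle v a : ∀ w : HeightOneSpectrum (𝓞 F), w.adicCompletion F) w ∈
        (w.adicCompletionIntegers F : Set (w.adicCompletion F)) := by
    intro a
    rw [Filter.eventually_principal]
    intro w hw
    rw [Pi.mulSingle_eq_of_ne hw]
    exact one_mem _
  refine hc.comp (f := fun a => ⟨_, hg a⟩) ?_
  refine RestrictedProduct.continuous_rng_of_principal.2 (continuous_pi fun w => ?_)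
  exact (continuous_apply w).comp (continuous_mulSingle
    (A := fun v : HeightOneSpectrum (𝓞 F) => v.adicCompletion F) v)

/-- The embedding `F_vˣ → 𝔸ˣ`. -/
noncomputable def single (v : HeightOneSpectrum (𝓞 F)) : (v.adicCompletion F)ˣ →* Idele F :=
  Units.map (singleAdele v)

theorem continuous_single (v : HeightOneSpectrum (𝓞 F)) : Continuous (single v) :=
  Continuous.units_map _ (continuous_singleAdele v)

theorem finComp_single_self (v : HeightOneSpectrum (𝓞 F)) (a : (v.adicCompletion F)ˣ) :
    finComp v (single v a) = a := by
  classical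
  exact Units.ext (Pi.mulSingle_eq_same v _)

theorem finComp_single_of_ne {v w : HeightOneSpectrum (𝓞 F)} (h : w ≠ v)
    (a : (v.adicCompletion F)ˣ) : finComp w (single v a) = 1 := by
  classical
  exact Units.ext (Pi.mulSingle_eq_of_ne h _)

theorem infComp_single (v : HeightOneSpectrum (𝓞 F)) (w : InfinitePlace F)
    (a : (v.adicCompletion F)ˣ) : infComp w (single v a) = 1 :=
  Units.ext rfl

end Ideles

section Local

variable {F : Type} [Field F] [NumberField F] (v : HeightOneSpectrum (𝓞 F))

theorem isClopen_valued_lt_one : IsClopen {y : v.adicCompletion F | Valued.v y < 1} := by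
  have := Valued.isClopen_ball (v.adicCompletion F)
    (1 : MonoidWithZeroHom.ValueGroup₀
      (.ofClass (Valued.v : Valuation (v.adicCompletion F) (WithZero (Multiplicative ℤ)))))
  simpa only [Valuation.restrict_lt_one_iff] using this

theorem isClopen_valued_le_one : IsClopen {y : v.adicCompletion F | Valued.v y ≤ 1} :=
  Valued.isClopen_integer (v.adicCompletion F)

theorem isClopen_valued_eq_one : IsClopen {y : v.adicCompletion F | Valued.v y = 1} := by
  have := (isClopen_valued_le_one v).diff (isClopen_valued_lt_one v)
  convert this using 1
  ext y
  simp [le_antisymm_iff]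

theorem exists_integer_sub_lt_one (x : v.adicCompletion F) (hx : Valued.v x ≤ 1) :
    ∃ a : 𝓞 F, Valued.v (x - algebraMap F (v.adicCompletion F) (algebraMap (𝓞 F) F a)) < 1 := by
  obtain ⟨k, hk⟩ := (denseRange_algebraMap (R := 𝓞 F) (K := F) v).exists_mem_open
    (s := (fun y => x - y) ⁻¹' {y | Valued.v y < 1})
    ((isClopen_valued_lt_one v).2.preimage (continuous_const.sub continuous_id)) ⟨x, by simp⟩
  have hk' : Valued.v (x - algebraMap F (v.adicCompletion F) k) < 1 := hk
  have hk1 : v.valuation F k ≤ 1 := by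
    rw [← valuedAdicCompletion_eq_valuation']
    have h := Valuation.map_sub (Valued.v : Valuation (v.adicCompletion F) _) x
      (x - algebraMap F (v.adicCompletion F) k)
    rw [sub_sub_cancel] at h
    exact h.trans (max_le hx hk'.le)
  obtain ⟨a, ha⟩ := v.exists_valuation_sub_lt_of_integer hk1 1
  refine ⟨a, ?_⟩
  have h2 : Valued.v (algebraMap F (v.adicCompletion F) k -
      algebraMap F (v.adicCompletion F) (algebraMap (𝓞 F) F a)) < 1 := by
    rw [← map_sub, ← Valuation.map_neg, ← map_neg, neg_sub]
    have := valuedAdicCompletion_eq_valuation' v (algebraMap (𝓞 F) F a - k)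
    exact this.trans_lt ha
  have h3 := Valuation.map_add_lt _ hk' h2
  rwa [sub_add_sub_cancel] at h3

theorem residue_eq_zero (x : Valued.integer (v.adicCompletion F))
    (hx : Valued.v (x : v.adicCompletion F) < 1) :
    IsLocalRing.residue (Valued.integer (v.adicCompletion F)) x = 0 := by
  rw [IsLocalRing.residue_eq_zero_iff, IsLocalRing.mem_maximalIdeal, mem_nonunits_iff]
  intro h
  obtain ⟨y, hy⟩ := h.exists_right_inv
  have h1 : Valued.v (x : v.adicCompletion F) * Valued.v (y : v.adicCompletion F) = 1 := by
    rw [← map_mul, ← map_one (Valued.v : Valuation (v.adicCompletion F) _)]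
    exact congrArg _ (congrArg Subtype.val hy)
  exact (mul_lt_one_of_nonneg_of_lt_one_left zero_le hx y.2).ne h1

theorem compactSpace_integer : CompactSpace (Valued.integer (v.adicCompletion F)) := by
  rw [Valued.integer.compactSpace_iff_completeSpace_and_isDiscreteValuationRing_and_finite_residueField]
  refine ⟨?_, inferInstanceAs (IsDiscreteValuationRing (v.adicCompletionIntegers F)), ?_⟩
  · exact (Valued.isClosed_integer (v.adicCompletion F)).completeSpace_coe
  · have hfin : Finite (𝓞 F ⧸ v.asIdeal) := Ideal.finiteQuotientOfFreeOfNeBot _ v.ne_bot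
    let f : 𝓞 F →+* Valued.integer (v.adicCompletion F) :=
      algebraMap (𝓞 F) (v.adicCompletionIntegers F)
    let g := (IsLocalRing.residue (Valued.integer (v.adicCompletion F))).comp f
    have hg : ∀ a ∈ v.asIdeal, g a = 0 := by
      intro a ha
      apply residue_eq_zero
      have h := valuedAdicCompletion_eq_valuation' v (algebraMap (𝓞 F) F a)
      have h2 := (v.valuation_lt_one_iff_mem (K := F) a).2 ha
      exact h.trans_lt h2
    refine Finite.of_surjective (Ideal.Quotient.lift v.asIdeal g hg) ?_
    apply Ideal.Quotient.lift_surjective_of_surjective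
    intro y
    obtain ⟨x, rfl⟩ := IsLocalRing.residue_surjective y
    obtain ⟨a, ha⟩ := exists_integer_sub_lt_one v (x : v.adicCompletion F) x.2
    refine ⟨a, ?_⟩
    have := residue_eq_zero v (x - f a) ha
    rw [map_sub, sub_eq_zero] at this
    exact this.symm

theorem isCompact_valued_le_one : IsCompact {y : v.adicCompletion F | Valued.v y ≤ 1} :=
  isCompact_iff_compactSpace.2 (compactSpace_integer v)

theorem isCompact_units_valued_eq_one :
    IsCompact {y : (v.adicCompletion F)ˣ | Valued.v (y : v.adicCompletion F) = 1} := by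
  have h : IsCompact {y : v.adicCompletion F | Valued.v y = 1} :=
    (isCompact_valued_le_one v).of_isClosed_subset (isClopen_valued_eq_one v).1 fun y hy => hy.le
  refine (Units.isEmbedding_val₀.isInducing.isCompact_preimage_iff ?_).2 h
  intro y hy
  have : y ≠ 0 := by
    rintro rfl
    simp at hy
  exact ⟨Units.mk0 y this, rfl⟩

end Local

section AdelicQuotients

variable {F : Type} [Field F] [NumberField F]

/-- The sign condition `x_w > 0` at a real place, for a totally real field. -/
def IsPos [IsTotallyReal F] (w : InfinitePlace F) (x : w.Completion) : Prop :=
  0 < InfinitePlace.Completion.extensionEmbeddingOfIsReal (IsTotallyReal.isReal w) x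

/-- `(𝔸^T)ˣ`, realised as the group of ideles with component `1` at all places in `T`. -/
def idelesAway (T : Finset (HeightOneSpectrum (𝓞 F))) : Subgroup (Idele F) where
  carrier := {x | ∀ v ∈ T, finComp v x = 1}
  mul_mem' hx hy v hv := by rw [map_mul, hx v hv, hy v hv, mul_one]
  one_mem' v _ := map_one _
  inv_mem' hx v hv := by rw [map_inv, hx v hv, inv_one]

/-- `U^S = ∏_{v ∉ S} U_v`, with component `1` at all places in `S`; here `U_v = O_vˣ` for `v`
nonarchimedean and `U_v = ℝ_{>0}` for `v` archimedean. -/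
def unitsAway [IsTotallyReal F] (S : Finset (HeightOneSpectrum (𝓞 F))) : Subgroup (Idele F) where
  carrier := {x | (∀ v ∈ S, finComp v x = 1) ∧
    (∀ v ∉ S, Valued.v (finComp v x : v.adicCompletion F) = 1) ∧
    ∀ w, IsPos w (infComp w x : w.Completion)}
  mul_mem' hx hy := by
    refine ⟨fun v hv => ?_, fun v hv => ?_, fun w => ?_⟩
    · rw [map_mul, hx.1 v hv, hy.1 v hv, mul_one]
    · rw [map_mul, Units.val_mul, map_mul, hx.2.1 v hv, hy.2.1 v hv, mul_one]
    · unfold IsPos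
      rw [map_mul, Units.val_mul, map_mul]
      exact mul_pos (hx.2.2 w) (hy.2.2 w)
  one_mem' := by
    refine ⟨fun v hv => map_one _, fun v hv => ?_, fun w => ?_⟩
    · rw [map_one, Units.val_one, map_one]
    · unfold IsPos
      rw [map_one, Units.val_one, map_one]
      exact one_pos
  inv_mem' {x} hx := by
    refine ⟨fun v hv => ?_, fun v hv => ?_, fun w => ?_⟩
    · rw [map_inv, hx.1 v hv, inv_one]
    · rw [map_inv, Units.val_inv_eq_inv_val, map_inv₀, hx.2.1 v hv, inv_one]
    · unfold IsPos
      rw [map_inv, Units.val_inv_eq_inv_val, map_inv₀]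
      exact inv_pos.2 (hx.2.2 w)

/-- The projection `𝔸ˣ → (𝔸^T)ˣ`, replacing the components in `T` by `1`. -/
noncomputable def projAway (T : Finset (HeightOneSpectrum (𝓞 F))) : Idele F →* idelesAway T where
  toFun x := ⟨x * ∏ v ∈ T, single v (finComp v x)⁻¹, fun v hv => by
    rw [map_mul, map_prod, Finset.prod_eq_single_of_mem v hv
      fun w _ hw => finComp_single_of_ne hw.symm _, finComp_single_self, mul_inv_cancel]⟩
  map_one' := by simp
  map_mul' x y := Subtype.ext (by
    simp only [map_mul, mul_inv, Finset.prod_mul_distrib, Subgroup.coe_mul]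
    exact mul_mul_mul_comm _ _ _ _)

theorem finComp_projAway_of_notMem {T : Finset (HeightOneSpectrum (𝓞 F))}
    {v : HeightOneSpectrum (𝓞 F)} (hv : v ∉ T) (x : Idele F) :
    finComp v (projAway T x : Idele F) = finComp v x := by
  change finComp v (x * ∏ v ∈ T, single v (finComp v x)⁻¹) = _
  rw [map_mul, map_prod, Finset.prod_eq_one, mul_one]
  intro w hw
  exact finComp_single_of_ne (fun h => hv (by rw [h]; exact hw)) _

theorem finComp_projAway_of_mem {T : Finset (HeightOneSpectrum (𝓞 F))}
    {v : HeightOneSpectrum (𝓞 F)} (hv : v ∈ T) (x : Idele F) :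
    finComp v (projAway T x : Idele F) = 1 := (projAway T x).2 v hv

theorem infComp_projAway (T : Finset (HeightOneSpectrum (𝓞 F))) (w : InfinitePlace F)
    (x : Idele F) : infComp w (projAway T x : Idele F) = infComp w x := by
  change infComp w (x * ∏ v ∈ T, single v (finComp v x)⁻¹) = _
  rw [map_mul, map_prod, Finset.prod_eq_one, mul_one]
  intro v hv
  exact infComp_single _ _ _

theorem projAway_coe {T : Finset (HeightOneSpectrum (𝓞 F))} (x : idelesAway T) :
    projAway T (x : Idele F) = x := by
  apply Subtype.ext
  apply idele_ext
  · intro v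
    by_cases hv : v ∈ T
    · rw [finComp_projAway_of_mem hv, x.2 v hv]
    · rw [finComp_projAway_of_notMem hv]
  · intro w
    rw [infComp_projAway]

theorem continuous_projAway (T : Finset (HeightOneSpectrum (𝓞 F))) :
    Continuous (projAway T) :=
  Continuous.subtype_mk (continuous_id.mul (continuous_finsetProd _ fun v _ =>
    (continuous_single v).comp (continuous_finComp v).inv)) _

variable [IsTotallyReal F]

/-- The group `(𝔸^T)ˣ / U^S` (used for `T ⊆ S`), with the quotient topology. -/
def AdelicQuotient (T S : Finset (HeightOneSpectrum (𝓞 F))) : Type :=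
  idelesAway T ⧸ (unitsAway S).subgroupOf (idelesAway T)

variable (T S : Finset (HeightOneSpectrum (𝓞 F)))

noncomputable instance : CommGroup (AdelicQuotient T S) :=
  inferInstanceAs (CommGroup (idelesAway T ⧸ (unitsAway S).subgroupOf (idelesAway T)))

noncomputable instance : TopologicalSpace (AdelicQuotient T S) :=
  inferInstanceAs (TopologicalSpace (idelesAway T ⧸ (unitsAway S).subgroupOf (idelesAway T)))

instance : IsTopologicalGroup (AdelicQuotient T S) :=
  inferInstanceAs (IsTopologicalGroup (idelesAway T ⧸ (unitsAway S).subgroupOf (idelesAway T)))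

/-- The projection `(𝔸^T)ˣ → (𝔸^T)ˣ / U^S`. -/
noncomputable def quotientMk : idelesAway T →* AdelicQuotient T S :=
  QuotientGroup.mk' ((unitsAway S).subgroupOf (idelesAway T))

theorem isOpenQuotientMap_quotientMk : IsOpenQuotientMap (quotientMk T S) :=
  QuotientGroup.isOpenQuotientMap_mk

theorem quotientMk_eq_one_iff (x : idelesAway T) :
    quotientMk T S x = 1 ↔ (x : Idele F) ∈ unitsAway S :=
  (QuotientGroup.eq_one_iff x).trans Subgroup.mem_subgroupOf

/-- The projection `𝔸ˣ → (𝔸^T)ˣ / U^S`. -/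
noncomputable def toQuotient : Idele F →* AdelicQuotient T S := (quotientMk T S).comp (projAway T)

theorem continuous_toQuotient : Continuous (toQuotient T S) :=
  (isOpenQuotientMap_quotientMk T S).continuous.comp (continuous_projAway T)

/-- The action of `Fˣ` on `(𝔸^T)ˣ / U^S`, by multiplication. -/
noncomputable instance : MulAction Fˣ (AdelicQuotient T S) :=
  MulAction.compHom (AdelicQuotient T S) ((toQuotient T S).comp principal)

variable {T S} in
theorem smul_def (g : Fˣ) (y : AdelicQuotient T S) :
    g • y = toQuotient T S (principal g) * y := rfl

instance : ContinuousConstSMul Fˣ (AdelicQuotient T S) :=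
  ⟨fun _ => continuous_const.mul continuous_id⟩

theorem continuous_extensionEmbedding (w : InfinitePlace F) : Continuous
    (InfinitePlace.Completion.extensionEmbeddingOfIsReal (IsTotallyReal.isReal w)) :=
  (InfinitePlace.Completion.isometry_extensionEmbeddingOfIsReal _).continuous

theorem isClosed_unitsAway : IsClosed (unitsAway S : Set (Idele F)) := by
  have h : (unitsAway S : Set (Idele F)) =
      (⋂ v ∈ S, finComp v ⁻¹' {1}) ∩
      ((⋂ v ∈ (S : Set (HeightOneSpectrum (𝓞 F)))ᶜ,
        (fun x : Idele F => (finComp v x : v.adicCompletion F)) ⁻¹' {y | Valued.v y = 1}) ∩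
      ⋂ w, (fun x : Idele F => InfinitePlace.Completion.extensionEmbeddingOfIsReal
        (IsTotallyReal.isReal w) (infComp w x : w.Completion)) ⁻¹' Set.Ici 0) := by
    ext x
    simp only [Set.mem_inter_iff, Set.mem_iInter, Set.mem_preimage, Set.mem_Ici]
    refine and_congr Iff.rfl (and_congr Iff.rfl (forall_congr' fun w => ?_))
    exact ⟨le_of_lt, fun h => lt_of_le_of_ne h fun h2 => (infComp w x).ne_zero
      ((map_eq_zero _).1 h2.symm)⟩
  rw [h]
  refine (isClosed_biInter fun v _ => isClosed_singleton.preimage (continuous_finComp v)).inter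
    ((isClosed_biInter fun v _ => (isClopen_valued_eq_one v).1.preimage
      (Units.continuous_val.comp (continuous_finComp v))).inter
    (isClosed_iInter fun w => isClosed_Ici.preimage ((continuous_extensionEmbedding w).comp
      (Units.continuous_val.comp (continuous_infComp w)))))

instance : T2Space (AdelicQuotient T S) := by
  have : IsClosed (((unitsAway S).subgroupOf (idelesAway T) : Subgroup (idelesAway T)) :
      Set (idelesAway T)) := (isClosed_unitsAway S).preimage continuous_subtype_val
  exact inferInstanceAs (T2Space (idelesAway T ⧸ (unitsAway S).subgroupOf (idelesAway T)))

theorem isOpen_integral_adeles :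
    IsOpen {x : FiniteAdeleRing (𝓞 F) F | ∀ v, x v ∈ v.adicCompletionIntegers F} := by
  have h : ∀ v : HeightOneSpectrum (𝓞 F),
      IsOpen (v.adicCompletionIntegers F : Set (v.adicCompletion F)) :=
    fun v => Valued.isOpen_valuationSubring _
  exact RestrictedProduct.isOpen_forall_mem h

theorem isOpen_unitsAway_subgroupOf :
    IsOpen (((unitsAway T).subgroupOf (idelesAway T) : Subgroup (idelesAway T)) :
      Set (idelesAway T)) := by
  have h1 : IsOpen {x : Idele F | (∀ v, (finComp v x : v.adicCompletion F) ∈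
      v.adicCompletionIntegers F) ∧ (∀ v, (finComp v x⁻¹ : v.adicCompletion F) ∈
      v.adicCompletionIntegers F) ∧ ∀ w, IsPos w (infComp w x : w.Completion)} := by
    have h2 : Continuous fun x : Idele F => (x : AdeleRing (𝓞 F) F).2 :=
      continuous_snd.comp Units.continuous_val
    refine IsOpen.inter (isOpen_integral_adeles.preimage h2)
      (IsOpen.inter (isOpen_integral_adeles.preimage (h2.comp continuous_inv)) ?_)
    have : {x : Idele F | ∀ w, IsPos w (infComp w x : w.Completion)} =
        ⋂ w, (fun x : Idele F => InfinitePlace.Completion.extensionEmbeddingOfIsReal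
        (IsTotallyReal.isReal w) (infComp w x : w.Completion)) ⁻¹' Set.Ioi 0 := by
      ext x
      simp [IsPos]
    change IsOpen {x : Idele F | ∀ w, IsPos w (infComp w x : w.Completion)}
    rw [this]
    exact isOpen_iInter_of_finite fun w => isOpen_Ioi.preimage
      ((continuous_extensionEmbedding w).comp
      (Units.continuous_val.comp (continuous_infComp w)))
  convert h1.preimage (continuous_subtype_val (p := fun x => x ∈ idelesAway T)) using 1
  ext x
  simp only [SetLike.mem_coe, Subgroup.mem_subgroupOf, Set.mem_preimage, Set.mem_ofPred_eq,
    mem_adicCompletionIntegers]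
  constructor
  · rintro ⟨h1, h2, h3⟩
    have h4 : ∀ v, Valued.v (finComp v (x : Idele F) : v.adicCompletion F) = 1 := by
      intro v
      by_cases hv : v ∈ T
      · rw [h1 v hv, Units.val_one, map_one]
      · exact h2 v hv
    refine ⟨fun v => (h4 v).le, fun v => ?_, h3⟩
    rw [map_inv, Units.val_inv_eq_inv_val, map_inv₀, h4, inv_one]
  · rintro ⟨h1, h2, h3⟩
    refine ⟨x.2, fun v hv => le_antisymm (h1 v) ?_, h3⟩
    have := h2 v
    rw [map_inv, Units.val_inv_eq_inv_val, map_inv₀] at this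
    exact (inv_le_one₀ (by simp [zero_lt_iff])).1 this

instance : DiscreteTopology (AdelicQuotient T T) :=
  QuotientGroup.discreteTopology (isOpen_unitsAway_subgroupOf T)

end AdelicQuotients

section Maps

variable {F : Type} [Field F] [NumberField F] [IsTotallyReal F]
  {T S : Finset (HeightOneSpectrum (𝓞 F))}

theorem unitsAway_anti (h : T ⊆ S) : unitsAway S ≤ unitsAway T := by
  refine fun x hx => ⟨fun v hv => hx.1 v (h hv), fun v hv => ?_, hx.2.2⟩
  by_cases hv' : v ∈ S
  · rw [hx.1 v hv', Units.val_one, map_one]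
  · exact hx.2.1 v hv'

/-- The projection `(𝔸^T)ˣ / U^S → (𝔸^T)ˣ / U^T` for `T ⊆ S`. -/
noncomputable def coarsen (h : T ⊆ S) : AdelicQuotient T S →* AdelicQuotient T T :=
  QuotientGroup.lift _ (quotientMk T T) fun x hx =>
    (quotientMk_eq_one_iff T T x).2 (unitsAway_anti h (Subgroup.mem_subgroupOf.1 hx))

theorem coarsen_quotientMk (h : T ⊆ S) (x : idelesAway T) :
    coarsen h (quotientMk T S x) = quotientMk T T x := rfl

theorem coarsen_smul (h : T ⊆ S) (g : Fˣ) (y : AdelicQuotient T S) :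
    coarsen h (g • y) = g • coarsen h y := by
  rw [smul_def, map_mul]
  rfl

theorem continuous_coarsen (h : T ⊆ S) : Continuous (coarsen h) :=
  (isOpenQuotientMap_quotientMk T S).isQuotientMap.continuous_iff.2
    (isOpenQuotientMap_quotientMk T T).continuous

theorem isCompact_coarsen_preimage_one (h : T ⊆ S) : IsCompact (coarsen h ⁻¹' {1}) := by
  have hC : IsCompact ((fun u : ∀ v : HeightOneSpectrum (𝓞 F), (v.adicCompletion F)ˣ =>
      toQuotient T S (∏ v ∈ S, single v (u v))) ''
      Set.pi Set.univ fun v => {y | Valued.v (y : v.adicCompletion F) = 1}) :=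
    (isCompact_univ_pi fun v => isCompact_units_valued_eq_one v).image
      ((continuous_toQuotient T S).comp (continuous_finsetProd _ fun v _ =>
        (continuous_single v).comp (continuous_apply v)))
  refine hC.of_isClosed_subset (isClosed_singleton.preimage (continuous_coarsen h)) ?_
  intro y hy
  obtain ⟨x, rfl⟩ := (isOpenQuotientMap_quotientMk T S).surjective y
  have hx : (x : Idele F) ∈ unitsAway T := (quotientMk_eq_one_iff T T x).1 hy
  refine ⟨fun v => finComp v (x : Idele F), fun v _ => ?_, ?_⟩
  · by_cases hv : v ∈ T
    · change Valued.v (finComp v (x : Idele F) : v.adicCompletion F) = 1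
      rw [hx.1 v hv, Units.val_one, map_one]
    · exact hx.2.1 v hv
  · change quotientMk T S (projAway T (∏ v ∈ S, single v (finComp v (x : Idele F)))) = _
    rw [← inv_mul_eq_one, ← map_inv, ← map_mul, quotientMk_eq_one_iff]
    have hS : ∀ v ∈ S, finComp v (∏ v ∈ S, single v (finComp v (x : Idele F))) =
        finComp v (x : Idele F) := by
      intro v hv
      rw [map_prod, Finset.prod_eq_single_of_mem v hv
        fun w _ hw => finComp_single_of_ne hw.symm _, finComp_single_self]
    have hS' : ∀ v ∉ S, finComp v (∏ v ∈ S, single v (finComp v (x : Idele F))) = 1 := by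
      intro v hv
      rw [map_prod, Finset.prod_eq_one]
      intro w hw
      exact finComp_single_of_ne (fun h => hv (by rw [h]; exact hw)) _
    refine ⟨fun v hv => ?_, fun v hv => ?_, fun w => ?_⟩
    · rw [Subgroup.coe_mul, Subgroup.coe_inv, map_mul, map_inv]
      by_cases hv' : v ∈ T
      · rw [finComp_projAway_of_mem hv', x.2 v hv', inv_one, one_mul]
      · rw [finComp_projAway_of_notMem hv', hS v hv, inv_mul_cancel]
    · rw [Subgroup.coe_mul, Subgroup.coe_inv, map_mul, map_inv,
        finComp_projAway_of_notMem (fun h' => hv (h h')), hS' v hv, inv_one, one_mul]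
      exact hx.2.1 v fun h' => hv (h h')
    · have : infComp w (∏ v ∈ S, single v (finComp v (x : Idele F))) = 1 := by
        rw [map_prod, Finset.prod_eq_one]
        intro v _
        exact infComp_single _ _ _
      rw [Subgroup.coe_mul, Subgroup.coe_inv, map_mul, map_inv, infComp_projAway, this, inv_one,
        one_mul]
      exact hx.2.2 w

theorem isProperMap_coarsen (h : T ⊆ S) : IsProperMap (coarsen h) := by
  rw [isProperMap_iff_isCompact_preimage]
  refine ⟨continuous_coarsen h, fun K hK => ?_⟩
  have hfin : K.Finite := hK.finite_of_discrete
  rw [← Set.biUnion_preimage_singleton]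
  refine hfin.isCompact_biUnion fun k _ => ?_
  obtain ⟨x, rfl⟩ := (isOpenQuotientMap_quotientMk T T).surjective k
  have : coarsen h ⁻¹' {quotientMk T T x} =
      (fun y => quotientMk T S x * y) '' (coarsen h ⁻¹' {1}) := by
    ext y
    constructor
    · intro hy
      refine ⟨(quotientMk T S x)⁻¹ * y, ?_, mul_inv_cancel_left _ _⟩
      rw [Set.mem_preimage, Set.mem_singleton_iff] at hy ⊢
      rw [map_mul, map_inv, hy, coarsen_quotientMk, inv_mul_cancel]
    · rintro ⟨y, hy, rfl⟩
      rw [Set.mem_preimage, Set.mem_singleton_iff] at hy ⊢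
      rw [map_mul, hy, coarsen_quotientMk, mul_one]
  rw [this]
  exact (isCompact_coarsen_preimage_one h).image (continuous_const_mul _)

/-- The set of places underlying a tuple of pairwise distinct places. -/
def placeSet {r : ℕ} (v : Fin r ↪ HeightOneSpectrum (𝓞 F)) : Finset (HeightOneSpectrum (𝓞 F)) :=
  Finset.univ.map v

theorem mem_placeSet {r : ℕ} (v : Fin r ↪ HeightOneSpectrum (𝓞 F)) (i : Fin r) :
    v i ∈ placeSet v := Finset.mem_map_of_mem v (Finset.mem_univ i)

variable {r : ℕ} (v : Fin r ↪ HeightOneSpectrum (𝓞 F))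

/-- The isomorphism `𝔸ˣ ≅ ∏ᵢ F_{vᵢ}ˣ × (𝔸^T)ˣ`, where `T = {v₁, …, v_r}`. -/
noncomputable def splitIdele :
    Idele F →* (∀ i, ((v i).adicCompletion F)ˣ) × idelesAway (placeSet v) :=
  (MonoidHom.pi fun i => finComp (v i)).prod (projAway (placeSet v))

noncomputable def splitIdeleHomeo :
    Idele F ≃ₜ (∀ i, ((v i).adicCompletion F)ˣ) × idelesAway (placeSet v) where
  toFun := splitIdele v
  invFun p := (∏ i, single (v i) (p.1 i)) * p.2
  left_inv x := by
    change (∏ i, single (v i) (finComp (v i) x)) *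
      (x * ∏ v ∈ placeSet v, single v (finComp v x)⁻¹) = x
    rw [placeSet, Finset.prod_map, mul_left_comm, ← Finset.prod_mul_distrib, Finset.prod_eq_one,
      mul_one]
    intro i _
    rw [← map_mul, mul_inv_cancel, map_one]
  right_inv p := by
    have h1 : ∀ i, finComp (v i) (∏ i, single (v i) (p.1 i)) = p.1 i := by
      intro i
      rw [map_prod, Finset.prod_eq_single_of_mem i (Finset.mem_univ i), finComp_single_self]
      intro l _ hl
      exact finComp_single_of_ne (fun h => hl (v.injective h.symm)) _
    have h2 : projAway (placeSet v) (∏ i, single (v i) (p.1 i)) = 1 := by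
      apply Subtype.ext
      apply idele_ext
      · intro w
        by_cases hw : w ∈ placeSet v
        · rw [finComp_projAway_of_mem hw]
          exact (map_one _).symm
        · rw [finComp_projAway_of_notMem hw, map_prod, Finset.prod_eq_one]
          · exact (map_one _).symm
          · intro i _
            exact finComp_single_of_ne (fun h => hw (by rw [h]; exact mem_placeSet v i)) _
      · intro w
        rw [infComp_projAway, map_prod, Finset.prod_eq_one]
        · exact (map_one _).symm
        · intro i _
          exact infComp_single _ _ _
    refine Prod.ext (funext fun i => ?_) ?_
    · change finComp (v i) (_ * (p.2 : Idele F)) = _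
      rw [map_mul, h1, p.2.2 _ (mem_placeSet v i), mul_one]
    · change projAway (placeSet v) (_ * (p.2 : Idele F)) = _
      rw [map_mul, h2, one_mul, projAway_coe]
  continuous_toFun := (continuous_pi fun i => continuous_finComp (v i)).prodMk
    (continuous_projAway _)
  continuous_invFun := (continuous_finsetProd _ fun i _ => (continuous_single (v i)).comp
    ((continuous_apply i).comp continuous_fst)).mul (continuous_subtype_val.comp continuous_snd)

/-- The space `∏ᵢ F_{vᵢ} × (𝔸^T)ˣ / U^S`, where `T = {v₁, …, v_r}`. -/
abbrev MixedSpace (S : Finset (HeightOneSpectrum (𝓞 F))) : Type :=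
  (∀ i, (v i).adicCompletion F) × AdelicQuotient (placeSet v) S

/-- The homomorphism `𝔸ˣ / U^S → ∏ᵢ F_{vᵢ}ˣ × (𝔸^T)ˣ / U^S`, where `T = {v₁, …, v_r} ⊆ S`. -/
noncomputable def splitQuotient (h : placeSet v ⊆ S) : AdelicQuotient ∅ S →*
    (∀ i, ((v i).adicCompletion F)ˣ) × AdelicQuotient (placeSet v) S :=
  QuotientGroup.lift _ (((MonoidHom.id _).prodMap (quotientMk (placeSet v) S)).comp
    ((splitIdele v).comp (idelesAway ∅).subtype)) fun x hx => by
      have hx' := Subgroup.mem_subgroupOf.1 hx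
      refine Prod.ext (funext fun i => hx'.1 _ (h (mem_placeSet v i))) ?_
      refine (quotientMk_eq_one_iff _ _ _).2 ?_
      have : projAway (placeSet v) (x : Idele F) = ⟨x, fun w hw => hx'.1 _ (h hw)⟩ :=
        projAway_coe ⟨(x : Idele F), fun w hw => hx'.1 _ (h hw)⟩
      change (projAway (placeSet v) (x : Idele F) : Idele F) ∈ _
      rw [this]
      exact hx'

theorem splitQuotient_quotientMk (h : placeSet v ⊆ S) (x : idelesAway (F := F) ∅) :
    splitQuotient v h (quotientMk ∅ S x) =
      (fun i => finComp (v i) (x : Idele F), toQuotient (placeSet v) S (x : Idele F)) := rfl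

theorem splitQuotient_injective (h : placeSet v ⊆ S) :
    Function.Injective (splitQuotient v h) := by
  rw [injective_iff_map_eq_one]
  intro y hy
  obtain ⟨x, rfl⟩ := (isOpenQuotientMap_quotientMk ∅ S).surjective y
  rw [splitQuotient_quotientMk] at hy
  have h1 : ∀ i, finComp (v i) (x : Idele F) = 1 := fun i => congrFun (congrArg Prod.fst hy) i
  have h2 : quotientMk (placeSet v) S (projAway (placeSet v) (x : Idele F)) = 1 :=
    congrArg Prod.snd hy
  have h3 : ∀ w ∈ placeSet v, finComp w (x : Idele F) = 1 := by
    intro w hw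
    obtain ⟨i, -, rfl⟩ := Finset.mem_map.1 hw
    exact h1 i
  have : projAway (placeSet v) (x : Idele F) = ⟨x, h3⟩ := projAway_coe ⟨(x : Idele F), h3⟩
  rw [this, quotientMk_eq_one_iff] at h2
  exact (quotientMk_eq_one_iff _ _ _).2 h2

theorem continuous_splitQuotient (h : placeSet v ⊆ S) : Continuous (splitQuotient v h) :=
  (isOpenQuotientMap_quotientMk ∅ S).isQuotientMap.continuous_iff.2
    (((continuous_pi fun i => continuous_finComp (v i)).prodMk (continuous_toQuotient _ _)).comp
      continuous_subtype_val)

theorem isOpenMap_splitQuotient (h : placeSet v ⊆ S) : IsOpenMap (splitQuotient v h) := by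
  have h1 : IsOpenMap (splitQuotient v h ∘ quotientMk ∅ S) := by
    have h2 : IsOpenMap (Subtype.val : idelesAway (F := F) ∅ → Idele F) := by
      refine IsOpen.isOpenMap_subtype_val ?_
      convert isOpen_univ
      ext x
      simp [idelesAway]
    have h3 : IsOpenMap (Prod.map (id : (∀ i, ((v i).adicCompletion F)ˣ) → _)
        (quotientMk (placeSet v) S)) :=
      IsOpenMap.id.prodMap (isOpenQuotientMap_quotientMk (placeSet v) S).isOpenMap
    exact (h3.comp (splitIdeleHomeo v).isOpenMap).comp h2
  intro U hU
  rw [← Set.image_preimage_eq U (isOpenQuotientMap_quotientMk ∅ S).surjective, ← Set.image_comp]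
  exact h1 _ (hU.preimage (isOpenQuotientMap_quotientMk ∅ S).continuous)

/-- The open embedding `𝔸ˣ / U^S → ∏ᵢ F_{vᵢ} × (𝔸^T)ˣ / U^S`. -/
noncomputable def toMixed (h : placeSet v ⊆ S) (y : AdelicQuotient ∅ S) : MixedSpace v S :=
  (fun i => ((splitQuotient v h y).1 i : (v i).adicCompletion F), (splitQuotient v h y).2)

theorem isOpenEmbedding_toMixed (h : placeSet v ⊆ S) :
    Topology.IsOpenEmbedding (toMixed v h) := by
  have h1 : Topology.IsOpenEmbedding (splitQuotient v h) :=
    .of_continuous_injective_isOpenMap (continuous_splitQuotient v h)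
      (splitQuotient_injective v h) (isOpenMap_splitQuotient v h)
  have h2 : Topology.IsOpenEmbedding (fun (u : ∀ i, ((v i).adicCompletion F)ˣ) i =>
      (u i : (v i).adicCompletion F)) := by
    refine .of_continuous_injective_isOpenMap (continuous_pi fun i =>
      Units.continuous_val.comp (continuous_apply i)) (fun a b hab => funext fun i =>
        Units.ext (congrFun hab i)) ?_
    exact IsOpenMap.piMap (fun i => IsOpenUnits.isOpenEmbedding_unitsVal.isOpenMap)
      (by simp [Filter.cofinite_eq_bot])
  exact (h2.prodMap .id).comp h1

theorem toMixed_smul (h : placeSet v ⊆ S) (g : Fˣ) (y : AdelicQuotient ∅ S) :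
    toMixed v h (g • y) = g • toMixed v h y := by
  have h1 : splitQuotient v h (toQuotient ∅ S (principal g)) =
      (fun i => finComp (v i) (principal g), toQuotient (placeSet v) S (principal g)) := by
    refine (splitQuotient_quotientMk v h _).trans ?_
    have : (projAway ∅ (principal g) : Idele F) = principal g := by
      change principal g * ∏ v ∈ ∅, single v (finComp v (principal g))⁻¹ = _
      rw [Finset.prod_empty, mul_one]
    rw [this]
  have h2 : splitQuotient v h (g • y) = (fun i => finComp (v i) (principal g),
      toQuotient (placeSet v) S (principal g)) * splitQuotient v h y := by
    rw [smul_def, map_mul, h1]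
  unfold toMixed
  rw [h2]
  refine Prod.ext (funext fun i => ?_) rfl
  exact (Algebra.smul_def (g : F) _).symm

end Maps

section LocalCocycle

variable {F : Type} [Field F] [NumberField F] {v : HeightOneSpectrum (𝓞 F)}
  {A : Type} [AddCommGroup A] [TopologicalSpace A] [IsTopologicalAddGroup A]

theorem isClopen_scaled (x : (v.adicCompletion F)ˣ) :
    IsClopen {y : v.adicCompletion F | Valued.v y ≤ Valued.v (x : v.adicCompletion F)} := by
  have h : {y : v.adicCompletion F | Valued.v y ≤ Valued.v (x : v.adicCompletion F)} =
      (fun y => ((x⁻¹ : (v.adicCompletion F)ˣ) : v.adicCompletion F) * y) ⁻¹' {y | Valued.v y ≤ 1} := by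
    ext y
    have hx : 0 < Valued.v (x : v.adicCompletion F) := by simp [zero_lt_iff]
    simp only [Set.mem_preimage, Set.mem_ofPred_eq, map_mul, Units.val_inv_eq_inv_val, map_inv₀]
    rw [inv_mul_le_one₀ hx]
  rw [h]
  exact (isClopen_valued_le_one v).preimage (continuous_const.mul continuous_id)

theorem isCompact_scaled (x : (v.adicCompletion F)ˣ) :
    IsCompact {y : v.adicCompletion F | Valued.v y ≤ Valued.v (x : v.adicCompletion F)} := by
  have h : {y : v.adicCompletion F | Valued.v y ≤ Valued.v (x : v.adicCompletion F)} =
      (fun y => (x : v.adicCompletion F) * y) '' {y | Valued.v y ≤ 1} := by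
    ext y
    have hx : 0 < Valued.v (x : v.adicCompletion F) := by simp [zero_lt_iff]
    constructor
    · intro hy
      refine ⟨((x⁻¹ : (v.adicCompletion F)ˣ) : v.adicCompletion F) * y, ?_, by simp⟩
      simp only [Set.mem_ofPred_eq, map_mul, Units.val_inv_eq_inv_val, map_inv₀]
      rwa [inv_mul_le_one₀ hx]
    · rintro ⟨y, hy, rfl⟩
      simp only [Set.mem_ofPred_eq, map_mul]
      exact mul_le_of_le_one_right' hy
  rw [h]
  exact (isCompact_valued_le_one v).image (continuous_const.mul continuous_id)

open Classical in
/-- The indicator function of `x O_v`, with integral values. -/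
noncomputable def indicatorScaled (x : (v.adicCompletion F)ˣ) (y : v.adicCompletion F) : ℤ :=
  if Valued.v y ≤ Valued.v (x : v.adicCompletion F) then 1 else 0

theorem continuous_indicatorScaled (x : (v.adicCompletion F)ˣ) :
    Continuous (indicatorScaled x) := by
  classical
  refine Continuous.if (fun a ha => ?_) continuous_const continuous_const
  rw [(isClopen_scaled x).frontier_eq] at ha
  exact ha.elim

open Classical in
/-- The function `y ↦ 1_{x O_v}(y) ψ(x) + ((1_{O_v} - 1_{x O_v}) ψ)_!(y)` attached to a
homomorphism `ψ : F_vˣ → A`. -/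
noncomputable def zFun (ψ : Additive (v.adicCompletion F)ˣ →+ A) (x : (v.adicCompletion F)ˣ)
    (y : v.adicCompletion F) : A :=
  indicatorScaled x y • ψ (Additive.ofMul x) +
    if hy : y = 0 then 0
    else (indicatorScaled 1 y - indicatorScaled x y) • ψ (Additive.ofMul (Units.mk0 y hy))

theorem continuous_zFun (ψ : Additive (v.adicCompletion F)ˣ →+ A)
    (hψ : Continuous fun x : (v.adicCompletion F)ˣ => ψ (Additive.ofMul x))
    (x : (v.adicCompletion F)ˣ) : Continuous (zFun ψ x) := by
  classical
  refine ((continuous_indicatorScaled x).smul continuous_const).add ?_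
  rw [continuous_iff_continuousAt]
  intro y
  by_cases hy : y = 0
  · subst hy
    have h1 : {y : v.adicCompletion F | Valued.v y ≤ Valued.v ((1 : (v.adicCompletion F)ˣ) :
        v.adicCompletion F)} ∈ nhds 0 := (isClopen_scaled 1).2.mem_nhds (by simp)
    have h2 : {y : v.adicCompletion F | Valued.v y ≤ Valued.v (x : v.adicCompletion F)} ∈
        nhds 0 := (isClopen_scaled x).2.mem_nhds (by simp)
    refine (continuousAt_const (y := (0 : A))).congr ?_
    filter_upwards [h1, h2] with y hy1 hy2
    split_ifs with hy
    · rfl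
    · rw [indicatorScaled, indicatorScaled, if_pos hy1, if_pos hy2, sub_self, zero_smul]
  · have ho : Topology.IsOpenEmbedding (Units.val : (v.adicCompletion F)ˣ → v.adicCompletion F) :=
      IsOpenUnits.isOpenEmbedding_unitsVal
    have := ho.continuousAt_iff (x := Units.mk0 y hy) (g := fun y : v.adicCompletion F =>
      if hy : y = 0 then (0 : A)
      else (indicatorScaled 1 y - indicatorScaled x y) • ψ (Additive.ofMul (Units.mk0 y hy)))
    rw [Units.val_mk0] at this
    rw [← this]
    have h3 : (fun y : v.adicCompletion F => if hy : y = 0 then (0 : A)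
      else (indicatorScaled 1 y - indicatorScaled x y) • ψ (Additive.ofMul (Units.mk0 y hy))) ∘
        Units.val = fun u : (v.adicCompletion F)ˣ =>
          (indicatorScaled 1 (u : v.adicCompletion F) - indicatorScaled x u) •
            ψ (Additive.ofMul u) := by
      funext u
      simp
    rw [h3]
    exact ((((continuous_indicatorScaled 1).sub (continuous_indicatorScaled x)).comp
      Units.continuous_val).smul hψ).continuousAt

theorem hasCompactSupport_zFun (ψ : Additive (v.adicCompletion F)ˣ →+ A)
    (x : (v.adicCompletion F)ˣ) : HasCompactSupport (zFun ψ x) := by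
  classical
  refine ((isCompact_scaled 1).union (isCompact_scaled x)).of_isClosed_subset isClosed_closure
    (closure_minimal ?_ ((isClopen_scaled 1).1.union (isClopen_scaled x).1))
  intro y hy
  by_contra h
  rw [Set.mem_union, not_or] at h
  apply hy
  have h1 : indicatorScaled 1 y = 0 := if_neg h.1
  have h2 : indicatorScaled x y = 0 := if_neg h.2
  simp [zFun, h1, h2]

theorem indicatorScaled_mul (x w : (v.adicCompletion F)ˣ) (y : v.adicCompletion F) :
    indicatorScaled (x * w) y = indicatorScaled w ((x⁻¹ : (v.adicCompletion F)ˣ) * y) := by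
  have hx : 0 < Valued.v (x : v.adicCompletion F) := by simp [zero_lt_iff]
  unfold indicatorScaled
  simp only [Units.val_mul, map_mul, Units.val_inv_eq_inv_val, map_inv₀]
  congr 1
  rw [inv_mul_le_iff₀ hx]

theorem zFun_mul (ψ : Additive (v.adicCompletion F)ˣ →+ A) (x w : (v.adicCompletion F)ˣ)
    (y : v.adicCompletion F) :
    zFun ψ (x * w) y = zFun ψ x y + zFun ψ w ((x⁻¹ : (v.adicCompletion F)ˣ) * y) := by
  have hx := indicatorScaled_mul x 1 y
  rw [mul_one] at hx
  unfold zFun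
  rw [indicatorScaled_mul, ofMul_mul, map_add, ← hx]
  by_cases hy : y = 0
  · subst hy
    have : ∀ u : (v.adicCompletion F)ˣ, indicatorScaled u 0 = 1 := fun u => if_pos (by simp)
    simp [this]
  · have hy' : (x⁻¹ : (v.adicCompletion F)ˣ) * y ≠ 0 := mul_ne_zero (Units.ne_zero _) hy
    rw [dif_neg hy, dif_neg hy, dif_neg hy']
    have : Units.mk0 _ hy' = x⁻¹ * Units.mk0 y hy := Units.ext rfl
    rw [this, ofMul_mul, ofMul_inv, map_add, map_neg]
    module

variable (ψ : Additive (v.adicCompletion F)ˣ →+ A)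
    (hψ : Continuous fun x : (v.adicCompletion F)ˣ => ψ (Additive.ofMul x))

/-- The `1`-cocycle `z_ψ`, restricted from `F_vˣ` to `Fˣ`, with values in `C_c(F_v, A)`. -/
noncomputable def zCocycle (x : Fˣ) : ccRep Fˣ (v.adicCompletion F) A :=
  (⟨⟨zFun ψ (finComp v (principal x)), continuous_zFun ψ hψ _⟩, hasCompactSupport_zFun ψ _⟩ :
    C_c(v.adicCompletion F, A))

theorem zCocycle_mul (x w : Fˣ) : zCocycle ψ hψ (x * w) =
    zCocycle ψ hψ x + (ccRep Fˣ (v.adicCompletion F) A).ρ x (zCocycle ψ hψ w) :=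
  CompactlySupportedContinuousMap.ext fun y => by
    change zFun ψ (finComp v (principal (x * w))) y = zFun ψ (finComp v (principal x)) y +
      zFun ψ (finComp v (principal w)) (x⁻¹ • y)
    rw [map_mul, map_mul, zFun_mul]
    congr 2
    rw [← map_inv, ← map_inv]
    exact (Algebra.smul_def ((x⁻¹ : Fˣ) : F) y).symm

end LocalCocycle

section Theta

variable {F : Type} [Field F] [NumberField F]

/-- The group `E_{T,+}` of totally positive `T`-units of `F`. -/
def posUnits (T : Finset (HeightOneSpectrum (𝓞 F))) : Subgroup Fˣ where
  carrier := {x | (∀ v ∉ T, v.valuation F (x : F) = 1) ∧ ∀ σ : F →+* ℝ, 0 < σ (x : F)}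
  mul_mem' hx hy := by
    refine ⟨fun v hv => ?_, fun σ => ?_⟩
    · rw [Units.val_mul, map_mul, hx.1 v hv, hy.1 v hv, mul_one]
    · rw [Units.val_mul, map_mul]
      exact mul_pos (hx.2 σ) (hy.2 σ)
  one_mem' := ⟨fun v _ => by rw [Units.val_one, map_one], fun σ => by
    rw [Units.val_one, map_one]; exact one_pos⟩
  inv_mem' {x} hx := by
    refine ⟨fun v hv => ?_, fun σ => ?_⟩
    · rw [Units.val_inv_eq_inv_val, map_inv₀, hx.1 v hv, inv_one]
    · rw [Units.val_inv_eq_inv_val, map_inv₀]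
      exact inv_pos.2 (hx.2 σ)

/-- The normalised additive valuation `ord_v` on `Fˣ`. -/
noncomputable def ordAt (v : HeightOneSpectrum (𝓞 F)) (x : Fˣ) : ℤ :=
  -WithZero.log (v.valuation F (x : F))

/-- The functionals `ord_{v₁}, …, ord_{v_r}, log σ₁, …, log σ_{n-1}` on the group of totally
positive elements of `F`, where `σ₁, …, σ_n` are the real embeddings of `F`. -/
noncomputable def regulatorRow {r n : ℕ} (v : Fin r → HeightOneSpectrum (𝓞 F))
    (σ : Fin n → F →+* ℝ) (j : Fin (r + (n - 1))) (x : Fˣ) : ℝ :=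
  Fin.addCases (fun i : Fin r => (ordAt (v i) x : ℝ))
    (fun l : Fin (n - 1) => Real.log (σ (Fin.castLE (Nat.sub_le n 1) l) (x : F))) j

variable [IsTotallyReal F]

/-- The choices entering the definition of `ϑ^T`, for `T = {v₁, …, v_r}`: a basis of `E_{T,+}`,
positively oriented with respect to the given orderings of `T` and of the real embeddings, and a
fundamental domain for the action of `Fˣ / E_{T,+}` on `(𝔸^T)ˣ / U^T`. -/
structure ThetaData {r n : ℕ} (T : Finset (HeightOneSpectrum (𝓞 F)))
    (v : Fin r → HeightOneSpectrum (𝓞 F)) (σ : Fin n → F →+* ℝ) where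
  basis : Module.Basis (Fin (r + (n - 1))) ℤ (Additive (posUnits T))
  oriented : 0 < (Matrix.of fun j i =>
    regulatorRow v σ j ((basis i).toMul : Fˣ)).det
  domain : Finset (AdelicQuotient T T)
  isFundamental : ∀ y, ∃! z, z ∈ domain ∧ ∃ g : Fˣ, g • z = y

theorem smul_posUnits {T : Finset (HeightOneSpectrum (𝓞 F))} (g : posUnits T)
    (y : AdelicQuotient T T) : (g : Fˣ) • y = y := by
  have h : toQuotient T T (principal (g : Fˣ)) = 1 := by
    refine (quotientMk_eq_one_iff _ _ _).2 ⟨fun v hv => finComp_projAway_of_mem hv _,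
      fun v hv => ?_, fun w => ?_⟩
    · rw [finComp_projAway_of_notMem hv]
      exact (valuedAdicCompletion_eq_valuation' v ((g : Fˣ) : F)).trans (g.2.1 v hv)
    · rw [infComp_projAway]
      unfold IsPos
      have h1 : ((infComp w (principal (g : Fˣ)) : w.Completionˣ) : w.Completion) =
          ((WithAbs.equiv w.1).symm ((g : Fˣ) : F) : WithAbs w.1) := rfl
      rw [h1, InfinitePlace.Completion.extensionEmbeddingOfIsReal_coe]
      exact g.2.2 _
  rw [smul_def, h, one_mul]

open Classical in
/-- The characteristic function of a finite subset of a discrete space. -/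
noncomputable def finsetIndicator {X : Type} [TopologicalSpace X] [DiscreteTopology X]
    (s : Finset X) : C_c(X, ℤ) where
  toFun x := if x ∈ s then 1 else 0
  continuous_toFun := continuous_of_discreteTopology
  hasCompactSupport' := by
    refine s.finite_toSet.isCompact.of_isClosed_subset isClosed_closure
      (closure_minimal (fun x hx => ?_) (isClosed_discrete _))
    by_contra h
    exact hx (if_neg h)

/-- The homomorphism `ℤ → C_c((𝔸^T)ˣ / U^T, ℤ)`, `1 ↦ 1_𝓕`, of `E_{T,+}`-modules. -/
noncomputable def indicatorHom {T : Finset (HeightOneSpectrum (𝓞 F))}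
    (s : Finset (AdelicQuotient T T)) :
    Rep.trivial ℤ (posUnits T) ℤ ⟶ Rep.res (posUnits T).subtype (ccRep Fˣ (AdelicQuotient T T) ℤ) :=
  Rep.ofHom ⟨LinearMap.toSpanSingleton ℤ C_c(AdelicQuotient T T, ℤ) (finsetIndicator s),
    fun g => LinearMap.ext fun n => CompactlySupportedContinuousMap.ext fun y => by
      change n * finsetIndicator s y = n * finsetIndicator s ((g : Fˣ)⁻¹ • y)
      rw [show (g : Fˣ)⁻¹ • y = y from smul_posUnits g⁻¹ y]⟩

/-- The generator `η_T` of `H_m(E_{T,+}, ℤ)`. -/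
noncomputable def etaClass {r n : ℕ} {T : Finset (HeightOneSpectrum (𝓞 F))}
    {v : Fin r → HeightOneSpectrum (𝓞 F)} {σ : Fin n → F →+* ℝ} (D : ThetaData T v σ) :
    groupHomology (Rep.trivial ℤ (posUnits T) ℤ) (r + (n - 1)) :=
  homologyClass (fundamentalChain (Rep.trivial ℤ (posUnits T) ℤ) (1 : ℤ) fun i => (D.basis i).toMul)
    (isCycle_fundamentalChain (fun _ => rfl) _)

/-- The class `ϑ^T ∈ H_m(Fˣ, C_c((𝔸^T)ˣ / U^T, ℤ))`. -/
noncomputable def theta {r n : ℕ} {T : Finset (HeightOneSpectrum (𝓞 F))}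
    {v : Fin r → HeightOneSpectrum (𝓞 F)} {σ : Fin n → F →+* ℝ} (D : ThetaData T v σ) :
    groupHomology (ccRep Fˣ (AdelicQuotient T T) ℤ) (r + (n - 1)) :=
  groupHomology.map (posUnits T).subtype (indicatorHom D.domain) (r + (n - 1)) (etaClass D)

end Theta

section Invariants

variable {k G : Type} [CommRing k] [Group G]

theorem isCocycle_const {M : Rep.{0} k G} (m : M) (hm : ∀ g, M.ρ g m = m) :
    IsCocycle (fun _ : Fin 0 → G => m) := by
  funext g
  change dCochain M 0 _ g = 0
  rw [dCochain_apply, Fin.sum_univ_succ]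
  simp [hm]

/-- The class in `H⁰(G, M)` of an invariant element of `M`. -/
noncomputable def invariantClass {M : Rep.{0} k G} (m : M) (hm : ∀ g, M.ρ g m = m) :
    groupCohomology M 0 := cohomologyClass (fun _ => m) (isCocycle_const m hm)

/-- The map on homology induced by a homomorphism of `G`-modules. -/
noncomputable def homologyMap {M N : Rep.{0} k G} (φ : M ⟶ N) (m : ℕ) (x : groupHomology M m) :
    groupHomology N m := (groupHomology.functor k G m).map φ x

end Invariants

section Characters

variable {F : Type} [Field F] [NumberField F] [IsTotallyReal F]
  {T S : Finset (HeightOneSpectrum (𝓞 F))} {R : Type} [CommRing R] [TopologicalSpace R]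
  (χ : Idele F →* Rˣ)

/-- The restriction of `χ` to `(𝔸^T)ˣ`, as a homomorphism on `(𝔸^T)ˣ / U^S`. -/
noncomputable def restrictChar (hU : ∀ x ∈ unitsAway S, χ x = 1) : AdelicQuotient T S →* Rˣ :=
  QuotientGroup.lift _ (χ.comp (idelesAway T).subtype) fun x hx =>
    hU x (Subgroup.mem_subgroupOf.1 hx)

/-- The function `q ∘ χ^T` on `(𝔸^T)ˣ / U^S` for a continuous ring homomorphism `q`. -/
noncomputable def charFun {R' : Type} [CommRing R'] [TopologicalSpace R'] (T)
    (hU : ∀ x ∈ unitsAway S, χ x = 1) (hχ : Continuous χ) (q : R →+* R') (hq : Continuous q) :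
    C(AdelicQuotient T S, R') where
  toFun y := q (restrictChar χ hU y : Rˣ)
  continuous_toFun := hq.comp (Units.continuous_val.comp
    ((isOpenQuotientMap_quotientMk T S).isQuotientMap.continuous_iff.2
      (hχ.comp continuous_subtype_val)))

theorem charFun_invariant {R' : Type} [CommRing R'] [TopologicalSpace R'] [IsTopologicalRing R']
    (hU : ∀ x ∈ unitsAway S, χ x = 1) (hχ : Continuous χ)
    (hF : ∀ x : Fˣ, χ (principal x) = 1) (q : R →+* R') (hq : Continuous q)
    (h : ∀ v ∈ T, ∀ u, q (χ (single v u)) = 1) (g : Fˣ) :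
    (cRep Fˣ (AdelicQuotient T S) R').ρ g (charFun χ T hU hχ q hq) = charFun χ T hU hχ q hq :=
  ContinuousMap.ext fun y => by
    change q (restrictChar χ hU (g⁻¹ • y) : Rˣ) = q (restrictChar χ hU y : Rˣ)
    have h1 : q (χ (projAway T (principal g⁻¹) : Idele F) : Rˣ) = 1 := by
      change q ((χ (principal g⁻¹ * ∏ v ∈ T, single v (finComp v (principal g⁻¹))⁻¹) : Rˣ) : R) = 1
      rw [map_mul, hF, one_mul, map_prod, Units.coe_prod, map_prod]
      exact Finset.prod_eq_one fun v hv => h v hv _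
    rw [smul_def, map_mul, Units.val_mul, map_mul]
    refine Eq.trans (congrArg (· * _) h1) (one_mul _)

/-- The local component `χ_v` of `χ`. -/
noncomputable def localChar (v : HeightOneSpectrum (𝓞 F)) : (v.adicCompletion F)ˣ →* Rˣ :=
  χ.comp (single v)

/-- The group `I / aI`, with the topology induced from the subspace topology on `I`. -/
abbrev IdealMod (a I : Ideal R) : Type := I ⧸ (a • ⊤ : Submodule R I)

variable [IsTopologicalRing R] {a I : Ideal R} {v : HeightOneSpectrum (𝓞 F)}

/-- The homomorphism `dχ_v : F_vˣ → I / aI`, `x ↦ χ_v(x) - 1`. -/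
noncomputable def dChar (h : ∀ x, (localChar χ v x : R) - 1 ∈ I) (hI : I ≤ a) :
    Additive (v.adicCompletion F)ˣ →+ IdealMod a I where
  toFun x := Submodule.Quotient.mk ⟨(localChar χ v x.toMul : R) - 1, h _⟩
  map_zero' := by
    have h0 : (⟨(localChar χ v (0 : Additive (v.adicCompletion F)ˣ).toMul : R) - 1, h _⟩ : I) =
        0 := Subtype.ext (by simp)
    rw [h0, Submodule.Quotient.mk_zero]
  map_add' x y := by
    rw [← Submodule.Quotient.mk_add, Submodule.Quotient.eq]
    have : (⟨(localChar χ v (x + y).toMul : R) - 1, h _⟩ : I) -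
        (⟨(localChar χ v x.toMul : R) - 1, h _⟩ + ⟨(localChar χ v y.toMul : R) - 1, h _⟩) =
        ((localChar χ v x.toMul : R) - 1) • ⟨(localChar χ v y.toMul : R) - 1, h _⟩ := by
      apply Subtype.ext
      simp
      ring
    rw [this]
    exact Submodule.smul_mem_smul (hI (h _)) trivial

theorem continuous_dChar (hχ : Continuous χ) (h : ∀ x, (localChar χ v x : R) - 1 ∈ I)
    (hI : I ≤ a) :
    Continuous fun x : (v.adicCompletion F)ˣ => dChar χ h hI (Additive.ofMul x) := by
  have : Continuous (Submodule.Quotient.mk : I → IdealMod a I) := continuous_quot_mk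
  exact this.comp (Continuous.subtype_mk ((Units.continuous_val.comp
    (hχ.comp (continuous_single v))).sub continuous_const) _)

end Characters

section Mult

variable {R : Type} [CommRing R] [TopologicalSpace R] [IsTopologicalRing R] {r : ℕ}
  (a : Ideal R) (I : Fin r → Ideal R)

theorem prod_sub_prod_mem (J : Finset (Fin r)) (s s' : ∀ i, I i)
    (h : ∀ i, (s i : R) - s' i ∈ a * I i) :
    ∏ i ∈ J, (s i : R) - ∏ i ∈ J, (s' i : R) ∈ a * ∏ i ∈ J, I i := by
  classical
  induction J using Finset.induction_on with
  | empty => simp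
  | insert j J hj ih =>
    rw [Finset.prod_insert hj, Finset.prod_insert hj, Finset.prod_insert hj]
    have : (s j : R) * ∏ i ∈ J, (s i : R) - s' j * ∏ i ∈ J, (s' i : R) =
        ((s j : R) - s' j) * ∏ i ∈ J, (s i : R) +
          s' j * (∏ i ∈ J, (s i : R) - ∏ i ∈ J, (s' i : R)) := by ring
    rw [this]
    refine add_mem ?_ ?_
    · rw [← mul_assoc]
      exact Ideal.mul_mem_mul (h j) (Ideal.prod_mem_prod fun i _ => (s i).2)
    · rw [mul_left_comm]
      exact Ideal.mul_mem_mul (s' j).2 ih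

theorem surjective_mk_pi :
    Function.Surjective fun (s : ∀ i, I i) i => (Submodule.Quotient.mk (s i) : IdealMod a (I i)) :=
  fun y => ⟨fun i => (Submodule.Quotient.mk_surjective _ (y i)).choose,
    funext fun i => (Submodule.Quotient.mk_surjective _ (y i)).choose_spec⟩

/-- The map `R/a × ∏ᵢ Iᵢ/aIᵢ → I₁⋯I_r` induced by multiplication, if `a I₁⋯I_r = 0`; it is
computed on arbitrary representatives. -/
noncomputable def multFun (x : R ⧸ a) (y : ∀ i, IdealMod a (I i)) : ↥(∏ i, I i) :=
  ⟨Function.surjInv Ideal.Quotient.mk_surjective x *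
      ∏ i, (Function.surjInv (surjective_mk_pi a I) y i : R),
    Ideal.mul_mem_left _ _ (Ideal.prod_mem_prod fun i _ =>
      (Function.surjInv (surjective_mk_pi a I) y i).2)⟩

variable {a I}

theorem multFun_mk (h : a * ∏ i, I i = ⊥) (x : R) (s : ∀ i, I i) :
    (multFun a I (Ideal.Quotient.mk a x) fun i => Submodule.Quotient.mk (s i) : R) =
      x * ∏ i, (s i : R) := by
  unfold multFun
  have e1 := Function.surjInv_eq (Ideal.Quotient.mk_surjective (I := a)) (Ideal.Quotient.mk a x)
  have e2 := Function.surjInv_eq (surjective_mk_pi a I) fun i => Submodule.Quotient.mk (s i)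
  dsimp only
  generalize Function.surjInv (Ideal.Quotient.mk_surjective (I := a))
    (Ideal.Quotient.mk a x) = x' at e1 ⊢
  generalize Function.surjInv (surjective_mk_pi a I)
    (fun i => Submodule.Quotient.mk (s i)) = s' at e2 ⊢
  have h1 : x' - x ∈ a := Ideal.Quotient.eq.1 e1
  have h2 : ∀ i, (s' i : R) - s i ∈ a * I i := by
    intro i
    have h4 := Submodule.mem_map_of_mem (f := (I i).subtype)
      ((Submodule.Quotient.eq _).1 (congrFun e2 i))
    rw [Submodule.map_smul'', Submodule.map_top, Submodule.range_subtype] at h4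
    exact h4
  have h3 := prod_sub_prod_mem a I Finset.univ s' s h2
  rw [h, Ideal.mem_bot, sub_eq_zero] at h3
  rw [h3]
  have h4 : (x' - x) * ∏ i, (s i : R) ∈ a * ∏ i, I i :=
    Ideal.mul_mem_mul h1 (Ideal.prod_mem_prod fun i _ => (s i).2)
  rw [h, Ideal.mem_bot, sub_mul, sub_eq_zero] at h4
  exact h4

theorem isOpenQuotientMap_idealMod (a I : Ideal R) :
    IsOpenQuotientMap (Submodule.Quotient.mk : I → IdealMod a I) :=
  QuotientAddGroup.isOpenQuotientMap_mk

/-- The continuous multiadditive map `R/a × ∏ᵢ Iᵢ/aIᵢ → I₁⋯I_r` induced by multiplication. -/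
noncomputable def multPairing (h : a * ∏ i, I i = ⊥) :
    ContinuousMultiadditive (R ⧸ a) (fun i => IdealMod a (I i)) ↥(∏ i, I i) where
  toFun := multFun a I
  add_left x x' y := by
    obtain ⟨x, rfl⟩ := Ideal.Quotient.mk_surjective x
    obtain ⟨x', rfl⟩ := Ideal.Quotient.mk_surjective x'
    obtain ⟨s, rfl⟩ := surjective_mk_pi a I y
    apply Subtype.ext
    rw [← map_add, Submodule.coe_add, multFun_mk h, multFun_mk h, multFun_mk h, add_mul]
  update_add x y i b b' := by
    obtain ⟨x, rfl⟩ := Ideal.Quotient.mk_surjective x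
    obtain ⟨s, rfl⟩ := surjective_mk_pi a I y
    obtain ⟨b, rfl⟩ := Submodule.Quotient.mk_surjective _ b
    obtain ⟨b', rfl⟩ := Submodule.Quotient.mk_surjective _ b'
    have hu : ∀ c : I i, Function.update (fun i => (Submodule.Quotient.mk (s i) :
        IdealMod a (I i))) i (Submodule.Quotient.mk c) =
        fun l => Submodule.Quotient.mk (Function.update s i c l) := fun c => funext fun l =>
      (Function.apply_update (fun l (c : I l) => (Submodule.Quotient.mk c : IdealMod a (I l)))
        s i c l).symm
    have hp : ∀ c : I i, ∏ l, (Function.update s i c l : R) =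
        (c : R) * ∏ l ∈ Finset.univ \ {i}, (s l : R) := by
      intro c
      rw [← Finset.prod_update_of_mem (Finset.mem_univ i) (fun l => (s l : R)) (c : R)]
      refine Finset.prod_congr rfl fun l _ => ?_
      exact Function.apply_update (fun l (c : I l) => (c : R)) s i c l
    apply Subtype.ext
    rw [← Submodule.Quotient.mk_add, hu, hu, hu, Submodule.coe_add, multFun_mk h, multFun_mk h,
      multFun_mk h, hp, hp, hp, Submodule.coe_add]
    ring
  continuous := by
    have hq : IsOpenQuotientMap (Prod.map (Ideal.Quotient.mk a)
        (Pi.map fun i => (Submodule.Quotient.mk : I i → IdealMod a (I i)))) :=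
      (QuotientRing.isOpenQuotientMap_mk a).prodMap
        (IsOpenQuotientMap.piMap fun i => isOpenQuotientMap_idealMod a (I i))
    rw [hq.isQuotientMap.continuous_iff]
    refine continuous_induced_rng.2 ?_
    have : (Subtype.val ∘ (fun p : (R ⧸ a) × ∀ i, IdealMod a (I i) => multFun a I p.1 p.2) ∘
        Prod.map (Ideal.Quotient.mk a)
        (Pi.map fun i => (Submodule.Quotient.mk : I i → IdealMod a (I i)))) =
        fun p : R × ∀ i, I i => p.1 * ∏ i, (p.2 i : R) := funext fun p => multFun_mk h _ _
    rw [this]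
    exact continuous_fst.mul (continuous_finsetProd _ fun i _ =>
      continuous_subtype_val.comp ((continuous_apply i).comp continuous_snd))

end Mult

section Diamond

variable (X A : Type) [TopologicalSpace X] [AddCommGroup A] [TopologicalSpace A]
  [IsTopologicalAddGroup A]

/-- The subgroup of `C_c(X, A)` generated by the locally constant functions with compact support
and by the functions with values in a compact open subgroup of `A`. -/
def ccDiamond : AddSubgroup C_c(X, A) :=
  AddSubgroup.closure ({f | IsLocallyConstant f} ∪
    {f | ∃ K : AddSubgroup A, IsOpen (K : Set A) ∧ IsCompact (K : Set A) ∧ ∀ x, f x ∈ K})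

variable {A} in
theorem exists_compact_open_subgroup [T2Space A] [LocallyCompactSpace A]
    [TotallyDisconnectedSpace A] :
    ∃ K : AddSubgroup A, IsOpen (K : Set A) ∧ IsCompact (K : Set A) := by
  obtain ⟨C, hC, hC0⟩ := exists_compact_mem_nhds (0 : A)
  obtain ⟨W, hW, h0, hWC⟩ := (loc_compact_Haus_tot_disc_of_zero_dim (H := A)).mem_nhds_iff.1 hC0
  have hWc : IsCompact W := hC.of_isClosed_subset hW.1 hWC
  obtain ⟨V, hV, hVW⟩ := compact_open_separated_add_left hWc hW.2 Set.Subset.rfl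
  let K : AddSubgroup A :=
    { carrier := {g | ∀ w, g + w ∈ W ↔ w ∈ W}
      add_mem' := fun {a b} ha hb w => by rw [add_assoc, ha, hb]
      zero_mem' := fun w => by rw [zero_add]
      neg_mem' := fun {a} ha w => by rw [← ha (-a + w), add_neg_cancel_left] }
  have hK : IsOpen (K : Set A) := by
    refine AddSubgroup.isOpen_of_mem_nhds K (g := 0) ?_
    have hV' : -V ∈ nhds (0 : A) := by
      have := (continuous_neg (G := A)).continuousAt.preimage_mem_nhds (x := 0) (t := V)
        (by rwa [neg_zero])
      exact this
    filter_upwards [hV, hV'] with g hg hg' w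
    refine ⟨fun h => ?_, fun h => hVW (Set.add_mem_add hg h)⟩
    have := hVW (Set.add_mem_add (Set.mem_neg.1 hg') h)
    rwa [neg_add_cancel_left] at this
  refine ⟨K, hK, hWc.of_isClosed_subset (K.isClosed_of_isOpen hK) fun g hg => ?_⟩
  have := (hg 0).2 h0
  rwa [add_zero] at this

/-- For a locally profinite group `A`, the subgroup `ccDiamond X A` is all of `C_c(X, A)`. -/
theorem ccDiamond_eq_top [T2Space A] [LocallyCompactSpace A] [TotallyDisconnectedSpace A] :
    ccDiamond X A = ⊤ := by
  classical
  obtain ⟨K, hK, hKc⟩ := exists_compact_open_subgroup (A := A)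
  refine eq_top_iff.2 fun f _ => ?_
  have hs := QuotientAddGroup.mk_surjective (s := K)
  let s : A ⧸ K → A := fun q => if q = 0 then 0 else Function.surjInv hs q
  have hs' : ∀ q, ((s q : A) : A ⧸ K) = q := by
    intro q
    by_cases hq : q = 0
    · simp [s, hq]
    · simp only [s, if_neg hq]
      exact Function.surjInv_eq hs q
  have : DiscreteTopology (A ⧸ K) := QuotientAddGroup.discreteTopology hK
  have hg : IsLocallyConstant fun x => s (f x : A ⧸ K) :=
    ((IsLocallyConstant.iff_continuous (fun x => (f x : A ⧸ K))).2
      (QuotientAddGroup.continuous_mk.comp f.continuous)).comp s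
  let g : C_c(X, A) := ⟨⟨fun x => s (f x : A ⧸ K), hg.continuous⟩,
    f.hasCompactSupport.comp_left (g := fun a : A => s (a : A ⧸ K)) (if_pos rfl)⟩
  have h1 : g ∈ ccDiamond X A := AddSubgroup.subset_closure (Or.inl hg)
  have h2 : f - g ∈ ccDiamond X A := by
    refine AddSubgroup.subset_closure (Or.inr ⟨K, hK, hKc, fun x => ?_⟩)
    change f x - s (f x : A ⧸ K) ∈ K
    rw [← QuotientAddGroup.eq_zero_iff, QuotientAddGroup.mk_sub, hs', sub_self]
  have := add_mem h2 h1
  rwa [sub_add_cancel] at this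

end Diamond

section Classes

variable {F : Type} [Field F] [NumberField F] [IsTotallyReal F] {R : Type} [CommRing R]
  [TopologicalSpace R] [IsTopologicalRing R] {r n : ℕ} {v : Fin r ↪ HeightOneSpectrum (𝓞 F)}
  {S : Finset (HeightOneSpectrum (𝓞 F))} {σ : Fin n → F →+* ℝ} {χ : Idele F →* Rˣ}

/-- The class `χ ∩ ϑ ∈ H_{n-1}(Fˣ, C_c(𝔸ˣ / U^S, R))`. -/
noncomputable def characterClass (hχ : Continuous χ) (hF : ∀ x : Fˣ, χ (principal x) = 1)
    (hU : ∀ x ∈ unitsAway S, χ x = 1) (D : ThetaData ∅ Fin.elim0 σ) :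
    groupHomology (ccRep Fˣ (AdelicQuotient ∅ S) R) (n - 1) :=
  cap (properPairing R (coarsen (Finset.empty_subset S))
      (isProperMap_coarsen _) (coarsen_smul _)) (i := 0) rfl
    (invariantClass (charFun χ ∅ hU hχ (RingHom.id R) continuous_id)
      (charFun_invariant χ hU hχ hF _ _ fun v hv => absurd hv (Finset.notMem_empty v)))
    (theta D)

/-- The class `κ ∈ H_{n-1}(Fˣ, C_c(S₁, S₂, R))`: the image of `χ ∩ ϑ` under extension by zero.
For a locally profinite ring `R` the module `C_c` agrees with its submodule generated by locally
constant functions and functions with values in compact open subgroups, by `ccDiamond_eq_top`. -/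
noncomputable def kappa (h : placeSet v ⊆ S) (hχ : Continuous χ)
    (hF : ∀ x : Fˣ, χ (principal x) = 1) (hU : ∀ x ∈ unitsAway S, χ x = 1)
    (D : ThetaData ∅ Fin.elim0 σ) :
    groupHomology (ccRep Fˣ (MixedSpace v S) R) (n - 1) :=
  homologyMap (extendZeroHom (toMixed v h) (isOpenEmbedding_toMixed v h) (toMixed_smul v h)) (n - 1)
    (characterClass hχ hF hU D)

theorem mk_char_eq_one {a : Ideal R} {I : Fin r → Ideal R} (hIa : ∀ i, I i ≤ a)
    (h : ∀ i x, (localChar χ (v i) x : R) - 1 ∈ I i) (w : HeightOneSpectrum (𝓞 F))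
    (hw : w ∈ placeSet v) (u : (w.adicCompletion F)ˣ) :
    Ideal.Quotient.mk a (χ (single w u) : R) = 1 := by
  obtain ⟨i, -, rfl⟩ := Finset.mem_map.1 hw
  exact (Ideal.Quotient.mk_eq_one_iff_sub_mem _).2 (hIa i (h i u))

/-- The class `κ̄ = χ̄^{S₁} ∩ ϑ^{S₁} ∈ H_{n+r-1}(Fˣ, C_c(S₂, R/a)^{S₁})`. -/
noncomputable def kappaBar {a : Ideal R} {I : Fin r → Ideal R} (h : placeSet v ⊆ S)
    (hχ : Continuous χ) (hF : ∀ x : Fˣ, χ (principal x) = 1) (hU : ∀ x ∈ unitsAway S, χ x = 1)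
    (hIa : ∀ i, I i ≤ a) (hI : ∀ i x, (localChar χ (v i) x : R) - 1 ∈ I i)
    (D : ThetaData (placeSet v) v σ) :
    groupHomology (ccRep Fˣ (AdelicQuotient (placeSet v) S) (R ⧸ a)) (r + (n - 1)) :=
  cap (properPairing (R ⧸ a) (coarsen h) (isProperMap_coarsen h) (coarsen_smul h)) (i := 0)
    (Nat.zero_add _)
    (invariantClass (charFun χ (placeSet v) hU hχ (Ideal.Quotient.mk a) continuous_quot_mk)
      (charFun_invariant χ hU hχ hF _ _ (mk_char_eq_one hIa hI)))
    (theta D)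

/-- The class `c_{dχ₁} ∪ … ∪ c_{dχ_r} ∈ Hʳ(Fˣ, ⨂ᵢ C_c(F_{vᵢ}, Iᵢ/aIᵢ))`. -/
noncomputable def cupClass {a : Ideal R} {I : Fin r → Ideal R} (hχ : Continuous χ)
    (hIa : ∀ i, I i ≤ a) (hI : ∀ i x, (localChar χ (v i) x : R) - 1 ∈ I i) :
    groupCohomology (tensorRep fun i => ccRep Fˣ ((v i).adicCompletion F) (IdealMod a (I i))) r :=
  cohomologyClass
    (cupOne fun i => zCocycle (dChar χ (hI i) (hIa i)) (continuous_dChar χ hχ (hI i) (hIa i)))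
    (isCocycle_cupOne _ fun _ => zCocycle_mul _ _)

/-- The class `(c_{dχ₁} ∪ … ∪ c_{dχ_r}) ∩ κ̄ ∈ H_{n-1}(Fˣ, C_c(S₁, S₂, I₁⋯I_r))`. -/
noncomputable def cupCapKappaBar {a : Ideal R} {I : Fin r → Ideal R} (h : placeSet v ⊆ S)
    (hχ : Continuous χ) (hF : ∀ x : Fˣ, χ (principal x) = 1) (hU : ∀ x ∈ unitsAway S, χ x = 1)
    (hIa : ∀ i, I i ≤ a) (hI : ∀ i x, (localChar χ (v i) x : R) - 1 ∈ I i)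
    (h0 : a * ∏ i, I i = ⊥) (D : ThetaData (placeSet v) v σ) :
    groupHomology (ccRep Fˣ (MixedSpace v S) ↥(∏ i, I i)) (n - 1) :=
  cap (externalPairing (multPairing h0)) rfl (cupClass hχ hIa hI) (kappaBar h hχ hF hU hIa hI D)

end Classes

end HeckeClasses

open HeckeClasses NumberField IsDedekindDomain

/-!
The identity rests on a cap product formula for the classes `ϑ`. Let `T = {v₁, …, v_r}`, and let
`uᵢ` be the `1`-cocycle `x ↦ 1_{O_{vᵢ}} - 1_{x O_{vᵢ}}` of `Fˣ`, viewed as a function on `F_{vᵢ}ˣ`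
and extended by zero. Then, up to extension by zero, `ϑ` is the cap product of `u₁ ∪ … ∪ u_r` with
`ϑ^T`, and this already holds for suitable chains:

* `theta_eq`: the classes `ϑ` and `ϑ^T` do not depend on the basis and the fundamental domain. The
  fundamental chain is alternating and, up to boundaries, additive in the basis elements, so that
  a change of basis multiplies its class by a determinant, which orientation forces to be `1`;
  translating the coefficient of the chain changes it by a boundary
  (`fundamentalChain_translate_sub_mem_range`). Both facts come from the chain homotopy
  `insertChain` between the identity and the action of a group element.
* `exists_isTriangular_ordHom`: the finiteness of the class group provides totally positive
  `T`-units `η₁, …, η_r` such that the matrix of their orders at `v₁, …, v_r` is triangular, with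
  positive diagonal entries that are as small as possible. Together with a basis of the totally
  positive units they form a positively oriented basis of the totally positive `T`-units
  (`adaptedThetaData`), and the classes with order in `[-dᵢ, 0)` at `vᵢ`, where `dᵢ` is the order
  of `ηᵢ`, lying above a fundamental domain away from `T`, form a fundamental domain for `ϑ`
  (`boxThetaData`).
* `capChain_wCocycle`: for these choices the cap product of the cocycles `uᵢ` with the fundamental
  chain of `ϑ^T` is the fundamental chain of `ϑ`. Only the permutations fixing the first `r` basis
  elements contribute, as `uᵢ` vanishes on units at `vᵢ`, and for those the product of the
  functions `uᵢ(ηᵢ)`, successively translated, is the indicator function of the box.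

The character `χ` is incorporated by twisting. The cocycles `wCocycle`, that is
`((1_O - 1_{x O}) χ_v)_!`, take values in `C_c(F_v, R)` with the action twisted by `χ_v`; as `χ` is
trivial on `Fˣ`, multiplication by `χ^T` defines an equivariant pairing `charPairing` of these
modules with `C_c((𝔸^T)ˣ / U^T, ℤ)`. Adding the coboundary of `1_{O_v}` to `wCocycle` gives a
cocycle `zLift` with values in functions into `Iᵢ` which lifts `z_{dχ}` (`zLift_eq_zCocycle`).
Since `a · I₁ ⋯ I_r = 0`, the products only see these values modulo `a Iᵢ`, and the twists, being
congruent to `1` modulo `a`, are not seen at all (`externalProduct_zCocycle`). Hence capping with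
the cup product of the classes of `z_{dχ}` agrees with capping with that of the classes of `zLift`,
and these are the classes of `wCocycle` (`cohomologyClass_cupOne_eq`).
-/

namespace HeckeClasses

/-! ### Inserting a group element into a chain -/

section Insertion

variable {k G : Type} [CommRing k] [CommGroup G] {N : Rep.{0} k G}

/-- Prepending `g`: the operator `n ⊗ [g₁|…|gₘ] ↦ n ⊗ [g|g₁|…|gₘ]` on chains. -/
noncomputable def consChain (N : Rep.{0} k G) {m : ℕ} (g : G) :
    ((Fin m → G) →₀ N) →ₗ[k] ((Fin (m + 1) → G) →₀ N) :=
  Finsupp.lmapDomain N k fun t : Fin m → G => (Fin.cons g t : Fin (m + 1) → G)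

/-- Multiplying the first entry by `g`. -/
noncomputable def mulFirst (N : Rep.{0} k G) {m : ℕ} (g : G) :
    ((Fin (m + 1) → G) →₀ N) →ₗ[k] ((Fin (m + 1) → G) →₀ N) :=
  Finsupp.lmapDomain N k fun t : Fin (m + 1) → G =>
    (Fin.cons (g * t 0) (fun i => t i.succ) : Fin (m + 1) → G)

/-- The faces of the bar complex other than the first one, with alternating signs; the
differential is the first face minus this operator. -/
noncomputable def contractChain (N : Rep.{0} k G) {m : ℕ} :
    ((Fin (m + 1) → G) →₀ N) →ₗ[k] ((Fin m → G) →₀ N) :=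
  ∑ l : Fin (m + 1), (-1 : k) ^ (l : ℕ) •
    Finsupp.lmapDomain N k fun t : Fin (m + 1) → G => Fin.contractNth l (· * ·) t

/-- The signed sum of all insertions of `x`:
`n ⊗ [g₁|…|gₘ] ↦ ∑ᵢ (-1)ⁱ n ⊗ [g₁|…|gᵢ|x|gᵢ₊₁|…|gₘ]`. -/
noncomputable def insertChain (N : Rep.{0} k G) {m : ℕ} (x : G) :
    ((Fin m → G) →₀ N) →ₗ[k] ((Fin (m + 1) → G) →₀ N) :=
  ∑ i : Fin (m + 1), (-1 : k) ^ (i : ℕ) •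
    Finsupp.lmapDomain N k fun t : Fin m → G => (i.insertNth x t : Fin (m + 1) → G)

/-- The action of `g` on the coefficients. -/
noncomputable def coeffMap (N : Rep.{0} k G) {m : ℕ} (g : G) :
    ((Fin m → G) →₀ N) →ₗ[k] ((Fin m → G) →₀ N) :=
  Finsupp.mapRange.linearMap (N.ρ g)

theorem consChain_single {m : ℕ} (g : G) (t : Fin m → G) (n : N) :
    consChain N g (Finsupp.single t n) = Finsupp.single (Fin.cons g t : Fin (m + 1) → G) n :=
  Finsupp.mapDomain_single

theorem mulFirst_single {m : ℕ} (g : G) (t : Fin (m + 1) → G) (n : N) :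
    mulFirst N g (Finsupp.single t n) =
      Finsupp.single (Fin.cons (g * t 0) (fun i => t i.succ) : Fin (m + 1) → G) n :=
  Finsupp.mapDomain_single

theorem contractChain_single {m : ℕ} (t : Fin (m + 1) → G) (n : N) :
    contractChain N (Finsupp.single t n) = ∑ l : Fin (m + 1), (-1 : k) ^ (l : ℕ) •
      Finsupp.single (Fin.contractNth l (· * ·) t) n := by
  simp [contractChain, LinearMap.sum_apply, Finsupp.mapDomain_single]

theorem insertChain_single {m : ℕ} (x : G) (t : Fin m → G) (n : N) :
    insertChain N x (Finsupp.single t n) = ∑ i : Fin (m + 1), (-1 : k) ^ (i : ℕ) •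
      Finsupp.single (i.insertNth x t : Fin (m + 1) → G) n := by
  simp [insertChain, LinearMap.sum_apply, Finsupp.mapDomain_single]

theorem coeffMap_single {m : ℕ} (g : G) (t : Fin m → G) (n : N) :
    coeffMap N g (Finsupp.single t n) = Finsupp.single t (N.ρ g n) := by
  simp [coeffMap]

theorem dChain_single_eq_sub {m : ℕ} (t : Fin (m + 1) → G) (n : N) :
    dChain N m (Finsupp.single t n) =
      Finsupp.single (fun i => t i.succ) (N.ρ (t 0)⁻¹ n) - contractChain N (Finsupp.single t n) := by
  rw [dChain_single, contractChain_single, sub_eq_add_neg, ← Finset.sum_neg_distrib]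
  congr 1
  refine Finset.sum_congr rfl fun l _ => ?_
  rw [pow_succ, mul_neg_one, neg_smul]

theorem contractNth_zero_cons {m : ℕ} (g : G) (t : Fin (m + 1) → G) :
    Fin.contractNth 0 (· * ·) (Fin.cons g t : Fin (m + 2) → G) =
      (Fin.cons (g * t 0) (fun i => t i.succ) : Fin (m + 1) → G) := by
  funext i
  refine Fin.cases ?_ (fun i => ?_) i
  · rw [Fin.contractNth_apply_of_eq _ _ _ _ rfl]; rfl
  · rw [Fin.contractNth_apply_of_gt _ _ _ _ (by simp)]; rfl

theorem contractNth_succ_cons {m : ℕ} (l : Fin (m + 1)) (g : G) (t : Fin (m + 1) → G) :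
    Fin.contractNth l.succ (· * ·) (Fin.cons g t : Fin (m + 2) → G) =
      (Fin.cons g (Fin.contractNth l (· * ·) t) : Fin (m + 1) → G) := by
  funext i
  refine Fin.cases ?_ (fun i => ?_) i
  · rw [Fin.contractNth_apply_of_lt _ _ _ _ (by simp)]; rfl
  · simp only [Fin.contractNth, Fin.val_succ, Fin.cons_succ, add_lt_add_iff_right,
      add_left_inj, Fin.castSucc_succ]

theorem contractChain_cons {m : ℕ} (g : G) (y : (Fin (m + 1) → G) →₀ N) :
    contractChain N (consChain N g y) = mulFirst N g y - consChain N g (contractChain N y) := by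
  induction y using Finsupp.induction_linear with
  | zero => simp
  | add x y hx hy => simp only [map_add, hx, hy]; abel
  | single t n =>
    rw [consChain_single, contractChain_single, contractChain_single, mulFirst_single,
      Fin.sum_univ_succ, map_sum, sub_eq_add_neg, ← Finset.sum_neg_distrib, contractNth_zero_cons]
    simp only [Fin.val_zero, pow_zero, one_smul, Fin.val_succ, contractNth_succ_cons, map_smul,
      consChain_single, pow_succ, mul_neg_one, neg_smul]

theorem contractChain_cons_zero (g : G) (y : (Fin 0 → G) →₀ N) :
    contractChain N (consChain N g y) = y := by
  induction y using Finsupp.induction_linear with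
  | zero => simp
  | add x y hx hy => simp only [map_add, hx, hy]
  | single t n =>
    rw [consChain_single, contractChain_single, Fin.sum_univ_one]
    simp only [Fin.val_zero, pow_zero, one_smul]
    congr 1
    exact Subsingleton.elim _ _

theorem insertChain_cons {m : ℕ} (x g : G) (y : (Fin m → G) →₀ N) :
    insertChain N x (consChain N g y) =
      consChain N x (consChain N g y) - consChain N g (insertChain N x y) := by
  induction y using Finsupp.induction_linear with
  | zero => simp
  | add x y hx hy => simp only [map_add, hx, hy]; abel
  | single t n =>
    rw [consChain_single, insertChain_single, insertChain_single, consChain_single,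
      Fin.sum_univ_succ, map_sum, sub_eq_add_neg, ← Finset.sum_neg_distrib]
    simp only [Fin.val_zero, pow_zero, one_smul, Fin.val_succ, Fin.insertNth_succ_cons, map_smul,
      consChain_single, pow_succ, mul_neg_one, neg_smul, Fin.insertNth_zero']

theorem insertChain_zero (x : G) (y : (Fin 0 → G) →₀ N) : insertChain N x y = consChain N x y := by
  induction y using Finsupp.induction_linear with
  | zero => simp
  | add x y hx hy => simp only [map_add, hx, hy]
  | single t n =>
    rw [consChain_single, insertChain_single, Fin.sum_univ_one]
    simp

theorem contractChain_insertChain_zero (x : G) (y : (Fin 0 → G) →₀ N) :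
    contractChain N (insertChain N x y) = y := by
  rw [insertChain_zero, contractChain_cons_zero]

theorem mulFirst_cons {m : ℕ} (g a : G) (y : (Fin m → G) →₀ N) :
    mulFirst N g (consChain N a y) = consChain N (g * a) y := by
  induction y using Finsupp.induction_linear with
  | zero => simp
  | add x y hx hy => simp only [map_add, hx, hy]
  | single t n => simp [mulFirst_single, consChain_single]

theorem single_eq_consChain {m : ℕ} (t : Fin (m + 1) → G) (n : N) :
    Finsupp.single t n = consChain N (t 0) (Finsupp.single (fun i : Fin m => t i.succ) n) := by
  rw [consChain_single]
  congr 1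
  exact (Fin.cons_self_tail t).symm

/-- In `contractChain (insertChain x y)` the terms containing products of `x` with an entry cancel,
as `G` is commutative, and dropping the last entry `x` of the insertion at the end gives back `y`;
the remaining terms cancel against `insertChain x (contractChain y)`. -/
theorem contractChain_insertChain {m : ℕ} (x : G) (y : (Fin (m + 1) → G) →₀ N) :
    contractChain N (insertChain N x y) + insertChain N x (contractChain N y) = y := by
  induction m with
  | zero =>
    induction y using Finsupp.induction_linear with
    | zero => simp
    | add x y hx hy => simp only [map_add, ← add_add_add_comm, hx, hy]
    | single t n =>
      rw [single_eq_consChain, insertChain_cons, insertChain_zero, map_sub, contractChain_cons,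
        contractChain_cons, contractChain_cons_zero, contractChain_cons_zero, insertChain_zero,
        mulFirst_cons, mulFirst_cons, mul_comm x]
      abel
  | succ m ih =>
    induction y using Finsupp.induction_linear with
    | zero => simp
    | add x y hx hy => simp only [map_add, ← add_add_add_comm, hx, hy]
    | single t n =>
      rw [single_eq_consChain]
      generalize Finsupp.single (fun i : Fin (m + 1) => t i.succ) n = y
      generalize t 0 = g
      have key : mulFirst N x (consChain N g y) - consChain N x (mulFirst N g y) +
          insertChain N x (mulFirst N g y) - mulFirst N g (insertChain N x y) = 0 := by
        induction y using Finsupp.induction_linear with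
        | zero => simp
        | add y z hy hz =>
          simp only [map_add]
          rw [← add_zero (0 : (Fin (m + 2) → G) →₀ N)]
          refine Eq.trans ?_ (congrArg₂ (· + ·) hy hz)
          abel
        | single s n =>
          rw [single_eq_consChain]
          generalize Finsupp.single (fun i : Fin m => s i.succ) n = z
          simp only [mulFirst_cons, insertChain_cons, map_sub, mul_comm x]
          abel
      have e2 := congrArg (consChain N g) (ih y)
      rw [map_add] at e2
      rw [insertChain_cons, map_sub, contractChain_cons, contractChain_cons, contractChain_cons,
        map_sub, map_sub, insertChain_cons]
      have e3 := congrArg₂ (· + ·) key (sub_eq_zero.2 e2)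
      rw [add_zero] at e3
      rw [← sub_eq_zero, ← e3]
      abel

/-- The operator `insertChain N x` is a homotopy between the identity and the action of `x⁻¹` on
the coefficients. -/
theorem dChain_insertChain {m : ℕ} (x : G) (y : (Fin (m + 1) → G) →₀ N) :
    dChain N (m + 1) (insertChain N x y) + insertChain N x (dChain N m y) =
      coeffMap N x⁻¹ y - y := by
  induction y using Finsupp.induction_linear with
  | zero => simp
  | add y z hy hz =>
    simp only [map_add]
    rw [add_add_add_comm, hy, hz]
    abel
  | single t n =>
    have h1 : ∀ z : (Fin (m + 1) → G) →₀ N, ∀ g : G, dChain N (m + 1) (consChain N g z) =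
        coeffMap N g⁻¹ z - contractChain N (consChain N g z) := by
      intro z g
      induction z using Finsupp.induction_linear with
      | zero => simp
      | add y z hy hz => simp only [map_add, hy, hz]; abel
      | single s n =>
        rw [consChain_single, dChain_single_eq_sub, coeffMap_single]
        rfl
    have h2 : insertChain N x (Finsupp.single (fun i : Fin m => t i.succ) (N.ρ (t 0)⁻¹ n)) =
        coeffMap N (t 0)⁻¹ (insertChain N x (Finsupp.single (fun i : Fin m => t i.succ) n)) := by
      simp only [insertChain_single, map_sum, map_smul, coeffMap_single]
    have h3 := contractChain_insertChain x (Finsupp.single t n)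
    have h4 := insertChain_cons x (t 0) (Finsupp.single (fun i : Fin m => t i.succ) n)
    rw [← single_eq_consChain] at h4
    rw [dChain_single_eq_sub, map_sub, h2]
    rw [h4] at h3 ⊢
    rw [map_sub, h1, h1]
    rw [map_sub] at h3
    rw [← sub_eq_zero]
    rw [← sub_eq_zero] at h3
    rw [← neg_eq_zero, ← h3]
    abel

theorem dChain_insertChain_zero (x : G) (y : (Fin 0 → G) →₀ N) :
    dChain N 0 (insertChain N x y) = coeffMap N x⁻¹ y - y := by
  induction y using Finsupp.induction_linear with
  | zero => simp
  | add y z hy hz =>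
    simp only [map_add]
    rw [hy, hz]
    abel
  | single t n =>
    have h := contractChain_insertChain_zero x (Finsupp.single t n)
    rw [insertChain_zero, consChain_single] at h ⊢
    rw [dChain_single_eq_sub, coeffMap_single, h]
    congr 2

theorem IsCycle.dChain_insertChain {m : ℕ} {y : (Fin m → G) →₀ N} (hy : IsCycle y) (x : G) :
    dChain N m (insertChain N x y) = coeffMap N x⁻¹ y - y := by
  cases m with
  | zero => exact dChain_insertChain_zero x y
  | succ m =>
    have := HeckeClasses.dChain_insertChain x y
    rwa [hy.dChain_eq, map_zero, add_zero] at this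

end Insertion

/-! ### Fundamental chains -/

section FundamentalChain

variable {k G : Type} [CommRing k] [CommGroup G] {N : Rep.{0} k G}

/-- The permutation of `Fin (m + 1)` sending `i` to `0` and restricting to `π` on the complements. -/
def insertPerm {m : ℕ} (i : Fin (m + 1)) (π : Equiv.Perm (Fin m)) : Equiv.Perm (Fin (m + 1)) :=
  Equiv.Perm.decomposeFin.symm (0, π) * i.cycleRange

theorem insertPerm_self {m : ℕ} (i : Fin (m + 1)) (π : Equiv.Perm (Fin m)) :
    insertPerm i π i = 0 := by
  simp [insertPerm]

theorem insertPerm_succAbove {m : ℕ} (i : Fin (m + 1)) (π : Equiv.Perm (Fin m)) (j : Fin m) :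
    insertPerm i π (i.succAbove j) = (π j).succ := by
  simp [insertPerm, Fin.cycleRange_succAbove]

theorem sign_insertPerm {m : ℕ} (i : Fin (m + 1)) (π : Equiv.Perm (Fin m)) :
    Equiv.Perm.sign (insertPerm i π) = (-1) ^ (i : ℕ) * Equiv.Perm.sign π := by
  rw [insertPerm, map_mul, Fin.sign_cycleRange, Equiv.Perm.decomposeFin.symm_sign, mul_comm]
  simp

theorem bijective_insertPerm (m : ℕ) : Function.Bijective
    fun p : Fin (m + 1) × Equiv.Perm (Fin m) => insertPerm p.1 p.2 := by
  rw [Fintype.bijective_iff_injective_and_card]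
  constructor
  · rintro ⟨i, π⟩ ⟨j, ρ⟩ h
    have h' : insertPerm i π = insertPerm j ρ := h
    have hij : i = j := by
      apply (insertPerm i π).injective
      rw [insertPerm_self, h', insertPerm_self]
    subst hij
    refine Prod.ext rfl (Equiv.ext fun l => ?_)
    have := congrFun (congrArg DFunLike.coe h') (i.succAbove l)
    rw [insertPerm_succAbove, insertPerm_succAbove] at this
    exact Fin.succ_injective _ this
  · simp [Fintype.card_perm, Nat.factorial_succ]

/-- Fundamental chains are obtained by successive insertions. -/
theorem fundamentalChain_succ (n : N) {m : ℕ} (ε : Fin (m + 1) → G) :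
    fundamentalChain N n ε = insertChain N (ε 0) (fundamentalChain N n fun i => ε i.succ) := by
  unfold fundamentalChain
  rw [map_sum, ← (Equiv.ofBijective _ (bijective_insertPerm m)).sum_comp, Fintype.sum_prod_type_right]
  refine Finset.sum_congr rfl fun π _ => ?_
  rw [map_smul, insertChain_single, Finset.smul_sum]
  refine Finset.sum_congr rfl fun i _ => ?_
  have h : (fun l => ε (insertPerm i π l)) = (i.insertNth (ε 0) fun l => ε (π l).succ) := by
    refine (Fin.insertNth_eq_iff.2 ⟨?_, ?_⟩).symm
    · rw [insertPerm_self]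
    · funext l
      simp only [Fin.removeNth, insertPerm_succAbove]
  rw [Equiv.ofBijective_apply, sign_insertPerm, h, smul_smul]
  congr 1
  push_cast
  ring

theorem fundamentalChain_zero (n : N) (ε : Fin 0 → G) :
    fundamentalChain N n ε = Finsupp.single ε n := by
  unfold fundamentalChain
  rw [Fintype.sum_unique]
  simp only [Equiv.Perm.default_eq, Equiv.Perm.sign_one, Units.val_one, Int.cast_one, one_smul]
  congr 1

theorem fundamentalChain_comp_perm (n : N) {m : ℕ} (ε : Fin m → G) (τ : Equiv.Perm (Fin m)) :
    fundamentalChain N n (fun i => ε (τ i)) =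
      (((Equiv.Perm.sign τ : ℤˣ) : ℤ) : k) • fundamentalChain N n ε := by
  unfold fundamentalChain
  conv_rhs => rw [← Equiv.sum_comp (Equiv.mulLeft τ)]
  rw [Finset.smul_sum]
  refine Finset.sum_congr rfl fun π _ => ?_
  rw [smul_smul, Equiv.coe_mulLeft, map_mul, Units.val_mul, Int.cast_mul, ← mul_assoc,
    ← Int.cast_mul, ← Units.val_mul, Int.units_mul_self, Units.val_one, Int.cast_one, one_mul]
  rfl

theorem fundamentalChain_eq_zero (n : N) {m : ℕ} (ε : Fin m → G) {i j : Fin m} (hij : i ≠ j)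
    (h : ε i = ε j) : fundamentalChain N n ε = 0 := by
  refine Finset.sum_involution (fun π _ => Equiv.swap i j * π) ?_ ?_ ?_ ?_
  · intro π _
    have : (fun l => ε ((Equiv.swap i j * π) l)) = fun l => ε (π l) := by
      funext l
      rw [Equiv.Perm.mul_apply, Equiv.swap_apply_def]
      split_ifs with h1 h2
      · rw [h1, h]
      · rw [h2, h]
      · rfl
    rw [this, map_mul, Equiv.Perm.sign_swap hij, ← add_smul]
    simp
  · intro π _ _ h
    exact hij (Equiv.swap_eq_one_iff.1 (mul_eq_right.1 h))
  · simp
  · intro π _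
    simp [← mul_assoc]

theorem coeffMap_fundamentalChain (n : N) {m : ℕ} (ε : Fin m → G) (g : G) :
    coeffMap N g (fundamentalChain N n ε) = fundamentalChain N (N.ρ g n) ε := by
  simp only [fundamentalChain, map_sum, map_smul, coeffMap_single]

theorem fundamentalChain_sum {ι : Type} (s : Finset ι) (n : ι → N) {m : ℕ} (ε : Fin m → G) :
    fundamentalChain N (∑ i ∈ s, n i) ε = ∑ i ∈ s, fundamentalChain N (n i) ε := by
  simp only [fundamentalChain, Finsupp.single_finsetSum, Finset.smul_sum]
  exact Finset.sum_comm

theorem isCycle_fundamentalChain_of_fixed {n : N} {m : ℕ} (ε : Fin m → G)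
    (hn : ∀ i, N.ρ (ε i)⁻¹ n = n) : IsCycle (fundamentalChain N n ε) := by
  induction m with
  | zero => exact isCycle_zero _
  | succ m ih =>
    apply isCycle_of_dChain_eq
    rw [fundamentalChain_succ, (ih _ fun i => hn i.succ).dChain_insertChain,
      coeffMap_fundamentalChain, hn, sub_self]

/-- Translating the coefficient does not change the class of a fundamental cycle. -/
theorem fundamentalChain_translate_sub_mem_range {n : N} {m : ℕ} (ε : Fin m → G)
    (hn : ∀ i, N.ρ (ε i)⁻¹ n = n) (g : G) :
    fundamentalChain N (N.ρ g n) ε - fundamentalChain N n ε ∈ LinearMap.range (dChain N m) := by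
  refine ⟨insertChain N g⁻¹ (fundamentalChain N n ε), ?_⟩
  rw [(isCycle_fundamentalChain_of_fixed ε hn).dChain_insertChain, coeffMap_fundamentalChain,
    inv_inv]

/-- Modulo boundaries, fundamental chains are additive in the last variable. -/
theorem fundamentalChain_snoc_mul_mem_range {n : N} (hn : ∀ g, N.ρ g n = n) {m : ℕ}
    (ε : Fin m → G) (x y : G) :
    fundamentalChain N n (Fin.snoc ε (x * y) : Fin (m + 1) → G) -
      (fundamentalChain N n (Fin.snoc ε x : Fin (m + 1) → G) +
        fundamentalChain N n (Fin.snoc ε y : Fin (m + 1) → G)) ∈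
      LinearMap.range (dChain N (m + 1)) := by
  suffices h : ∃ z, (∀ g, coeffMap N g z = z) ∧ dChain N (m + 1) z =
      fundamentalChain N n (Fin.snoc ε (x * y) : Fin (m + 1) → G) -
        (fundamentalChain N n (Fin.snoc ε x : Fin (m + 1) → G) +
          fundamentalChain N n (Fin.snoc ε y : Fin (m + 1) → G)) by
    obtain ⟨z, -, hz⟩ := h
    exact ⟨z, hz⟩
  induction m with
  | zero =>
    have h1 : ∀ w : G, fundamentalChain N n (Fin.snoc ε w : Fin 1 → G) =
        Finsupp.single (fun _ => w) n := by
      intro w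
      rw [fundamentalChain_succ, fundamentalChain_zero, insertChain_zero, consChain_single]
      congr 1
      funext i
      obtain rfl : i = 0 := Subsingleton.elim (α := Fin 1) _ _
      rfl
    refine ⟨-Finsupp.single ![x, y] n, fun g => ?_, ?_⟩
    · rw [map_neg, coeffMap_single, hn]
    · have h2 : (fun i : Fin 1 => ![x, y] i.succ) = fun _ => y := by
        funext i
        rw [Subsingleton.elim i 0]
        rfl
      have h3 : Fin.contractNth (0 : Fin 2) (· * ·) ![x, y] = fun _ => x * y := by
        funext i
        obtain rfl : i = 0 := Subsingleton.elim (α := Fin 1) _ _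
        rw [Fin.contractNth_apply_of_eq _ _ _ _ rfl]
        rfl
      have h4 : Fin.contractNth (1 : Fin 2) (· * ·) ![x, y] = fun _ => x := by
        funext i
        obtain rfl : i = 0 := Subsingleton.elim (α := Fin 1) _ _
        rw [Fin.contractNth_apply_of_lt _ _ _ _ (by simp)]
        rfl
      rw [h1, h1, h1, map_neg, dChain_single, hn, Fin.sum_univ_two, h2, h3, h4]
      simp only [Fin.val_zero, Fin.val_one, zero_add, pow_one, neg_smul, one_smul, one_add_one_eq_two,
        neg_one_sq]
      abel
  | succ m ih =>
    obtain ⟨z, hz, hd⟩ := ih fun i => ε i.succ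
    have h1 : ∀ w : G, fundamentalChain N n (Fin.snoc ε w : Fin (m + 2) → G) =
        insertChain N (ε 0)
          (fundamentalChain N n (Fin.snoc (fun i => ε i.succ) w : Fin (m + 1) → G)) := by
      intro w
      rw [fundamentalChain_succ]
      congr 2
      funext i
      refine Fin.lastCases ?_ (fun i => ?_) i
      · rw [Fin.succ_last, Fin.snoc_last, Fin.snoc_last]
      · rw [Fin.succ_castSucc, Fin.snoc_castSucc, Fin.snoc_castSucc]
    have h2 : ∀ g (w : (Fin (m + 2) → G) →₀ N),
        coeffMap N g (insertChain N (ε 0) w) = insertChain N (ε 0) (coeffMap N g w) := by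
      intro g w
      induction w using Finsupp.induction_linear with
      | zero => simp
      | add x y hx hy => simp only [map_add, hx, hy]
      | single t n => simp only [insertChain_single, map_sum, map_smul, coeffMap_single]
    refine ⟨-insertChain N (ε 0) z, fun g => ?_, ?_⟩
    · rw [map_neg, h2, hz]
    · have h3 := dChain_insertChain (ε 0) z
      rw [hz, sub_self, hd] at h3
      rw [h1, h1, h1, map_neg, ← map_add, ← map_sub]
      exact neg_eq_of_add_eq_zero_right h3

end FundamentalChain

/-! ### The map on homology induced by a homomorphism -/

section HomologyMap

variable {k G H : Type} [CommRing k] [Group G] [Group H]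

theorem isCycle_chainsMap {M : Rep.{0} k G} {N : Rep.{0} k H} (f : G →* H)
    (φ : M ⟶ Rep.res f N) {m : ℕ} {x : (Fin m → G) →₀ M} (hx : IsCycle x) :
    IsCycle ((groupHomology.chainsMap f φ).f m x) := by
  intro j
  have h := (groupHomology.chainsMap f φ).comm m j
  have h2 := congrArg (fun t => t.hom x) h
  have h3 : (groupHomology.inhomogeneousChains N).d m j ((groupHomology.chainsMap f φ).f m x) =
      (groupHomology.chainsMap f φ).f j ((groupHomology.inhomogeneousChains M).d m j x) := h2
  rw [h3, hx j, map_zero]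

theorem map_homologyClass {M : Rep.{0} k G} {N : Rep.{0} k H} (f : G →* H)
    (φ : M ⟶ Rep.res f N) {m : ℕ} {x : (Fin m → G) →₀ M} (hx : IsCycle x) :
    groupHomology.map f φ m (homologyClass x hx) =
      homologyClass ((groupHomology.chainsMap f φ).f m x) (isCycle_chainsMap f φ hx) := by
  unfold homologyClass
  have h := congrArg (fun t => t.hom (groupHomology.cyclesMk m _ rfl x (hx _)))
    (groupHomology.π_map f φ m)
  refine Eq.trans h ?_
  change groupHomology.π N m (groupHomology.cyclesMap f φ m _) = _
  congr 1
  apply (ModuleCat.mono_iff_injective (groupHomology.iCycles N m)).1 inferInstance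
  rw [groupHomology.iCycles_mk]
  have h2 := congrArg (fun t => t.hom (groupHomology.cyclesMk m _ rfl x (hx _)))
    (HomologicalComplex.cyclesMap_i (groupHomology.chainsMap f φ) m)
  refine Eq.trans h2 ?_
  change (groupHomology.chainsMap f φ).f m (groupHomology.iCycles M m _) = _
  rw [groupHomology.iCycles_mk]

theorem homologyMap_homologyClass {M N : Rep.{0} k G} (φ : M ⟶ N) {m : ℕ}
    {x : (Fin m → G) →₀ M} (hx : IsCycle x) :
    homologyMap φ m (homologyClass x hx) =
      homologyClass ((groupHomology.chainsMap (MonoidHom.id G) φ).f m x)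
        (isCycle_chainsMap (MonoidHom.id G) φ hx) :=
  map_homologyClass (MonoidHom.id G) φ hx

theorem homologyClass_congr {N : Rep.{0} k G} {m : ℕ} {x y : (Fin m → G) →₀ N} (h : x = y)
    (hx : IsCycle x) (hy : IsCycle y) : homologyClass x hx = homologyClass y hy := by
  subst h; rfl

theorem homologyClass_eq_of_sub_mem_range {N : Rep.{0} k G} {m : ℕ} {x y : (Fin m → G) →₀ N}
    (hx : IsCycle x) (hy : IsCycle y) (h : x - y ∈ LinearMap.range (dChain N m)) :
    homologyClass x hx = homologyClass y hy :=
  (homologyClass_eq_iff x y hx hy).2 h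

theorem homologyClass_add {N : Rep.{0} k G} {m : ℕ} {x y : (Fin m → G) →₀ N}
    (hx : IsCycle x) (hy : IsCycle y) (hxy : IsCycle (x + y)) :
    homologyClass (x + y) hxy = homologyClass x hx + homologyClass y hy := by
  unfold homologyClass
  rw [← map_add]
  congr 1
  apply (ModuleCat.mono_iff_injective (groupHomology.iCycles N m)).1 inferInstance
  rw [map_add, groupHomology.iCycles_mk, groupHomology.iCycles_mk, groupHomology.iCycles_mk]

theorem IsCycle.add {N : Rep.{0} k G} {m : ℕ} {x y : (Fin m → G) →₀ N}
    (hx : IsCycle x) (hy : IsCycle y) : IsCycle (x + y) := by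
  intro j
  rw [map_add, hx, hy, add_zero]

theorem isCycle_smul {N : Rep.{0} k G} {m : ℕ} {x : (Fin m → G) →₀ N} (c : k)
    (hx : IsCycle x) : IsCycle (c • x) := by
  intro j
  rw [map_smul, hx, smul_zero]

theorem homologyClass_smul {N : Rep.{0} k G} {m : ℕ} {x : (Fin m → G) →₀ N} (c : k)
    (hx : IsCycle x) (hcx : IsCycle (c • x)) :
    homologyClass (c • x) hcx = c • homologyClass x hx := by
  unfold homologyClass
  rw [← map_smul]
  congr 1
  apply (ModuleCat.mono_iff_injective (groupHomology.iCycles N m)).1 inferInstance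
  rw [map_smul, groupHomology.iCycles_mk, groupHomology.iCycles_mk]

theorem chainsMap_fundamentalChain {G H : Type} [CommGroup G] [CommGroup H] {M : Rep.{0} k G}
    {N : Rep.{0} k H} (f : G →* H) (φ : M ⟶ Rep.res f N) (n : M) {m : ℕ} (ε : Fin m → G) :
    (groupHomology.chainsMap f φ).f m (fundamentalChain M n ε) =
      fundamentalChain N (φ.hom n) fun i => f (ε i) := by
  unfold fundamentalChain
  rw [map_sum]
  refine Finset.sum_congr rfl fun π _ => ?_
  rw [map_smul, groupHomology.chainsMap_f_single]
  rfl

end HomologyMap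

/-! ### The orientation class of a free abelian group -/

section Orientation

variable {E : Type} [CommGroup E]

theorem isCycle_fundamentalChain_trivial {m : ℕ} (ε : Fin m → E) :
    IsCycle (fundamentalChain (Rep.trivial ℤ E ℤ) (1 : ℤ) ε) :=
  isCycle_fundamentalChain (fun _ => rfl) _

theorem homologyClass_zero {k G : Type} [CommRing k] [Group G] {N : Rep.{0} k G} {m : ℕ}
    (h : IsCycle (0 : (Fin m → G) →₀ N)) : homologyClass 0 h = 0 := by
  have h1 := homologyClass_add h h (h.add h)
  have h2 := homologyClass_congr (add_zero (0 : (Fin m → G) →₀ N)) (h.add h) h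
  rw [h1] at h2
  exact left_eq_add.1 h2.symm

/-- The class of the fundamental cycle of `ε₁, …, ε_m ∈ E` in `H_m(E, ℤ)`. -/
noncomputable def fundamentalClassFun {m : ℕ} (ε : Fin m → Additive E) :
    groupHomology (Rep.trivial ℤ E ℤ) m :=
  homologyClass (fundamentalChain (Rep.trivial ℤ E ℤ) (1 : ℤ) fun i => (ε i).toMul)
    (isCycle_fundamentalChain_trivial _)

theorem fundamentalClassFun_perm {m : ℕ} (ε : Fin m → Additive E) (τ : Equiv.Perm (Fin m)) :
    fundamentalClassFun (fun i => ε (τ i)) =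
      ((Equiv.Perm.sign τ : ℤˣ) : ℤ) • fundamentalClassFun ε := by
  unfold fundamentalClassFun
  refine (homologyClass_congr (fundamentalChain_comp_perm _ (fun i => (ε i).toMul) τ) _
    (isCycle_smul _ (isCycle_fundamentalChain_trivial _))).trans ?_
  rw [homologyClass_smul _ (isCycle_fundamentalChain_trivial _)]
  exact int_smul_eq_zsmul _ _ _

theorem fundamentalClassFun_update_add {m : ℕ} (ε : Fin m → Additive E) (i : Fin m)
    (x y : Additive E) : fundamentalClassFun (Function.update ε i (x + y)) =
      fundamentalClassFun (Function.update ε i x) +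
        fundamentalClassFun (Function.update ε i y) := by
  cases m with
  | zero => exact i.elim0
  | succ m =>
    -- A transposition moves the `i`-th variable to the last place.
    have hs : ∀ w, fundamentalClassFun (Function.update ε i w) =
        ((Equiv.Perm.sign (Equiv.swap i (Fin.last m)) : ℤˣ) : ℤ) •
          fundamentalClassFun (Fin.snoc
            (fun l : Fin m => ε (Equiv.swap i (Fin.last m) l.castSucc)) w) := by
      intro w
      rw [← fundamentalClassFun_perm]
      congr 1
      funext l
      by_cases hl : l = i
      · subst hl
        rw [Function.update_self, Equiv.swap_apply_left, Fin.snoc_last]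
      · rw [Function.update_of_ne hl]
        have h1 : Equiv.swap i (Fin.last m) l ≠ Fin.last m := by
          intro h
          rw [Equiv.swap_apply_eq_iff, Equiv.swap_apply_right] at h
          exact hl h
        obtain ⟨l', hl'⟩ := Fin.exists_castSucc_eq.2 h1
        rw [← hl', Fin.snoc_castSucc, hl', Equiv.swap_apply_self]
    rw [hs, hs, hs, ← zsmul_add]
    congr 1
    unfold fundamentalClassFun
    rw [← homologyClass_add _ _ ((isCycle_fundamentalChain_trivial _).add
      (isCycle_fundamentalChain_trivial _))]
    apply homologyClass_eq_of_sub_mem_range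
    have h := fundamentalChain_snoc_mul_mem_range (N := Rep.trivial ℤ E ℤ) (n := (1 : ℤ))
      (fun _ => rfl) (fun l : Fin m => (ε (Equiv.swap i (Fin.last m) l.castSucc)).toMul)
      x.toMul y.toMul
    have h1 : ∀ w : Additive E, (Fin.snoc (fun l : Fin m =>
        (ε (Equiv.swap i (Fin.last m) l.castSucc)).toMul) w.toMul : Fin (m + 1) → E) = fun l =>
        ((Fin.snoc (fun l : Fin m => ε (Equiv.swap i (Fin.last m) l.castSucc)) w :
          Fin (m + 1) → Additive E) l).toMul := by
      intro w
      funext l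
      refine Fin.lastCases ?_ (fun l => ?_) l
      · rw [Fin.snoc_last, Fin.snoc_last]
      · rw [Fin.snoc_castSucc, Fin.snoc_castSucc]
    rw [h1, h1, ← toMul_add, h1] at h
    exact h

/-- The alternating multilinear map sending `ε₁, …, ε_m ∈ E` to the class of their fundamental
cycle in `H_m(E, ℤ)`. -/
noncomputable def fundamentalClass (E : Type) [CommGroup E] (m : ℕ) :
    (Additive E) [⋀^Fin m]→ₗ[ℤ] groupHomology (Rep.trivial ℤ E ℤ) m where
  toFun := fundamentalClassFun
  map_update_add' := by
    intro inst ε i x y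
    obtain rfl : inst = instDecidableEqFin m := Subsingleton.elim _ _
    exact fundamentalClassFun_update_add ε i x y
  map_update_smul' := by
    intro inst ε i a x
    obtain rfl : inst = instDecidableEqFin m := Subsingleton.elim _ _
    exact (map_zsmul (AddMonoidHom.mk' (fun x => fundamentalClassFun (Function.update ε i x))
      (fundamentalClassFun_update_add ε i)) a x).trans (int_smul_eq_zsmul _ _ _).symm
  map_eq_zero_of_eq' := by
    intro ε i j h hij
    exact (homologyClass_congr (fundamentalChain_eq_zero (N := Rep.trivial ℤ E ℤ) (1 : ℤ)
      (fun i => (ε i).toMul) hij h) (isCycle_fundamentalChain_trivial _)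
      (fun j => map_zero _)).trans (homologyClass_zero _)

end Orientation

/-! ### Independence of the class `ϑ` of the choices -/

section Regulator

variable {F : Type} [Field F] [NumberField F]

theorem ordAt_mul (v : HeightOneSpectrum (𝓞 F)) (x y : Fˣ) :
    ordAt v (x * y) = ordAt v x + ordAt v y := by
  unfold ordAt
  rw [Units.val_mul, map_mul, WithZero.log_mul (by simp) (by simp)]
  ring

/-- The functional `regulatorRow v σ j` as a homomorphism on the group of totally positive
`T`-units. -/
noncomputable def regulatorHom {r n : ℕ} (T : Finset (HeightOneSpectrum (𝓞 F)))
    (v : Fin r → HeightOneSpectrum (𝓞 F)) (σ : Fin n → F →+* ℝ) (j : Fin (r + (n - 1))) :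
    Additive (posUnits T) →+ ℝ where
  toFun x := regulatorRow v σ j (x.toMul : Fˣ)
  map_zero' := by
    refine Fin.addCases (fun i => ?_) (fun l => ?_) j
    · simp [regulatorRow, ordAt]
    · simp [regulatorRow]
  map_add' x y := by
    refine Fin.addCases (fun i => ?_) (fun l => ?_) j
    · simp [regulatorRow, ordAt_mul]
    · simp only [regulatorRow, Fin.addCases_right, toMul_add, Subgroup.coe_mul, Units.val_mul,
        map_mul]
      exact Real.log_mul (x.toMul.2.2 _).ne' (y.toMul.2.2 _).ne'

/-- The matrix whose determinant decides the orientation. -/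
noncomputable def regulatorMatrix {r n : ℕ} {T : Finset (HeightOneSpectrum (𝓞 F))}
    (v : Fin r → HeightOneSpectrum (𝓞 F)) (σ : Fin n → F →+* ℝ)
    (b : Fin (r + (n - 1)) → Additive (posUnits T)) :
    Matrix (Fin (r + (n - 1))) (Fin (r + (n - 1))) ℝ :=
  Matrix.of fun j i => regulatorRow v σ j ((b i).toMul : Fˣ)

theorem regulatorMatrix_eq_mul {r n : ℕ} {T : Finset (HeightOneSpectrum (𝓞 F))}
    (v : Fin r → HeightOneSpectrum (𝓞 F)) (σ : Fin n → F →+* ℝ)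
    (e : Module.Basis (Fin (r + (n - 1))) ℤ (Additive (posUnits T)))
    (b : Fin (r + (n - 1)) → Additive (posUnits T)) :
    regulatorMatrix v σ b = regulatorMatrix v σ e * (e.toMatrix b).map (Int.castRingHom ℝ) := by
  ext j i
  have h := congrArg (regulatorHom T v σ j) (e.sum_repr (b i))
  rw [map_sum] at h
  simp only [map_zsmul] at h
  rw [Matrix.mul_apply]
  refine h.symm.trans (Finset.sum_congr rfl fun l _ => ?_)
  rw [zsmul_eq_mul, mul_comm]
  rfl

variable [IsTotallyReal F] {r n : ℕ} {T : Finset (HeightOneSpectrum (𝓞 F))}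
  {v : Fin r → HeightOneSpectrum (𝓞 F)} {σ : Fin n → F →+* ℝ}

theorem _root_.AlternatingMap.apply_eq_of_det_eq_one {A M N ι : Type} [CommRing A] [AddCommGroup M]
    [Module A M] [AddCommGroup N] [Module A N] [Fintype ι] [DecidableEq ι] (f : M [⋀^ι]→ₗ[A] N)
    (e : Module.Basis ι A M) (b : ι → M) (hb : e.det b = 1) : f b = f e := by
  have h : f = (LinearMap.toSpanSingleton A N (f e)).compAlternatingMap e.det := by
    refine Module.Basis.ext_alternating e fun i h => ?_
    let τ : Equiv.Perm ι := Equiv.ofBijective i (Finite.injective_iff_bijective.1 h)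
    change f (e ∘ τ) = e.det (e ∘ τ) • f e
    rw [AlternatingMap.map_perm, AlternatingMap.map_perm, e.det_self]
    rcases Int.units_eq_one_or (Equiv.Perm.sign τ) with h | h <;> simp [h]
  have h2 : f b = e.det b • f e := congrArg (fun f => f b) h
  rw [h2, hb, one_smul]

/-- Two positively oriented bases of `E_{T,+}` are related by a matrix of determinant one. -/
theorem ThetaData.det_basis (D D' : ThetaData T v σ) : D.basis.det D'.basis = 1 := by
  have h1 : 0 < (regulatorMatrix v σ D.basis).det := D.oriented
  have h2 : 0 < (regulatorMatrix v σ D'.basis).det := D'.oriented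
  rw [regulatorMatrix_eq_mul v σ D.basis D'.basis, Matrix.det_mul, ← RingHom.mapMatrix_apply,
    ← RingHom.map_det] at h2
  have h3 : 0 < D.basis.det D'.basis := by
    have := (mul_pos_iff_of_pos_left h1).1 h2
    rw [Module.Basis.det_apply]
    rw [eq_intCast] at this
    exact_mod_cast this
  rcases Int.isUnit_iff.1 (D.basis.isUnit_det D'.basis) with h | h
  · exact h
  · rw [h] at h3
    exact absurd h3 (by norm_num)

theorem etaClass_eq (D D' : ThetaData T v σ) : etaClass D = etaClass D' :=
  ((fundamentalClass (posUnits T) (r + (n - 1))).apply_eq_of_det_eq_one D.basis D'.basis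
    (D.det_basis D')).symm

theorem isCycle_fundamentalChain_units (f : C_c(AdelicQuotient T T, ℤ)) {m : ℕ}
    (ε : Fin m → posUnits T) :
    IsCycle (fundamentalChain (ccRep Fˣ (AdelicQuotient T T) ℤ) f fun i => (ε i : Fˣ)) :=
  isCycle_fundamentalChain_of_fixed _ fun i => CompactlySupportedContinuousMap.ext fun y => by
    change f (((ε i : Fˣ)⁻¹)⁻¹ • y) = f y
    rw [inv_inv, smul_posUnits]

theorem theta_eq_homologyClass (D : ThetaData T v σ) :
    theta D = homologyClass (fundamentalChain (ccRep Fˣ (AdelicQuotient T T) ℤ)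
      (finsetIndicator D.domain) fun i => ((D.basis i).toMul : Fˣ))
      (isCycle_fundamentalChain_units _ _) := by
  unfold theta etaClass
  rw [map_homologyClass]
  apply homologyClass_congr
  rw [chainsMap_fundamentalChain]
  have : (indicatorHom D.domain).hom (1 : ℤ) = finsetIndicator D.domain :=
    one_smul ℤ (finsetIndicator D.domain)
  rw [this]
  rfl

theorem finsetIndicator_eq_sum {X : Type} [TopologicalSpace X] [DiscreteTopology X]
    (s : Finset X) : finsetIndicator s = ∑ z ∈ s, finsetIndicator {z} := by
  classical
  refine CompactlySupportedContinuousMap.ext fun x => ?_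
  rw [CompactlySupportedContinuousMap.coe_sum, Finset.sum_apply]
  change (if x ∈ s then (1 : ℤ) else 0) = ∑ z ∈ s, if x ∈ ({z} : Finset X) then (1 : ℤ) else 0
  simp

theorem translate_finsetIndicator_singleton (z : AdelicQuotient T T) (g : Fˣ) :
    (ccRep Fˣ (AdelicQuotient T T) ℤ).ρ g (finsetIndicator {z} : C_c(AdelicQuotient T T, ℤ)) =
      (finsetIndicator {g • z} : C_c(AdelicQuotient T T, ℤ)) := by
  classical
  refine CompactlySupportedContinuousMap.ext fun x => ?_
  change (if g⁻¹ • x ∈ ({z} : Finset _) then (1 : ℤ) else 0) =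
    if x ∈ ({g • z} : Finset _) then (1 : ℤ) else 0
  simp only [Finset.mem_singleton, inv_smul_eq_iff]

/-- The class of the fundamental cycle with coefficient the characteristic function of a
fundamental domain does not depend on that domain. -/
theorem fundamentalChain_domain_sub_mem_range (D D' : ThetaData T v σ) {m : ℕ}
    (ε : Fin m → posUnits T) :
    fundamentalChain (ccRep Fˣ (AdelicQuotient T T) ℤ) (finsetIndicator D.domain)
        (fun i => (ε i : Fˣ)) -
      fundamentalChain (ccRep Fˣ (AdelicQuotient T T) ℤ) (finsetIndicator D'.domain)
        (fun i => (ε i : Fˣ)) ∈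
      LinearMap.range (dChain (ccRep Fˣ (AdelicQuotient T T) ℤ) m) := by
  have hex : ∀ z : AdelicQuotient T T, ∃ g : Fˣ, g • z ∈ D.domain := by
    intro z
    obtain ⟨w, ⟨hw, g, hg⟩, -⟩ := D.isFundamental z
    exact ⟨g⁻¹, by rwa [← hg, inv_smul_smul]⟩
  choose g hg using hex
  have hbij : ∑ z ∈ D'.domain, fundamentalChain (ccRep Fˣ (AdelicQuotient T T) ℤ)
      (finsetIndicator {g z • z} : C_c(AdelicQuotient T T, ℤ)) (fun i => (ε i : Fˣ)) =
      ∑ z ∈ D.domain, fundamentalChain (ccRep Fˣ (AdelicQuotient T T) ℤ)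
        (finsetIndicator {z} : C_c(AdelicQuotient T T, ℤ)) (fun i => (ε i : Fˣ)) := by
    refine Finset.sum_bij (fun z _ => g z • z) (fun z _ => hg z) ?_ ?_ fun _ _ => rfl
    · intro z hz z' hz' h
      exact (D'.isFundamental z).unique ⟨hz, 1, one_smul _ _⟩
        ⟨hz', (g z)⁻¹ * g z', by rw [mul_smul, ← h, inv_smul_smul]⟩
    · intro w hw
      obtain ⟨z, ⟨hz, h, hh⟩, -⟩ := D'.isFundamental w
      refine ⟨z, hz, ?_⟩
      exact (D.isFundamental w).unique
        ⟨hg z, h * (g z)⁻¹, by rw [mul_smul, inv_smul_smul, hh]⟩ ⟨hw, 1, one_smul _ _⟩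
  have e1 := fundamentalChain_sum (N := ccRep Fˣ (AdelicQuotient T T) ℤ) D.domain
    (fun z => (finsetIndicator {z} : C_c(AdelicQuotient T T, ℤ))) (fun i => (ε i : Fˣ))
  have e2 := fundamentalChain_sum (N := ccRep Fˣ (AdelicQuotient T T) ℤ) D'.domain
    (fun z => (finsetIndicator {z} : C_c(AdelicQuotient T T, ℤ))) (fun i => (ε i : Fˣ))
  rw [finsetIndicator_eq_sum D.domain, finsetIndicator_eq_sum D'.domain]
  refine Eq.mpr (congrArg (· ∈ _) (congrArg₂ (· - ·) e1 e2)) ?_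
  rw [← hbij, ← Finset.sum_sub_distrib]
  refine Submodule.sum_mem _ fun z _ => ?_
  have h := fundamentalChain_translate_sub_mem_range (N := ccRep Fˣ (AdelicQuotient T T) ℤ)
    (n := (finsetIndicator {z} : C_c(AdelicQuotient T T, ℤ))) (fun i => (ε i : Fˣ))
    (fun i => CompactlySupportedContinuousMap.ext fun y => by
      change finsetIndicator {z} (((ε i : Fˣ)⁻¹)⁻¹ • y) = finsetIndicator {z} y
      rw [inv_inv, smul_posUnits]) (g z)
  rwa [translate_finsetIndicator_singleton] at h

/-- The class `ϑ^T` depends neither on the positively oriented basis of `E_{T,+}` nor on the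
fundamental domain. -/
theorem theta_eq (D D' : ThetaData T v σ) : theta D = theta D' := by
  let D'' : ThetaData T v σ :=
    { basis := D'.basis, oriented := D'.oriented, domain := D.domain,
      isFundamental := D.isFundamental }
  have h1 : theta D = theta D'' := congrArg
    (groupHomology.map (posUnits T).subtype (indicatorHom D.domain) (r + (n - 1)))
    (etaClass_eq D D'')
  rw [h1, theta_eq_homologyClass, theta_eq_homologyClass]
  exact homologyClass_eq_of_sub_mem_range _ _
    (fundamentalChain_domain_sub_mem_range D'' D' fun i => (D'.basis i).toMul)

end Regulator

/-! ### Triangular systems for a family of integral functionals -/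

section Triangular

variable {M : Type} [AddCommGroup M] {r : ℕ} {o : Fin r → M →+ ℤ} {η : Fin r → M}

/-- The elements `ηᵢ` are triangular with respect to the functionals `oᵢ`: `oⱼ(ηᵢ) = 0` for
`j < i`, and `oᵢ(ηᵢ)` is the positive generator of the image under `oᵢ` of the common kernel of
the `oⱼ` with `j < i`. -/
structure IsTriangular (o : Fin r → M →+ ℤ) (η : Fin r → M) : Prop where
  eq_zero : ∀ i j, j < i → o j (η i) = 0
  pos : ∀ i, 0 < o i (η i)
  dvd : ∀ i x, (∀ j < i, o j x = 0) → o i (η i) ∣ o i x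

/-- A triangular system exists as soon as each functional is nonzero on the common kernel of the
preceding ones: choose `ηᵢ` to generate the image of that kernel. -/
theorem exists_isTriangular (h : ∀ i, ∃ x, (∀ j < i, o j x = 0) ∧ o i x ≠ 0) :
    ∃ η, IsTriangular o η := by
  have key : ∀ i, ∃ y, (∀ j < i, o j y = 0) ∧ 0 < o i y ∧
      ∀ x, (∀ j < i, o j x = 0) → o i y ∣ o i x := by
    intro i
    let K : AddSubgroup M := ⨅ j : Fin r, ⨅ _ : j < i, (o j).ker
    have hK : ∀ x, x ∈ K ↔ ∀ j < i, o j x = 0 := by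
      intro x
      simp only [K, AddSubgroup.mem_iInf, AddMonoidHom.mem_ker]
    obtain ⟨a, ha⟩ := Int.subgroup_cyclic (K.map (o i))
    have hdvd : ∀ x, (∀ j < i, o j x = 0) → a ∣ o i x := by
      intro x hx
      have : o i x ∈ K.map (o i) := ⟨x, (hK x).2 hx, rfl⟩
      rw [ha, AddSubgroup.mem_closure_singleton] at this
      obtain ⟨c, hc⟩ := this
      exact ⟨c, by rw [← hc, smul_eq_mul, mul_comm]⟩
    have ha0 : a ≠ 0 := by
      rintro rfl
      obtain ⟨x, hx, hx0⟩ := h i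
      exact hx0 (zero_dvd_iff.1 (hdvd x hx))
    obtain ⟨y, hy, hya⟩ : a ∈ K.map (o i) := by
      rw [ha]
      exact AddSubgroup.mem_closure_singleton_self a
    rcases lt_or_gt_of_ne ha0 with hn | hp
    · refine ⟨-y, (hK _).1 (neg_mem hy), ?_, fun x hx => ?_⟩
      · rw [map_neg, hya]
        omega
      · rw [map_neg, hya, neg_dvd]
        exact hdvd x hx
    · refine ⟨y, (hK _).1 hy, by rwa [hya], fun x hx => ?_⟩
      rw [hya]
      exact hdvd x hx
  choose η h1 h2 h3 using key
  exact ⟨η, fun i j hj => h1 i j hj, h2, h3⟩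

/-- Any vector can be moved into a box with side lengths `oᵢ(ηᵢ)` by the lattice of the `ηᵢ`. -/
theorem IsTriangular.exists_mem_box (hη : IsTriangular o η) (f a : Fin r → ℤ) :
    ∃ x ∈ AddSubgroup.closure (Set.range η),
      ∀ i, a i ≤ f i + o i x ∧ f i + o i x < a i + o i (η i) := by
  suffices h : ∀ m ≤ r, ∃ x ∈ AddSubgroup.closure (Set.range η),
      ∀ i : Fin r, (i : ℕ) < m → a i ≤ f i + o i x ∧ f i + o i x < a i + o i (η i) by
    obtain ⟨x, hx, h⟩ := h r le_rfl
    exact ⟨x, hx, fun i => h i i.2⟩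
  intro m
  induction m with
  | zero => exact fun _ => ⟨0, zero_mem _, fun i hi => absurd hi (Nat.not_lt_zero _)⟩
  | succ m ih =>
    intro hm
    obtain ⟨x, hx, h⟩ := ih (Nat.le_of_succ_le hm)
    let l : Fin r := ⟨m, hm⟩
    let c : ℤ := (f l + o l x - a l) / o l (η l)
    refine ⟨x - c • η l, sub_mem hx (zsmul_mem (AddSubgroup.subset_closure (Set.mem_range_self l)) _), ?_⟩
    intro i hi
    rw [map_sub, map_zsmul, smul_eq_mul]
    rcases Nat.lt_succ_iff_lt_or_eq.1 hi with hlt | heq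
    · rw [hη.eq_zero l i hlt, mul_zero, sub_zero]
      exact h i hlt
    · obtain rfl : i = l := Fin.ext heq
      have h1 := Int.emod_nonneg (f l + o l x - a l) (hη.pos l).ne'
      have h2 := Int.emod_lt_of_pos (f l + o l x - a l) (hη.pos l)
      have h3 := Int.emod_add_mul_ediv (f l + o l x - a l) (o l (η l))
      have h4 : c * o l (η l) = o l (η l) * ((f l + o l x - a l) / o l (η l)) := mul_comm _ _
      constructor <;> linarith

/-- Two points of a box with side lengths `oᵢ(ηᵢ)` that differ by values of the `oᵢ` agree. -/
theorem IsTriangular.eq_zero_of_mem_box (hη : IsTriangular o η) {f a : Fin r → ℤ} {x : M}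
    (h1 : ∀ i, a i ≤ f i ∧ f i < a i + o i (η i))
    (h2 : ∀ i, a i ≤ f i + o i x ∧ f i + o i x < a i + o i (η i)) (i : Fin r) : o i x = 0 := by
  induction i using WellFoundedLT.induction with
  | _ i ih =>
    refine Int.eq_zero_of_abs_lt_dvd (hη.dvd i x ih) ?_
    obtain ⟨h3, h4⟩ := h1 i
    obtain ⟨h5, h6⟩ := h2 i
    rw [abs_lt]
    constructor <;> linarith

end Triangular

/-! ### Totally positive elements with prescribed divisor -/

section PositiveElements

variable {F : Type} [Field F] [NumberField F]

/-- A power of the ideal of `w` is principal; the square of a generator is totally positive. -/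
theorem exists_pos_generator (w : HeightOneSpectrum (𝓞 F)) : ∃ x : Fˣ,
    (∀ σ : F →+* ℝ, 0 < σ (x : F)) ∧ (∀ u ≠ w, u.valuation F (x : F) = 1) ∧
      w.valuation F (x : F) < 1 := by
  obtain ⟨a, ha⟩ : (w.asIdeal ^ Fintype.card (ClassGroup (𝓞 F))).IsPrincipal := by
    have h : ClassGroup.mk0 ⟨w.asIdeal, mem_nonZeroDivisors_of_ne_zero w.ne_bot⟩ ^
        Fintype.card (ClassGroup (𝓞 F)) = 1 := pow_card_eq_one
    rw [← map_pow, ClassGroup.mk0_eq_one_iff] at h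
    exact h
  have ha' : w.asIdeal ^ Fintype.card (ClassGroup (𝓞 F)) = Ideal.span {a} := ha
  have ha0 : a ≠ 0 := by
    rintro rfl
    rw [Ideal.span_singleton_eq_bot.2 rfl] at ha'
    exact w.ne_bot (eq_zero_of_pow_eq_zero ha')
  have hx : (algebraMap (𝓞 F) F a) ≠ 0 := by simpa using ha0
  refine ⟨Units.mk0 _ hx ^ 2, fun σ => ?_, fun u hu => ?_, ?_⟩
  · rw [Units.val_pow_eq_pow_val, map_pow]
    have : σ (algebraMap (𝓞 F) F a) ≠ 0 := by simpa using ha0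
    positivity
  · rw [Units.val_pow_eq_pow_val, map_pow]
    have h1 : u.valuation F (algebraMap (𝓞 F) F a) = 1 := by
      refine le_antisymm (u.valuation_le_one a) (not_lt.1 fun h => hu ?_)
      rw [u.valuation_lt_one_iff_dvd, ← ha'] at h
      have h2 := Ideal.dvd_iff_le.1 (u.prime.dvd_of_dvd_pow h)
      exact HeightOneSpectrum.ext (w.isMaximal.eq_of_le u.isPrime.ne_top h2).symm
    change u.valuation F (algebraMap (𝓞 F) F a) ^ 2 = 1
    rw [h1, one_pow]
  · rw [Units.val_pow_eq_pow_val, map_pow]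
    have h1 : w.valuation F (algebraMap (𝓞 F) F a) < 1 := by
      rw [w.valuation_lt_one_iff_dvd, ← ha']
      exact dvd_pow_self _ Fintype.card_ne_zero
    exact pow_lt_one₀ zero_le h1 two_ne_zero

end PositiveElements

/-! ### A basis of the totally positive units adapted to the places in `T` -/

section AdaptedBasis

variable {F : Type} [Field F] [NumberField F] {r : ℕ}

theorem ordAt_eq_zero_iff (w : HeightOneSpectrum (𝓞 F)) (x : Fˣ) :
    ordAt w x = 0 ↔ w.valuation F (x : F) = 1 := by
  have hx : w.valuation F (x : F) ≠ 0 := by simp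
  unfold ordAt
  rw [neg_eq_zero]
  constructor
  · intro h
    rw [← WithZero.exp_log hx, h, WithZero.exp_zero]
  · intro h
    rw [h, WithZero.log_one]

theorem ordAt_pos (w : HeightOneSpectrum (𝓞 F)) (x : Fˣ) (h : w.valuation F (x : F) < 1) :
    0 < ordAt w x := by
  have hx : w.valuation F (x : F) ≠ 0 := by simp
  unfold ordAt
  have := (WithZero.log_lt_log hx one_ne_zero).2 h
  rw [WithZero.log_one] at this
  omega

/-- The homomorphism `ord_v` on the group of totally positive `T`-units. -/
noncomputable def ordHom (T : Finset (HeightOneSpectrum (𝓞 F))) (w : HeightOneSpectrum (𝓞 F)) :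
    Additive (posUnits T) →+ ℤ :=
  AddMonoidHom.mk' (fun x => ordAt w (x.toMul : Fˣ)) fun _ _ => ordAt_mul _ _ _

variable (v : Fin r ↪ HeightOneSpectrum (𝓞 F))

theorem mem_posUnits_empty_iff {x : Fˣ} (hx : x ∈ posUnits (placeSet v)) :
    x ∈ posUnits (F := F) ∅ ↔ ∀ i, ordAt (v i) x = 0 := by
  constructor
  · intro h i
    exact (ordAt_eq_zero_iff _ _).2 (h.1 _ (Finset.notMem_empty _))
  · intro h
    refine ⟨fun w _ => ?_, hx.2⟩
    by_cases hw : w ∈ placeSet v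
    · obtain ⟨i, -, rfl⟩ := Finset.mem_map.1 hw
      exact (ordAt_eq_zero_iff _ _).1 (h i)
    · exact hx.1 w hw

theorem exists_isTriangular_ordHom [IsTotallyReal F] :
    ∃ η, IsTriangular (fun i => ordHom (placeSet v) (v i)) η := by
  refine exists_isTriangular fun i => ?_
  obtain ⟨x, hx, h1, h2⟩ := exists_pos_generator (v i)
  refine ⟨Additive.ofMul ⟨x, fun w hw => h1 w ?_, hx⟩, fun j hj => ?_, ?_⟩
  · rintro rfl
    exact hw (mem_placeSet v i)
  · exact (ordAt_eq_zero_iff _ _).2 (h1 _ fun h => hj.ne (v.injective h))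
  · exact (ordAt_pos _ _ h2).ne'

/-- The inclusion of the totally positive units into the totally positive `T`-units. -/
noncomputable def inclUnits (T : Finset (HeightOneSpectrum (𝓞 F))) :
    Additive (posUnits (F := F) ∅) →+ Additive (posUnits T) :=
  MonoidHom.toAdditive (Subgroup.inclusion fun _ hx =>
    ⟨fun w _ => hx.1 w (Finset.notMem_empty w), hx.2⟩)

variable [IsTotallyReal F] {n : ℕ} {σ : Fin n → F →+* ℝ} {v}

/-- The family consisting of `η₁, …, η_r` followed by a basis of the totally positive units. -/
noncomputable def adaptedFamily (η : Fin r → Additive (posUnits (placeSet v)))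
    (D₀ : ThetaData (F := F) ∅ Fin.elim0 σ) :
    Fin (r + (n - 1)) → Additive (posUnits (placeSet v)) :=
  Fin.append η fun l => inclUnits (placeSet v) (D₀.basis (Fin.cast (Nat.zero_add _).symm l))

theorem det_regulatorMatrix_adaptedFamily_pos {η : Fin r → Additive (posUnits (placeSet v))}
    (hη : IsTriangular (fun i => ordHom (placeSet v) (v i)) η)
    (D₀ : ThetaData (F := F) ∅ Fin.elim0 σ) :
    0 < (regulatorMatrix v σ (adaptedFamily η D₀)).det := by
  -- The matrix is block triangular: the units `ε` have order zero at all places.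
  let A : Matrix (Fin r) (Fin r) ℝ := Matrix.of fun j i => (ordHom (placeSet v) (v j) (η i) : ℝ)
  let C : Matrix (Fin (n - 1)) (Fin r) ℝ := Matrix.of fun l i =>
    Real.log (σ (Fin.castLE (Nat.sub_le n 1) l) ((η i).toMul : Fˣ))
  let B : Matrix (Fin (n - 1)) (Fin (n - 1)) ℝ := Matrix.of fun l i =>
    Real.log (σ (Fin.castLE (Nat.sub_le n 1) l)
      ((D₀.basis (Fin.cast (Nat.zero_add _).symm i)).toMul : Fˣ))
  have h1 : (regulatorMatrix v σ (adaptedFamily η D₀)).submatrix finSumFinEquiv finSumFinEquiv =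
      Matrix.fromBlocks A 0 C B := by
    ext i j
    rcases i with i | i <;> rcases j with j | j
    · simp [regulatorMatrix, adaptedFamily, regulatorRow, A, ordHom]
    · simp only [regulatorMatrix, adaptedFamily, regulatorRow, Matrix.submatrix_apply,
        Matrix.of_apply, finSumFinEquiv_apply_left, finSumFinEquiv_apply_right, Fin.addCases_left,
        Fin.append_right, Matrix.fromBlocks_apply₁₂, Matrix.zero_apply]
      have := (mem_posUnits_empty_iff v (inclUnits (placeSet v)
        (D₀.basis (Fin.cast (Nat.zero_add _).symm j))).toMul.2).1
        (D₀.basis (Fin.cast (Nat.zero_add _).symm j)).toMul.2 i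
      exact_mod_cast this
    · simp [regulatorMatrix, adaptedFamily, regulatorRow, C]
    · simp [regulatorMatrix, adaptedFamily, regulatorRow, B]
      rfl
  have h2 : 0 < A.det := by
    rw [Matrix.det_of_isLowerTriangular A]
    · exact Finset.prod_pos fun i _ => Int.cast_pos.2 (hη.pos i)
    · intro i j hij
      have : (i : Fin r) < j := hij
      exact Int.cast_eq_zero.2 (hη.eq_zero j i this)
  have h3 : 0 < B.det := by
    have h4 := D₀.oriented
    have h5 : B = (Matrix.of fun j i => regulatorRow Fin.elim0 σ j ((D₀.basis i).toMul : Fˣ)).submatrix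
        (finCongr (Nat.zero_add (n - 1)).symm) (finCongr (Nat.zero_add (n - 1)).symm) := by
      ext i j
      simp only [B, Matrix.of_apply, Matrix.submatrix_apply, finCongr_apply]
      have : Fin.cast (Nat.zero_add (n - 1)).symm i = Fin.natAdd 0 i := Fin.ext (by simp)
      rw [this, regulatorRow, Fin.addCases_right]
    rw [h5, Matrix.det_submatrix_equiv_self]
    exact h4
  rw [← Matrix.det_submatrix_equiv_self finSumFinEquiv, h1, Matrix.det_fromBlocks_zero₁₂]
  exact mul_pos h2 h3

theorem linearIndependent_adaptedFamily {η : Fin r → Additive (posUnits (placeSet v))}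
    (hη : IsTriangular (fun i => ordHom (placeSet v) (v i)) η)
    (D₀ : ThetaData (F := F) ∅ Fin.elim0 σ) : LinearIndependent ℤ (adaptedFamily η D₀) := by
  rw [Fintype.linearIndependent_iff]
  intro c hc i
  have h : (regulatorMatrix v σ (adaptedFamily η D₀)).mulVec (fun i => (c i : ℝ)) = 0 := by
    funext j
    have h2 := congrArg (regulatorHom (placeSet v) v σ j) hc
    rw [map_sum, map_zero] at h2
    simp only [map_zsmul] at h2
    refine Eq.trans ?_ h2
    rw [Matrix.mulVec, dotProduct]
    refine Finset.sum_congr rfl fun l _ => ?_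
    rw [zsmul_eq_mul, mul_comm]
    rfl
  have h3 := Matrix.eq_zero_of_mulVec_eq_zero
    (det_regulatorMatrix_adaptedFamily_pos hη D₀).ne' h
  exact Int.cast_eq_zero.1 (congrFun h3 i)

theorem span_adaptedFamily {η : Fin r → Additive (posUnits (placeSet v))}
    (hη : IsTriangular (fun i => ordHom (placeSet v) (v i)) η)
    (D₀ : ThetaData (F := F) ∅ Fin.elim0 σ) :
    ⊤ ≤ Submodule.span ℤ (Set.range (adaptedFamily η D₀)) := by
  intro x _
  obtain ⟨y, hy, hbox⟩ := hη.exists_mem_box (fun i => ordHom (placeSet v) (v i) x) 0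
  have h0 : ∀ i, ordHom (placeSet v) (v i) (x + y) = 0 :=
    hη.eq_zero_of_mem_box (f := 0) (a := 0)
      (fun i => ⟨le_rfl, by simpa using hη.pos i⟩)
      (fun i => by simpa [map_add] using hbox i)
  have hy' : y ∈ Submodule.span ℤ (Set.range (adaptedFamily η D₀)) := by
    have h1 : AddSubgroup.closure (Set.range η) ≤
        (Submodule.span ℤ (Set.range (adaptedFamily η D₀))).toAddSubgroup := by
      rw [AddSubgroup.closure_le]
      rintro _ ⟨i, rfl⟩
      exact Submodule.subset_span ⟨Fin.castAdd _ i, Fin.append_left _ _ _⟩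
    exact h1 hy
  have hxy : x + y ∈ Submodule.span ℤ (Set.range (adaptedFamily η D₀)) := by
    let e : Additive (posUnits (F := F) ∅) := Additive.ofMul
      ⟨((x + y).toMul : Fˣ), (mem_posUnits_empty_iff v (x + y).toMul.2).2 h0⟩
    have he : inclUnits (placeSet v) e = x + y := rfl
    have hspan : e ∈ Submodule.span ℤ (Set.range D₀.basis) := by
      rw [D₀.basis.span_eq]; trivial
    have h2 := Submodule.mem_map_of_mem (f := (inclUnits (placeSet v)).toIntLinearMap) hspan
    rw [Submodule.map_span, ← Set.range_comp] at h2
    refine Submodule.span_mono ?_ h2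
    rintro _ ⟨i, rfl⟩
    refine ⟨Fin.natAdd r (Fin.cast (Nat.zero_add _) i), ?_⟩
    exact Fin.append_right _ _ _
  have := sub_mem hxy hy'
  rwa [add_sub_cancel_right] at this

/-- The data for `ϑ^T` given by an adapted basis. -/
noncomputable def adaptedThetaData {η : Fin r → Additive (posUnits (placeSet v))}
    (hη : IsTriangular (fun i => ordHom (placeSet v) (v i)) η)
    (D₀ : ThetaData (F := F) ∅ Fin.elim0 σ) (D : ThetaData (placeSet v) v σ) :
    ThetaData (placeSet v) v σ where
  basis := Module.Basis.mk (linearIndependent_adaptedFamily hη D₀) (span_adaptedFamily hη D₀)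
  oriented := by
    rw [Module.Basis.coe_mk]
    exact det_regulatorMatrix_adaptedFamily_pos hη D₀
  domain := D.domain
  isFundamental := D.isFundamental

end AdaptedBasis

/-! ### A fundamental domain adapted to the places in `T` -/

section AdaptedDomain

variable {F : Type} [Field F] [NumberField F]

/-- The normalised additive valuation on `F_wˣ`. -/
noncomputable def localOrd (w : HeightOneSpectrum (𝓞 F)) (x : (w.adicCompletion F)ˣ) : ℤ :=
  -WithZero.log (Valued.v (x : w.adicCompletion F))

theorem localOrd_mul (w : HeightOneSpectrum (𝓞 F)) (x y : (w.adicCompletion F)ˣ) :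
    localOrd w (x * y) = localOrd w x + localOrd w y := by
  unfold localOrd
  rw [Units.val_mul, map_mul, WithZero.log_mul (by simp) (by simp)]
  ring

theorem localOrd_eq_zero_iff (w : HeightOneSpectrum (𝓞 F)) (x : (w.adicCompletion F)ˣ) :
    localOrd w x = 0 ↔ Valued.v (x : w.adicCompletion F) = 1 := by
  have hx : Valued.v (x : w.adicCompletion F) ≠ 0 := by simp
  unfold localOrd
  rw [neg_eq_zero]
  constructor
  · intro h
    rw [← WithZero.exp_log hx, h, WithZero.exp_zero]
  · intro h
    rw [h, WithZero.log_one]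

theorem localOrd_le_iff (w : HeightOneSpectrum (𝓞 F)) (x y : (w.adicCompletion F)ˣ) :
    localOrd w x ≤ localOrd w y ↔
      Valued.v (y : w.adicCompletion F) ≤ Valued.v (x : w.adicCompletion F) := by
  unfold localOrd
  rw [neg_le_neg_iff, WithZero.log_le_log (by simp) (by simp)]

theorem localOrd_principal (w : HeightOneSpectrum (𝓞 F)) (g : Fˣ) :
    localOrd w (finComp w (principal g)) = ordAt w g :=
  congrArg (fun t => -WithZero.log t) (HeightOneSpectrum.valuedAdicCompletion_eq_valuation' w (g : F))

variable [IsTotallyReal F]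

/-- The homomorphism `ord_w` on `𝔸ˣ / U`. -/
noncomputable def quotientOrd (w : HeightOneSpectrum (𝓞 F)) :
    AdelicQuotient (F := F) ∅ ∅ →* Multiplicative ℤ :=
  QuotientGroup.lift _
    ((MonoidHom.mk' (fun x => Multiplicative.ofAdd (localOrd w x)) fun x y => by
      rw [localOrd_mul, ofAdd_add]).comp ((finComp w).comp (idelesAway ∅).subtype))
    fun x hx => by
      have h := (Subgroup.mem_subgroupOf.1 hx).2.1 w (Finset.notMem_empty w)
      exact congrArg Multiplicative.ofAdd ((localOrd_eq_zero_iff _ _).2 h)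

theorem quotientOrd_quotientMk (w : HeightOneSpectrum (𝓞 F)) (x : idelesAway (F := F) ∅) :
    quotientOrd w (quotientMk ∅ ∅ x) =
      Multiplicative.ofAdd (localOrd w (finComp w (x : Idele F))) := rfl

variable (T : Finset (HeightOneSpectrum (𝓞 F)))

/-- The projection `𝔸ˣ / U → (𝔸^T)ˣ / U^T`. -/
noncomputable def projQuotient : AdelicQuotient (F := F) ∅ ∅ →* AdelicQuotient T T :=
  QuotientGroup.lift _ ((toQuotient T T).comp (idelesAway ∅).subtype) fun x hx => by
    have hx' := Subgroup.mem_subgroupOf.1 hx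
    refine (quotientMk_eq_one_iff _ _ _).2 ⟨fun w hw => finComp_projAway_of_mem hw _,
      fun w hw => ?_, fun w => ?_⟩
    · rw [finComp_projAway_of_notMem hw]
      exact hx'.2.1 w (Finset.notMem_empty w)
    · rw [infComp_projAway]
      exact hx'.2.2 w

theorem projQuotient_quotientMk (x : idelesAway (F := F) ∅) :
    projQuotient T (quotientMk ∅ ∅ x) = toQuotient T T (x : Idele F) := rfl

theorem projAway_empty (x : Idele F) : (projAway ∅ x : Idele F) = x := by
  change x * ∏ v ∈ ∅, single v (finComp v x)⁻¹ = _
  rw [Finset.prod_empty, mul_one]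

theorem projQuotient_smul (g : Fˣ) (y : AdelicQuotient (F := F) ∅ ∅) :
    projQuotient T (g • y) = g • projQuotient T y := by
  rw [smul_def, smul_def, map_mul]
  congr 1
  refine (projQuotient_quotientMk T _).trans ?_
  rw [projAway_empty]

theorem quotientOrd_smul (w : HeightOneSpectrum (𝓞 F)) (g : Fˣ) (y : AdelicQuotient (F := F) ∅ ∅) :
    (quotientOrd w (g • y)).toAdd = (quotientOrd w y).toAdd + ordAt w g := by
  rw [smul_def, map_mul, toAdd_mul, add_comm]
  congr 1
  have h : quotientOrd w (toQuotient ∅ ∅ (principal g)) =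
      Multiplicative.ofAdd (localOrd w (finComp w (projAway ∅ (principal g) : Idele F))) :=
    quotientOrd_quotientMk w _
  rw [h, projAway_empty, localOrd_principal]
  rfl

/-- An element of `𝔸ˣ / U` is determined by its image in `(𝔸^T)ˣ / U^T` and its orders at `T`. -/
theorem eq_one_of_projQuotient_eq_one {y : AdelicQuotient (F := F) ∅ ∅}
    (h1 : projQuotient T y = 1) (h2 : ∀ w ∈ T, quotientOrd w y = 1) : y = 1 := by
  obtain ⟨x, rfl⟩ := (isOpenQuotientMap_quotientMk ∅ ∅).surjective y
  have h3 := (quotientMk_eq_one_iff T T (projAway T (x : Idele F))).1 h1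
  refine (quotientMk_eq_one_iff _ _ _).2 ⟨fun w hw => absurd hw (Finset.notMem_empty w),
    fun w _ => ?_, fun w => ?_⟩
  · by_cases hw : w ∈ T
    · exact (localOrd_eq_zero_iff _ _).1 (Multiplicative.ofAdd.injective (h2 w hw))
    · have := h3.2.1 w hw
      rwa [finComp_projAway_of_notMem hw] at this
  · have := h3.2.2 w
    rwa [infComp_projAway] at this

theorem pos_of_isPos {g : Fˣ}
    (h : ∀ w : InfinitePlace F, IsPos w (infComp w (principal g) : w.Completion)) (σ : F →+* ℝ) :
    0 < σ (g : F) := by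
  let φ : F →+* ℂ := Complex.ofRealHom.comp σ
  have hφ : ComplexEmbedding.IsReal φ := by
    refine RingHom.ext fun x => ?_
    exact Complex.conj_ofReal _
  have h1 := h (InfinitePlace.mk φ)
  unfold IsPos at h1
  have h2 : ((infComp (InfinitePlace.mk φ) (principal g) : (InfinitePlace.mk φ).Completionˣ) :
      (InfinitePlace.mk φ).Completion) = ((WithAbs.equiv (InfinitePlace.mk φ).1).symm (g : F) :
        WithAbs (InfinitePlace.mk φ).1) := rfl
  rw [h2, InfinitePlace.Completion.extensionEmbeddingOfIsReal_coe] at h1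
  have h3 : ((InfinitePlace.embedding_of_isReal
      (IsTotallyReal.isReal (InfinitePlace.mk φ)) (g : F) : ℝ) : ℂ) = σ (g : F) := by
    rw [InfinitePlace.embedding_of_isReal_apply, InfinitePlace.embedding_mk_eq_of_isReal hφ]
    rfl
  have h4 : InfinitePlace.embedding_of_isReal
      (IsTotallyReal.isReal (InfinitePlace.mk φ)) (g : F) = σ (g : F) := by exact_mod_cast h3
  rw [← h4]
  exact h1

/-- The stabiliser of a point of `(𝔸^T)ˣ / U^T` in `Fˣ` consists of totally positive `T`-units. -/
theorem mem_posUnits_of_smul_eq {T : Finset (HeightOneSpectrum (𝓞 F))} {g : Fˣ}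
    {y : AdelicQuotient T T} (h : g • y = y) : g ∈ posUnits T := by
  rw [smul_def, mul_eq_right] at h
  have h3 := (quotientMk_eq_one_iff T T (projAway T (principal g))).1 h
  refine ⟨fun w hw => ?_, pos_of_isPos fun w => ?_⟩
  · have := h3.2.1 w hw
    rw [finComp_projAway_of_notMem hw] at this
    exact (HeightOneSpectrum.valuedAdicCompletion_eq_valuation' w (g : F)).symm.trans this
  · have := h3.2.2 w
    rwa [infComp_projAway] at this

variable {r n : ℕ} {σ : Fin n → F →+* ℝ} {v : Fin r ↪ HeightOneSpectrum (𝓞 F)}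

/-- The set of classes with order in `[-dᵢ, 0)` at `vᵢ` for all `i`, and with component away from
`T = {v₁, …, v_r}` in a given set. -/
def boxDomain (v : Fin r ↪ HeightOneSpectrum (𝓞 F)) (d : Fin r → ℤ)
    (s : Set (AdelicQuotient (placeSet v) (placeSet v))) : Set (AdelicQuotient (F := F) ∅ ∅) :=
  {y | projQuotient (placeSet v) y ∈ s ∧
    ∀ i, -d i ≤ (quotientOrd (v i) y).toAdd ∧ (quotientOrd (v i) y).toAdd < 0}

theorem finite_boxDomain (d : Fin r → ℤ)
    {s : Set (AdelicQuotient (placeSet v) (placeSet v))} (hs : s.Finite) :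
    (boxDomain v d s).Finite := by
  let p : AdelicQuotient (F := F) ∅ ∅ → AdelicQuotient (placeSet v) (placeSet v) × (Fin r → ℤ) :=
    fun y => (projQuotient (placeSet v) y, fun i => (quotientOrd (v i) y).toAdd)
  have hp : Set.InjOn p (boxDomain v d s) := by
    intro y _ y' _ h
    have h1 : projQuotient (placeSet v) y = projQuotient (placeSet v) y' := congrArg Prod.fst h
    have h2 : ∀ i, (quotientOrd (v i) y).toAdd = (quotientOrd (v i) y').toAdd :=
      fun i => congrFun (congrArg Prod.snd h) i
    rw [← div_eq_one]
    refine eq_one_of_projQuotient_eq_one (placeSet v) (by rw [map_div, h1, div_self']) ?_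
    intro w hw
    obtain ⟨i, -, rfl⟩ := Finset.mem_map.1 hw
    rw [map_div, Multiplicative.toAdd.injective (h2 i), div_self']
  refine Set.Finite.of_finite_image ?_ hp
  refine (hs.prod (Set.finite_Icc (fun i => -d i) 0)).subset ?_
  rintro _ ⟨y, hy, rfl⟩
  exact ⟨hy.1, fun i => (hy.2 i).1, fun i => (hy.2 i).2.le⟩

theorem boxDomain_isFundamental {η : Fin r → Additive (posUnits (placeSet v))}
    (hη : IsTriangular (fun i => ordHom (placeSet v) (v i)) η)
    (D : ThetaData (placeSet v) v σ) (y : AdelicQuotient (F := F) ∅ ∅) :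
    ∃! z, z ∈ boxDomain v (fun i => ordHom (placeSet v) (v i) (η i)) D.domain ∧
      ∃ g : Fˣ, g • z = y := by
  obtain ⟨z', ⟨hz', g, hg⟩, huniq⟩ := D.isFundamental (projQuotient (placeSet v) y)
  obtain ⟨x, -, hx⟩ := hη.exists_mem_box (fun i => (quotientOrd (v i) (g⁻¹ • y)).toAdd)
    (fun i => -ordHom (placeSet v) (v i) (η i))
  have hproj : ∀ (u : posUnits (placeSet v)) (y : AdelicQuotient (F := F) ∅ ∅),
      projQuotient (placeSet v) ((u : Fˣ) • y) = projQuotient (placeSet v) y := by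
    intro u y
    rw [projQuotient_smul, smul_posUnits]
  refine ⟨(x.toMul : Fˣ) • g⁻¹ • y, ⟨⟨?_, fun i => ?_⟩, g * (x.toMul : Fˣ)⁻¹, ?_⟩, ?_⟩
  · rw [hproj, projQuotient_smul, ← hg, inv_smul_smul]
    exact hz'
  · rw [quotientOrd_smul]
    have := hx i
    rw [neg_add_cancel] at this
    exact this
  · rw [smul_smul, inv_mul_cancel_right, smul_inv_smul]
  · rintro z ⟨⟨hz1, hz2⟩, h, rfl⟩
    set z₀ := (x.toMul : Fˣ) • g⁻¹ • h • z with hz₀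
    have hz₀1 : projQuotient (placeSet v) z₀ = z' := by
      rw [hz₀, hproj, projQuotient_smul, ← hg, inv_smul_smul]
    have hz₀2 : ∀ i, -ordHom (placeSet v) (v i) (η i) ≤ (quotientOrd (v i) z₀).toAdd ∧
        (quotientOrd (v i) z₀).toAdd < 0 := by
      intro i
      rw [hz₀, quotientOrd_smul]
      have := hx i
      rw [neg_add_cancel] at this
      exact this
    have hzz : projQuotient (placeSet v) z = z' :=
      huniq _ ⟨hz1, h, (projQuotient_smul _ _ _).symm⟩
    -- The element `e` carries one point of the box to the other and fixes their projection.
    set e : Fˣ := (x.toMul : Fˣ) * g⁻¹ * h with he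
    have hez : e • z = z₀ := by rw [he, hz₀, mul_smul, mul_smul]
    have heT : e ∈ posUnits (placeSet v) := by
      refine mem_posUnits_of_smul_eq (y := z') ?_
      rw [← hzz, ← projQuotient_smul, hez, hz₀1, hzz]
    have he0 := hη.eq_zero_of_mem_box (x := Additive.ofMul (⟨e, heT⟩ : posUnits (placeSet v)))
      (f := fun i => (quotientOrd (v i) z).toAdd)
      (a := fun i => -ordHom (placeSet v) (v i) (η i))
      (fun i => by rw [neg_add_cancel]; exact hz2 i)
      (fun i => by
        have h1 : ordHom (placeSet v) (v i) (Additive.ofMul (⟨e, heT⟩ : posUnits (placeSet v))) =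
          ordAt (v i) e := rfl
        rw [neg_add_cancel, h1, ← quotientOrd_smul, hez]
        exact hz₀2 i)
    have he1 := (mem_posUnits_empty_iff v heT).2 he0
    rw [← hez]
    exact (smul_posUnits ⟨e, he1⟩ z).symm

/-- The data for `ϑ` given by the box domain. -/
noncomputable def boxThetaData {η : Fin r → Additive (posUnits (placeSet v))}
    (hη : IsTriangular (fun i => ordHom (placeSet v) (v i)) η)
    (D₀ : ThetaData (F := F) ∅ Fin.elim0 σ) (D : ThetaData (placeSet v) v σ) :
    ThetaData (F := F) ∅ Fin.elim0 σ where
  basis := D₀.basis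
  oriented := D₀.oriented
  domain := (finite_boxDomain (fun i => ordHom (placeSet v) (v i) (η i))
    D.domain.finite_toSet).toFinset
  isFundamental y := by
    simp only [Set.Finite.mem_toFinset]
    exact boxDomain_isFundamental hη D y

end AdaptedDomain

/-! ### Cup products of cohomologous cocycles -/

section CupCoboundary

variable {k G : Type} [CommRing k] [Group G]

/-- Inserting a coboundary `g ↦ g b - b` as the `i`-th factor makes a cup product of `1`-cocycles
a coboundary, namely that of the cochain with `b` inserted as the `i`-th factor, up to sign. -/
theorem cupOne_update_mem_range {s : ℕ} {M : Fin (s + 1) → Rep.{0} k G} (z : ∀ i, G → M i)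
    (hz : ∀ i g h, z i (g * h) = z i g + (M i).ρ g (z i h)) (i : Fin (s + 1)) (b : M i) :
    cupOne (Function.update z i fun g => (M i).ρ g b - b) ∈
      LinearMap.range (dCochain (tensorRep M) s) := by
  let Φ : M i →ₗ[k] MultilinearMap k (fun l : Fin s => M (i.succAbove l))
      (PiTensorProduct k fun i => M i) :=
    MultilinearMap.curryMid (M := fun i => (M i : Type)) i (PiTensorProduct.tprod k)
  have hΦ : ∀ w f, Φ w f = PiTensorProduct.tprod k (i.insertNth w f : ∀ i, M i) := fun w f => rfl
  let κ : (Fin s → G) → tensorRep M := fun g => Φ ((M i).ρ (Fin.partialProd g i) b) fun l =>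
    (M (i.succAbove l)).ρ (Fin.partialProd g l.castSucc) (z (i.succAbove l) (g l))
  refine ⟨(-1 : k) ^ (i : ℕ) • κ, ?_⟩
  funext g
  -- The tensors in which the variable with index `q` does not occur.
  let f : ℕ → ∀ l : Fin s, M (i.succAbove l) := fun q l =>
    if (l : ℕ) < q then (M (i.succAbove l)).ρ (Fin.partialProd g l.castSucc.castSucc)
      (z (i.succAbove l) (g l.castSucc))
    else (M (i.succAbove l)).ρ (Fin.partialProd g l.succ.castSucc) (z (i.succAbove l) (g l.succ))
  let A : G → ℕ → tensorRep M := fun c q => Φ ((M i).ρ c b) (f q)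
  let cp : G := Fin.partialProd g i.succ
  let cm : G := Fin.partialProd g i.castSucc
  have h0 : (tensorRep M).ρ (g 0) (κ fun i => g i.succ) = A cp 0 := by
    refine (PiTensorProduct.map_tprod _ _).trans ?_
    change _ = PiTensorProduct.tprod k (i.insertNth _ _ : ∀ i, M i)
    congr 1
    have hP : ∀ (l : Fin (s + 1)), g 0 * Fin.partialProd (fun i : Fin s => g i.succ) l =
        Fin.partialProd g l.succ := fun l => (Fin.partialProd_succ' g l).symm
    refine Fin.eq_insertNth_iff.2 ⟨?_, ?_⟩
    · simp only [Fin.insertNth_apply_same]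
      rw [← Module.End.mul_apply, ← map_mul, hP]
    · funext l
      simp only [Fin.removeNth, Fin.insertNth_apply_succAbove, f, not_lt_zero, if_false]
      rw [← Module.End.mul_apply, ← map_mul, hP]
      rfl
  have hl : ∀ q : Fin s, κ (Fin.contractNth q.castSucc (· * ·) g) =
      A (if (i : ℕ) ≤ q then cm else cp) q + A (if (i : ℕ) ≤ q then cm else cp) (q + 1) := by
    intro q
    have hP : ∀ l : Fin (s + 1), Fin.partialProd (Fin.contractNth q.castSucc (· * ·) g) l =
        if (l : ℕ) ≤ q then Fin.partialProd g l.castSucc else Fin.partialProd g l.succ := by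
      intro l
      refine (congrFun (Fin.partialProd_contractNth g q.castSucc) l).trans ?_
      simp only [Function.comp]
      split_ifs with h
      · rw [Fin.succAbove_of_castSucc_lt]
        exact Fin.lt_def.2 (Nat.lt_succ_of_le h)
      · rw [Fin.succAbove_of_le_castSucc]
        exact Fin.le_def.2 (Nat.lt_of_not_le h)
    have e1 : (fun l => (M (i.succAbove l)).ρ
        (Fin.partialProd (Fin.contractNth q.castSucc (· * ·) g) l.castSucc)
        (z (i.succAbove l) (Fin.contractNth q.castSucc (· * ·) g l))) = Function.update (f q) q
          ((M (i.succAbove q)).ρ (Fin.partialProd g q.succ.castSucc)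
            (z (i.succAbove q) (g q.succ)) +
          (M (i.succAbove q)).ρ (Fin.partialProd g q.castSucc.castSucc)
            (z (i.succAbove q) (g q.castSucc))) := by
      funext l
      rw [hP, Fin.val_castSucc]
      rcases lt_trichotomy l q with h | h | h
      · rw [Function.update_of_ne h.ne, if_pos (Fin.le_def.1 h.le),
          Fin.contractNth_apply_of_lt _ _ _ _ (by simpa using h)]
        simp only [f]
        rw [if_pos (by simpa using h)]
      · subst h
        rw [Function.update_self, if_pos le_rfl, Fin.contractNth_apply_of_eq _ _ _ _ (by simp), hz,
          map_add, ← Module.End.mul_apply, ← map_mul, add_comm, ← Fin.succ_castSucc,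
          Fin.partialProd_succ]
      · rw [Function.update_of_ne h.ne', if_neg (not_le.2 (Fin.lt_def.1 h)),
          Fin.contractNth_apply_of_gt _ _ _ _ (by simpa using h)]
        simp only [f]
        rw [if_neg (by simpa using h.le)]
        rfl
    have e2 : Fin.partialProd (Fin.contractNth q.castSucc (· * ·) g) i =
        if (i : ℕ) ≤ q then cm else cp := hP i
    change Φ _ _ = _
    rw [e1, e2, MultilinearMap.map_update_add]
    congr 1
    · change Φ _ _ = Φ _ _
      congr 1
      funext l
      rcases eq_or_ne l q with h | h
      · subst h
        simp [f]
      · rw [Function.update_of_ne h]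
    · change Φ _ _ = Φ _ _
      congr 1
      funext l
      rcases eq_or_ne l q with h | h
      · subst h
        simp [f]
      · rw [Function.update_of_ne h]
        simp only [f]
        have : (l : ℕ) < q ↔ (l : ℕ) < q + 1 := by
          have : (l : ℕ) ≠ q := fun h' => h (Fin.ext h')
          omega
        simp only [this]
  have hr : κ (Fin.contractNth (Fin.last s) (· * ·) g) = A cm s := by
    have hP : ∀ l : Fin (s + 1), Fin.partialProd (Fin.contractNth (Fin.last s) (· * ·) g) l =
        Fin.partialProd g l.castSucc := by
      intro l
      refine (congrFun (Fin.partialProd_contractNth g (Fin.last s)) l).trans ?_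
      simp only [Function.comp]
      rw [Fin.succAbove_of_castSucc_lt]
      simp [Fin.lt_def]
      omega
    change Φ _ _ = Φ _ _
    rw [hP]
    congr 1
    funext l
    simp only [f]
    rw [if_pos l.2, hP, Fin.contractNth_apply_of_lt _ _ _ _ (by simp)]
  have ht : ∀ q : ℕ, ∑ l : Fin q, (-1 : k) ^ ((l : ℕ) + 1) •
      (A (if (i : ℕ) ≤ l then cm else cp) l + A (if (i : ℕ) ≤ l then cm else cp) (l + 1)) =
      if q ≤ i then (-1 : k) ^ q • A cp q - A cp 0
      else (-1 : k) ^ q • A cm q - A cp 0 + (-1 : k) ^ (i : ℕ) • (A cp i - A cm i) := by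
    intro q
    induction q with
    | zero => simp
    | succ q ih =>
      rw [Fin.sum_univ_castSucc]
      simp only [Fin.val_castSucc, Fin.val_last]
      rw [ih, pow_succ, mul_neg_one]
      rcases lt_trichotomy q (i : ℕ) with h | h | h
      · rw [if_pos h.le, if_neg (by omega), if_pos (by omega), smul_add, neg_smul, neg_smul]
        abel
      · rw [if_pos h.le, if_pos h.ge, if_neg (by omega), h]
        simp only [smul_add, neg_smul, smul_sub]
        abel
      · rw [if_neg (by omega), if_pos h.le, if_neg (by omega)]
        simp only [smul_add, neg_smul, smul_sub]
        abel
  have hfin : (dCochain (tensorRep M) s κ) g = (-1 : k) ^ (i : ℕ) • (A cp i - A cm i) := by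
    rw [dCochain_apply, Fin.sum_univ_castSucc, h0, hr]
    simp only [hl, Fin.val_castSucc, Fin.val_last, ht]
    rw [pow_succ, mul_neg_one, neg_smul]
    split_ifs with h
    · have : (i : ℕ) = s := by omega
      rw [this, smul_sub]
      abel
    · abel
  have hcup : cupOne (Function.update z i fun g => (M i).ρ g b - b) g = A cp i - A cm i := by
    have e1 : A cp i - A cm i = Φ ((M i).ρ cp b - (M i).ρ cm b) (f i) := by
      change Φ _ _ - Φ _ _ = _
      rw [map_sub]
      rfl
    rw [e1, hΦ]
    change PiTensorProduct.tprod k _ = _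
    congr 1
    refine Fin.eq_insertNth_iff.2 ⟨?_, ?_⟩
    · rw [Function.update_self, map_sub]
      congr 1
      rw [← Module.End.mul_apply, ← map_mul]
      simp only [cp]
      rw [Fin.partialProd_succ]
    · funext l
      simp only [Fin.removeNth, f]
      rw [Function.update_of_ne (Fin.succAbove_ne i l)]
      split_ifs with h
      · have : i.succAbove l = l.castSucc := Fin.succAbove_of_castSucc_lt _ _ (Fin.lt_def.2 h)
        congr 2
        · rw [this]
        · rw [this]
      · have : i.succAbove l = l.succ := Fin.succAbove_of_le_castSucc _ _
          (Fin.le_def.2 (not_lt.1 h))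
        congr 2
        · rw [this]
        · rw [this]
  rw [map_smul, hcup]
  change (-1 : k) ^ (i : ℕ) • (dCochain (tensorRep M) s κ) g = _
  rw [hfin, smul_smul, ← mul_pow]
  simp

/-- The class of a cup product of `1`-cocycles only depends on the classes of the cocycles. -/
theorem cohomologyClass_cupOne_eq {r : ℕ} {M : Fin r → Rep.{0} k G} (z z' : ∀ i, G → M i)
    (hz : ∀ i g h, z i (g * h) = z i g + (M i).ρ g (z i h))
    (hz' : ∀ i g h, z' i (g * h) = z' i g + (M i).ρ g (z' i h))
    (b : ∀ i, M i) (h : ∀ i g, z' i g = z i g + ((M i).ρ g (b i) - b i)) :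
    cohomologyClass (cupOne z') (isCocycle_cupOne z' hz') =
      cohomologyClass (cupOne z) (isCocycle_cupOne z hz) := by
  classical
  let w : Finset (Fin r) → ∀ i, G → M i := fun J i => if i ∈ J then z' i else z i
  have hw : ∀ J i g h, w J i (g * h) = w J i g + (M i).ρ g (w J i h) := by
    intro J i g h
    simp only [w]
    split_ifs
    · exact hz' i g h
    · exact hz i g h
  have key : ∀ J, cohomologyClass (cupOne (w J)) (isCocycle_cupOne _ (hw J)) =
      cohomologyClass (cupOne z) (isCocycle_cupOne z hz) := by
    intro J
    induction J using Finset.induction_on with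
    | empty =>
      have : w ∅ = z := by simp [w]
      simp only [this]
    | insert i J hi ih =>
      rw [← ih]
      cases r with
      | zero => exact i.elim0
      | succ s =>
        rw [cohomologyClass_eq_iff]
        obtain ⟨y, hy⟩ := cupOne_update_mem_range (w J) (hw J) i (b i)
        refine ⟨y, ?_⟩
        change dCochain (tensorRep M) s y = _
        rw [hy, eq_sub_iff_add_eq]
        funext g
        have h1 : w (insert i J) = Function.update (w J) i
            (fun g => ((M i).ρ g (b i) - b i) + w J i g) := by
          funext l
          rcases eq_or_ne l i with hl | hl
          · subst hl
            funext g
            simp only [w, Finset.mem_insert_self, if_true, Function.update_self, if_neg hi, h]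
            abel
          · rw [Function.update_of_ne hl]
            simp [w, hl]
        have h2 : ∀ c : G → M i, cupOne (Function.update (w J) i c) g =
            PiTensorProduct.tprod k (Function.update (fun l => (M l).ρ
              (Fin.partialProd g l.castSucc) (w J l (g l))) i
                ((M i).ρ (Fin.partialProd g i.castSucc) (c (g i)))) := by
          intro c
          change PiTensorProduct.tprod k _ = _
          congr 1
          funext l
          rcases eq_or_ne l i with hl | hl
          · subst hl
            simp
          · simp [Function.update_of_ne hl]
        have h3 : cupOne (w J) g = cupOne (Function.update (w J) i (w J i)) g := by
          rw [Function.update_eq_self]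
        rw [h1, Pi.add_apply, h3, h2, h2, h2, map_add, MultilinearMap.map_update_add]
        rfl
  have h1 := key Finset.univ
  have h2 : w Finset.univ = z' := by simp [w]
  simp only [h2] at h1
  exact h1

end CupCoboundary

/-! ### Twisted modules and their cocycles -/

section Twisted

variable {G X R : Type} [Group G] [TopologicalSpace X] [MulAction G X] [ContinuousConstSMul G X]
  [CommRing R] [TopologicalSpace R] [IsTopologicalRing R]

/-- The `G`-module `C_c(X, R)` with the action twisted by a character: `(g f)(x) = χ(g) f(g⁻¹ x)`. -/
noncomputable def twistRep (χ : G →* Rˣ) (X : Type) [TopologicalSpace X] [MulAction G X]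
    [ContinuousConstSMul G X] : Rep.{0} ℤ G :=
  Rep.of (X := C_c(X, R))
    { toFun := fun g =>
        { toFun := fun f => (χ g : R) • ccTranslate g f
          map_add' := fun f f' => CompactlySupportedContinuousMap.ext fun x =>
            mul_add (χ g : R) (f (g⁻¹ • x)) (f' (g⁻¹ • x))
          map_smul' := fun n f => CompactlySupportedContinuousMap.ext fun x =>
            mul_smul_comm n (χ g : R) (f (g⁻¹ • x)) }
      map_one' := by
        ext f x
        change (χ 1 : R) * f ((1 : G)⁻¹ • x) = f x
        rw [map_one, Units.val_one, one_mul, inv_one, one_smul]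
      map_mul' := fun g h => by
        ext f x
        change (χ (g * h) : R) * f ((g * h)⁻¹ • x) = (χ g : R) * ((χ h : R) * f (h⁻¹ • g⁻¹ • x))
        rw [map_mul, Units.val_mul, mul_assoc, mul_inv_rev, mul_smul] }

end Twisted

section TwistedCocycle

variable {F : Type} [Field F] [NumberField F] {v : HeightOneSpectrum (𝓞 F)}
  {R : Type} [CommRing R] [TopologicalSpace R] [IsTopologicalRing R]

theorem indicatorScaled_zero (x : (v.adicCompletion F)ˣ) : indicatorScaled x 0 = 1 :=
  if_pos (by simp)

open Classical in
/-- The function `((1_{O_v} - 1_{x O_v}) c)_!` attached to a multiplicative character `c`. -/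
noncomputable def wFun (c : (v.adicCompletion F)ˣ →* Rˣ) (x : (v.adicCompletion F)ˣ)
    (y : v.adicCompletion F) : R :=
  if hy : y = 0 then 0
  else (indicatorScaled 1 y - indicatorScaled x y) • (c (Units.mk0 y hy) : R)

theorem continuous_wFun (c : (v.adicCompletion F)ˣ →* Rˣ) (hc : Continuous c)
    (x : (v.adicCompletion F)ˣ) : Continuous (wFun c x) := by
  classical
  rw [continuous_iff_continuousAt]
  intro y
  by_cases hy : y = 0
  · subst hy
    have h1 : {y : v.adicCompletion F | Valued.v y ≤ Valued.v ((1 : (v.adicCompletion F)ˣ) :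
        v.adicCompletion F)} ∈ nhds 0 := (isClopen_scaled 1).2.mem_nhds (by simp)
    have h2 : {y : v.adicCompletion F | Valued.v y ≤ Valued.v (x : v.adicCompletion F)} ∈
        nhds 0 := (isClopen_scaled x).2.mem_nhds (by simp)
    refine (continuousAt_const (y := (0 : R))).congr ?_
    filter_upwards [h1, h2] with y hy1 hy2
    unfold wFun
    split_ifs with hy
    · rfl
    · rw [indicatorScaled, indicatorScaled, if_pos hy1, if_pos hy2, sub_self, zero_smul]
  · have ho : Topology.IsOpenEmbedding (Units.val : (v.adicCompletion F)ˣ → v.adicCompletion F) :=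
      IsOpenUnits.isOpenEmbedding_unitsVal
    have := ho.continuousAt_iff (x := Units.mk0 y hy) (g := wFun c x)
    rw [Units.val_mk0] at this
    rw [← this]
    have h3 : wFun c x ∘ Units.val = fun u : (v.adicCompletion F)ˣ =>
          (indicatorScaled 1 (u : v.adicCompletion F) - indicatorScaled x u) • (c u : R) := by
      funext u
      simp [wFun]
    rw [h3]
    exact ((((continuous_indicatorScaled 1).sub (continuous_indicatorScaled x)).comp
      Units.continuous_val).smul (Units.continuous_val.comp hc)).continuousAt

theorem hasCompactSupport_wFun (c : (v.adicCompletion F)ˣ →* Rˣ) (x : (v.adicCompletion F)ˣ) :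
    HasCompactSupport (wFun c x) := by
  classical
  refine ((isCompact_scaled 1).union (isCompact_scaled x)).of_isClosed_subset isClosed_closure
    (closure_minimal ?_ ((isClopen_scaled 1).1.union (isClopen_scaled x).1))
  intro y hy
  by_contra h
  rw [Set.mem_union, not_or] at h
  apply hy
  have h1 : indicatorScaled 1 y = 0 := if_neg h.1
  have h2 : indicatorScaled x y = 0 := if_neg h.2
  simp [wFun, h1, h2]

theorem wFun_mul (c : (v.adicCompletion F)ˣ →* Rˣ) (x w : (v.adicCompletion F)ˣ)
    (y : v.adicCompletion F) :
    wFun c (x * w) y = wFun c x y +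
      (c x : R) * wFun c w ((x⁻¹ : (v.adicCompletion F)ˣ) * y) := by
  have hx := indicatorScaled_mul x 1 y
  rw [mul_one] at hx
  unfold wFun
  by_cases hy : y = 0
  · subst hy
    simp
  · have hy' : (x⁻¹ : (v.adicCompletion F)ˣ) * y ≠ 0 := mul_ne_zero (Units.ne_zero _) hy
    rw [dif_neg hy, dif_neg hy, dif_neg hy', indicatorScaled_mul, ← hx]
    have h1 : Units.mk0 y hy = x * Units.mk0 _ hy' := Units.ext (by simp)
    rw [h1, map_mul, Units.val_mul, mul_smul_comm]
    module

/-- On units the function `((1_{O_v} - 1_{x O_v}) c)_!` vanishes, as `x O_v = O_v`. -/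
theorem wFun_eq_zero (c : (v.adicCompletion F)ˣ →* Rˣ) {x : (v.adicCompletion F)ˣ}
    (hx : Valued.v (x : v.adicCompletion F) = 1) (y : v.adicCompletion F) : wFun c x y = 0 := by
  have : indicatorScaled x y = indicatorScaled 1 y := by
    unfold indicatorScaled
    rw [hx, Units.val_one, map_one]
  unfold wFun
  split_ifs
  · rfl
  · rw [this, sub_self, zero_smul]

variable (c : (v.adicCompletion F)ˣ →* Rˣ) (hc : Continuous c)

/-- The character of `Fˣ` induced by a character of `F_vˣ`. -/
noncomputable def globalChar : Fˣ →* Rˣ := c.comp ((finComp v).comp principal)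

/-- The twisted `1`-cocycle `x ↦ ((1_{O_v} - 1_{x O_v}) c)_!`, restricted to `Fˣ`. -/
noncomputable def wCocycle (x : Fˣ) : twistRep (globalChar c) (v.adicCompletion F) :=
  (⟨⟨wFun c (finComp v (principal x)), continuous_wFun c hc _⟩, hasCompactSupport_wFun c _⟩ :
    C_c(v.adicCompletion F, R))

theorem inv_smul_eq (x : Fˣ) (y : v.adicCompletion F) :
    x⁻¹ • y = (((finComp v (principal x))⁻¹ : (v.adicCompletion F)ˣ) : v.adicCompletion F) * y := by
  rw [← map_inv, ← map_inv]
  exact Algebra.smul_def ((x⁻¹ : Fˣ) : F) y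

theorem wCocycle_mul (x w : Fˣ) : wCocycle c hc (x * w) =
    wCocycle c hc x + (twistRep (globalChar c) (v.adicCompletion F)).ρ x (wCocycle c hc w) :=
  CompactlySupportedContinuousMap.ext fun y => by
    change wFun c (finComp v (principal (x * w))) y = wFun c (finComp v (principal x)) y +
      (c (finComp v (principal x)) : R) * wFun c (finComp v (principal w)) (x⁻¹ • y)
    rw [map_mul, map_mul, wFun_mul, inv_smul_eq]

/-- The characteristic function of `O_v` with values in `R`. -/
noncomputable def integerIndicator : twistRep (globalChar c) (v.adicCompletion F) :=
  (⟨⟨fun y => (indicatorScaled (1 : (v.adicCompletion F)ˣ) y : R),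
    (continuous_of_discreteTopology (f := fun n : ℤ => (n : R))).comp
      (continuous_indicatorScaled 1)⟩, by
    refine (isCompact_scaled 1).of_isClosed_subset isClosed_closure
      (closure_minimal ?_ (isClopen_scaled 1).1)
    intro y hy
    by_contra h
    have h1 : indicatorScaled (1 : (v.adicCompletion F)ˣ) y = 0 := if_neg h
    exact hy (by simp [h1])⟩ : C_c(v.adicCompletion F, R))

/-- The twisted `1`-cocycle lifting `z_{dχ}`: it is cohomologous to `wCocycle`. -/
noncomputable def zLift (x : Fˣ) : twistRep (globalChar c) (v.adicCompletion F) :=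
  wCocycle c hc x + ((twistRep (globalChar c) (v.adicCompletion F)).ρ x (integerIndicator c) -
    integerIndicator c)

theorem zLift_mul (x w : Fˣ) : zLift c hc (x * w) =
    zLift c hc x + (twistRep (globalChar c) (v.adicCompletion F)).ρ x (zLift c hc w) := by
  unfold zLift
  rw [wCocycle_mul, map_mul, map_add, map_sub, Module.End.mul_apply]
  abel

theorem zLift_apply (x : Fˣ) (y : v.adicCompletion F) :
    DFunLike.coe (F := C_c(v.adicCompletion F, R)) (zLift c hc x) y =
      wFun c (finComp v (principal x)) y + ((c (finComp v (principal x)) : R) *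
        (indicatorScaled (finComp v (principal x)) y : R) -
          (indicatorScaled (1 : (v.adicCompletion F)ˣ) y : R)) := by
  have h := indicatorScaled_mul (finComp v (principal x)) 1 y
  rw [mul_one, ← inv_smul_eq] at h
  rw [h]
  rfl

end TwistedCocycle

section Compare

variable {F : Type} [Field F] [NumberField F] {v : HeightOneSpectrum (𝓞 F)}
  {R : Type} [CommRing R] [TopologicalSpace R] [IsTopologicalRing R]
  [IsTotallyReal F] {χ : Idele F →* Rˣ} {a I : Ideal R}

theorem continuous_localChar (hχ : Continuous χ) : Continuous (localChar χ v) :=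
  hχ.comp (continuous_single v)

/-- The values of `zLift` lie in `I` and lift those of `z_{dχ}`. -/
theorem zLift_eq_zCocycle (hχ : Continuous χ) (h : ∀ x, (localChar χ v x : R) - 1 ∈ I)
    (hI : I ≤ a) (x : Fˣ) (y : v.adicCompletion F) :
    ∃ s : I, (s : R) = DFunLike.coe (F := C_c(v.adicCompletion F, R))
        (zLift (localChar χ v) (continuous_localChar hχ) x) y ∧
      (Submodule.Quotient.mk s : IdealMod a I) =
        DFunLike.coe (F := C_c(v.adicCompletion F, IdealMod a I))
          (zCocycle (dChar χ h hI) (continuous_dChar χ hχ h hI) x) y := by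
  classical
  set x' := finComp v (principal x) with hx'
  let e : (v.adicCompletion F)ˣ → I := fun u => ⟨(localChar χ v u : R) - 1, h u⟩
  have he : ∀ u, (Submodule.Quotient.mk (e u) : IdealMod a I) =
    dChar χ h hI (Additive.ofMul u) := fun _ => rfl
  refine ⟨indicatorScaled x' y • e x' + if hy : y = 0 then 0
    else (indicatorScaled 1 y - indicatorScaled x' y) • e (Units.mk0 y hy), ?_, ?_⟩
  · rw [zLift_apply]
    unfold wFun
    by_cases hy : y = 0
    · subst hy
      simp [indicatorScaled_zero, e, ← hx']
    · simp only [dif_neg hy, e, Submodule.coe_add, Submodule.coe_smul_of_tower, zsmul_eq_mul, ← hx']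
      push_cast
      ring
  · change _ = zFun (dChar χ h hI) x' y
    unfold zFun
    by_cases hy : y = 0
    · rw [dif_pos hy, dif_pos hy, add_zero, add_zero, ← he]
      exact map_zsmul (Submodule.mkQ _) _ _
    · rw [dif_neg hy, dif_neg hy, ← he, ← he, Submodule.Quotient.mk_add]
      exact congrArg₂ _ (map_zsmul (Submodule.mkQ _) _ _) (map_zsmul (Submodule.mkQ _) _ _)

end Compare

/-! ### The pairing defined by the character -/

section MulProd

/-- The multiplication map `R × R^r → R`, `(x, y) ↦ x y₁ ⋯ y_r`. -/
noncomputable def mulProd (R : Type) [CommRing R] [TopologicalSpace R] [IsTopologicalRing R]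
    (r : ℕ) : ContinuousMultiadditive R (fun _ : Fin r => R) R where
  toFun x y := x * ∏ i, y i
  add_left x x' y := add_mul x x' _
  update_add x y i b b' := by
    rw [Finset.prod_update_of_mem (Finset.mem_univ i), Finset.prod_update_of_mem
      (Finset.mem_univ i), Finset.prod_update_of_mem (Finset.mem_univ i)]
    ring
  continuous := continuous_fst.mul (continuous_finsetProd _ fun i _ =>
    (continuous_apply i).comp continuous_snd)

end MulProd

section CapConst

variable {k G : Type} [CommRing k] [Group G] {M N P : Rep.{0} k G}

theorem capChain_const_single (B : Pairing M N P) {j m : ℕ} (h : 0 + j = m) (x : M)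
    (g : Fin m → G) (n : N) :
    capChain B h (fun _ => x) (Finsupp.single g n) =
      Finsupp.single (fun l => g (Fin.cast ((Nat.zero_add j).symm.trans h) l)) (B.toFun x n) := by
  rw [capChain_single, List.ofFn_zero, List.prod_nil, inv_one, map_one]
  congr 1
  funext l
  congr 1
  exact Fin.ext (Nat.zero_add _)

end CapConst

section CapConstFundamental

variable {k G : Type} [CommRing k] [CommGroup G] {M N P : Rep.{0} k G}

theorem capChain_const_fundamentalChain (B : Pairing M N P) {j m : ℕ} (h : 0 + j = m) (x : M)
    (n : N) (ε : Fin m → G) :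
    capChain B h (fun _ => x) (fundamentalChain N n ε) =
      fundamentalChain P (B.toFun x n)
        fun l => ε (Fin.cast ((Nat.zero_add j).symm.trans h) l) := by
  obtain rfl : j = m := by omega
  unfold fundamentalChain
  rw [map_sum]
  refine Finset.sum_congr rfl fun π _ => ?_
  rw [map_smul, capChain_const_single]
  rfl

end CapConstFundamental

section CharPairing

variable {F : Type} [Field F] [NumberField F] [IsTotallyReal F] {R : Type} [CommRing R]
  [TopologicalSpace R] [IsTopologicalRing R] {r : ℕ} {v : Fin r ↪ HeightOneSpectrum (𝓞 F)}
  {S T : Finset (HeightOneSpectrum (𝓞 F))} {χ : Idele F →* Rˣ}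

/-- The function `φ χ^T` on `(𝔸^T)ˣ / U^S`, for a function `φ` on `(𝔸^T)ˣ / U^T`. -/
noncomputable def charMul (h : T ⊆ S) (hχ : Continuous χ) (hU : ∀ x ∈ unitsAway S, χ x = 1) :
    C_c(AdelicQuotient T T, ℤ) →ₗ[ℤ] C_c(AdelicQuotient T S, R) :=
  (properPairing R (coarsen h) (isProperMap_coarsen h) (coarsen_smul h)).toFun
    (charFun χ T hU hχ (RingHom.id R) continuous_id)

theorem charMul_apply (h : T ⊆ S) (hχ : Continuous χ) (hU : ∀ x ∈ unitsAway S, χ x = 1)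
    (φ : C_c(AdelicQuotient T T, ℤ)) (y : AdelicQuotient T S) :
    charMul h hχ hU φ y = φ (coarsen h y) • ((restrictChar χ hU y : Rˣ) : R) := rfl

/-- The decomposition of `χ` into its components at `T` and its component away from `T`. -/
theorem prod_localChar_mul_restrictChar (hU : ∀ x ∈ unitsAway S, χ x = 1) (w : Idele F) :
    (∏ i, localChar χ (v i) (finComp (v i) w)) *
      restrictChar χ hU (toQuotient (placeSet v) S w) = χ w := by
  have h1 : restrictChar χ hU (toQuotient (placeSet v) S w) =
      χ (w * ∏ u ∈ placeSet v, single u (finComp u w)⁻¹) := rfl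
  have h2 : ∏ u ∈ placeSet v, χ (single u (finComp u w)⁻¹) =
      (∏ i, localChar χ (v i) (finComp (v i) w))⁻¹ := by
    rw [← Finset.prod_inv_distrib]
    refine (Finset.prod_map _ _ _).trans (Finset.prod_congr rfl fun i _ => ?_)
    rw [map_inv, map_inv]
    rfl
  rw [h1, map_mul, map_prod, h2, mul_comm (χ w), mul_inv_cancel_left]

/-- The character of `(𝔸^T)ˣ` is invariant under `Fˣ` up to the local characters at `T`. -/
theorem restrictChar_smul (hF : ∀ x : Fˣ, χ (principal x) = 1)
    (hU : ∀ x ∈ unitsAway S, χ x = 1) (g : Fˣ) (y : AdelicQuotient (placeSet v) S) :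
    (∏ i, localChar χ (v i) (finComp (v i) (principal g))) * restrictChar χ hU (g • y) =
      restrictChar χ hU y := by
  rw [smul_def, map_mul, ← mul_assoc, prod_localChar_mul_restrictChar, hF, one_mul]

/-- The pairing `(⨂ᵢ fᵢ, φ) ↦ ((x, y) ↦ φ(y) χ^T(y) ∏ᵢ fᵢ(xᵢ))` of the modules `C_c(F_{vᵢ}, R)`,
twisted by the local characters, with `C_c((𝔸^T)ˣ / U^T, ℤ)`. The twists make it equivariant. -/
noncomputable def charPairing (h : placeSet v ⊆ S) (hχ : Continuous χ)
    (hF : ∀ x : Fˣ, χ (principal x) = 1) (hU : ∀ x ∈ unitsAway S, χ x = 1) :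
    Pairing (tensorRep fun i => twistRep (globalChar (localChar χ (v i))) ((v i).adicCompletion F))
      (ccRep Fˣ (AdelicQuotient (placeSet v) (placeSet v)) ℤ) (ccRep Fˣ (MixedSpace v S) R) :=
  tensorPairing _ _ _
    (fun (f : ∀ i, C_c((v i).adicCompletion F, R)) (φ : C_c(AdelicQuotient (placeSet v)
      (placeSet v), ℤ)) => externalProduct (mulProd R r) f
        (charMul h hχ hU φ))
    (fun f i x y φ => externalProduct_update_add (mulProd R r) f i x y _)
    (fun f i c x φ => externalProduct_update_zsmul (mulProd R r) f i c x _)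
    (fun (f : ∀ i, C_c((v i).adicCompletion F, R)) (φ φ' : C_c(AdelicQuotient (placeSet v)
      (placeSet v), ℤ)) => CompactlySupportedContinuousMap.ext fun p =>
      (congrArg (fun t => externalProduct (mulProd R r) f t p)
        (map_add (charMul h hχ hU) φ φ')).trans ((mulProd R r).add_left _ _ _))
    (fun (f : ∀ i, C_c((v i).adicCompletion F, R)) (c : ℤ) (φ : C_c(AdelicQuotient (placeSet v)
      (placeSet v), ℤ)) => CompactlySupportedContinuousMap.ext fun p =>
      (congrArg (fun t => externalProduct (mulProd R r) f t p)
        (map_smul (charMul h hχ hU) c φ)).trans ((mulProd R r).zsmul_left c _ _))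
    (fun g (f : ∀ i, C_c((v i).adicCompletion F, R)) (φ : C_c(AdelicQuotient (placeSet v)
      (placeSet v), ℤ)) => CompactlySupportedContinuousMap.ext fun p => by
      change (φ (g⁻¹ • coarsen h p.2) • ((restrictChar χ hU p.2 : Rˣ) : R)) *
        ∏ i, (((localChar χ (v i) (finComp (v i) (principal g)) : Rˣ) : R) *
          f i (g⁻¹ • p.1 i)) =
        (φ (coarsen h (g⁻¹ • p.2)) • ((restrictChar χ hU (g⁻¹ • p.2) : Rˣ) : R)) *
        ∏ i, f i (g⁻¹ • p.1 i)
      have h1 := restrictChar_smul (v := v) hF hU g (g⁻¹ • p.2)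
      rw [smul_inv_smul] at h1
      rw [coarsen_smul, ← h1, Finset.prod_mul_distrib, Units.val_mul, Units.coe_prod]
      simp only [zsmul_eq_mul]
      ring)

theorem charPairing_tprod (h : placeSet v ⊆ S) (hχ : Continuous χ)
    (hF : ∀ x : Fˣ, χ (principal x) = 1) (hU : ∀ x ∈ unitsAway S, χ x = 1)
    (f : ∀ i, twistRep (globalChar (localChar χ (v i))) ((v i).adicCompletion F))
    (φ : ccRep Fˣ (AdelicQuotient (placeSet v) (placeSet v)) ℤ) :
    (charPairing h hχ hF hU).toFun (PiTensorProduct.tprod ℤ f) φ =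
      externalProduct (mulProd R r) (X := fun i => (v i).adicCompletion F) f
        (charMul h hχ hU φ) :=
  DFunLike.congr_fun (PiTensorProduct.lift.tprod (R := ℤ) f) φ

theorem externalPairing_tprod {G : Type} [Group G] {X : Fin r → Type} {Y : Type}
    {A₀ : Type} {A : Fin r → Type} {B : Type} [∀ i, TopologicalSpace (X i)] [TopologicalSpace Y]
    [AddCommGroup A₀] [∀ i, AddCommGroup (A i)] [AddCommGroup B] [TopologicalSpace A₀]
    [∀ i, TopologicalSpace (A i)] [TopologicalSpace B]
    [IsTopologicalAddGroup A₀] [∀ i, IsTopologicalAddGroup (A i)] [IsTopologicalAddGroup B]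
    [∀ i, MulAction G (X i)] [∀ i, ContinuousConstSMul G (X i)] [MulAction G Y]
    [ContinuousConstSMul G Y] (μ : ContinuousMultiadditive A₀ A B)
    (f : ∀ i, ccRep G (X i) (A i)) (φ : ccRep G Y A₀) :
    (externalPairing μ).toFun (PiTensorProduct.tprod ℤ f) φ = externalProduct μ f φ :=
  DFunLike.congr_fun (PiTensorProduct.lift.tprod (R := ℤ) f) φ

end CharPairing

/-! ### Lifting the cap product with `κ̄` -/

section Lifting

variable {F : Type} [Field F] [NumberField F] [IsTotallyReal F] {R : Type} [CommRing R]
  [TopologicalSpace R] [IsTopologicalRing R] {r : ℕ} {v : Fin r ↪ HeightOneSpectrum (𝓞 F)}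
  {S : Finset (HeightOneSpectrum (𝓞 F))} {χ : Idele F →* Rˣ} {a : Ideal R} {I : Fin r → Ideal R}

/-- The two pairings agree on translates of the cocycles `z_{dχ}` and `zLift`: the values of `zLift`
lift those of `z_{dχ}`, and the factors by which the twisted action differs from the untwisted one
are congruent to `1` modulo `a`. -/
theorem externalProduct_zCocycle (h : placeSet v ⊆ S) (hχ : Continuous χ)
    (hU : ∀ x ∈ unitsAway S, χ x = 1)
    (hIa : ∀ i, I i ≤ a) (hI : ∀ i x, (localChar χ (v i) x : R) - 1 ∈ I i)
    (h0 : a * ∏ i, I i = ⊥) (p g : Fin r → Fˣ)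
    (φ : C_c(AdelicQuotient (placeSet v) (placeSet v), ℤ)) (z : MixedSpace v S) :
    ((externalProduct (multPairing h0) (X := fun i => (v i).adicCompletion F)
      (fun i => (ccRep Fˣ ((v i).adicCompletion F) (IdealMod a (I i))).ρ (p i)
        (zCocycle (dChar χ (hI i) (hIa i)) (continuous_dChar χ hχ (hI i) (hIa i)) (g i)))
      ((properPairing (R ⧸ a) (coarsen h) (isProperMap_coarsen h) (coarsen_smul h)).toFun
        (charFun χ (placeSet v) hU hχ (Ideal.Quotient.mk a) continuous_quot_mk) φ) z : ↥(∏ i, I i)) : R) =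
    externalProduct (mulProd R r) (X := fun i => (v i).adicCompletion F)
      (fun i => (twistRep (globalChar (localChar χ (v i))) ((v i).adicCompletion F)).ρ (p i)
        (zLift (localChar χ (v i)) (continuous_localChar hχ) (g i)))
      (charMul h hχ hU φ) z := by
  choose s hs hs' using fun i => zLift_eq_zCocycle hχ (hI i) (hIa i) (g i) ((p i)⁻¹ • z.1 i)
  set c : ∀ i, R := fun i => ((localChar χ (v i) (finComp (v i) (principal (p i))) : Rˣ) : R)
    with hc
  set t := φ (coarsen h z.2) • ((restrictChar χ hU z.2 : Rˣ) : R) with ht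
  have e1 : φ (coarsen h z.2) • Ideal.Quotient.mk a ((restrictChar χ hU z.2 : Rˣ) : R) =
      Ideal.Quotient.mk a t := (map_zsmul (Ideal.Quotient.mk a) _ _).symm
  have e2 : (multFun a I (Ideal.Quotient.mk a t) fun i =>
      (Submodule.Quotient.mk (s i) : IdealMod a (I i)) : R) = t * ∏ i, (c i * (s i : R)) := by
    rw [multFun_mk h0]
    -- The twisting factors `c i` are congruent to `1`, hence invisible modulo `a ∏ I = 0`.
    have h1 := prod_sub_prod_mem a I Finset.univ (fun i => c i • s i) s fun i => by
      have : ((c i • s i : I i) : R) - s i = (c i - 1) * s i := by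
        rw [Submodule.coe_smul, smul_eq_mul]
        ring
      rw [this]
      exact Ideal.mul_mem_mul (hIa i (hI i _)) (s i).2
    rw [h0, Ideal.mem_bot, sub_eq_zero] at h1
    rw [← h1]
    rfl
  have e3 : (fun i => DFunLike.coe (F := C_c((v i).adicCompletion F, IdealMod a (I i)))
      (zCocycle (dChar χ (hI i) (hIa i)) (continuous_dChar χ hχ (hI i) (hIa i)) (g i))
        ((p i)⁻¹ • z.1 i)) = fun i => Submodule.Quotient.mk (s i) :=
    funext fun i => (hs' i).symm
  change (multFun a I (φ (coarsen h z.2) • Ideal.Quotient.mk a ((restrictChar χ hU z.2 : Rˣ) : R))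
    (fun i => DFunLike.coe (F := C_c((v i).adicCompletion F, IdealMod a (I i)))
      (zCocycle (dChar χ (hI i) (hIa i)) (continuous_dChar χ hχ (hI i) (hIa i)) (g i))
        ((p i)⁻¹ • z.1 i)) : R) = t * ∏ i, (c i * DFunLike.coe
          (F := C_c((v i).adicCompletion F, R))
        (zLift (localChar χ (v i)) (continuous_localChar hχ) (g i)) ((p i)⁻¹ • z.1 i))
  rw [e1, e3, e2]
  simp only [hs]

/-- At the level of chains, capping with the cup product of the `zLift` computes the image under
`ι` of capping with the cup product of the `z_{dχ}`. -/
theorem capChain_zLift (h : placeSet v ⊆ S) (hχ : Continuous χ)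
    (hF : ∀ x : Fˣ, χ (principal x) = 1) (hU : ∀ x ∈ unitsAway S, χ x = 1)
    (hIa : ∀ i, I i ≤ a) (hI : ∀ i x, (localChar χ (v i) x : R) - 1 ∈ I i)
    (h0 : a * ∏ i, I i = ⊥) {m : ℕ}
    (x : (Fin (r + m) → Fˣ) →₀ ccRep Fˣ (AdelicQuotient (placeSet v) (placeSet v)) ℤ) :
    ((groupHomology.chainsMap (MonoidHom.id Fˣ)
      (ccMap (G := Fˣ) (X := MixedSpace v S) (Submodule.subtype (∏ i, I i)).toAddMonoidHom
        continuous_subtype_val)).f m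
      (capChain (externalPairing (multPairing h0)) rfl
        (cupOne fun i => zCocycle (dChar χ (hI i) (hIa i)) (continuous_dChar χ hχ (hI i) (hIa i)))
        (capChain (properPairing (R ⧸ a) (coarsen h) (isProperMap_coarsen h) (coarsen_smul h))
          (Nat.zero_add _)
          (fun _ => charFun χ (placeSet v) hU hχ (Ideal.Quotient.mk a) continuous_quot_mk) x))) =
    capChain (charPairing h hχ hF hU) rfl
      (cupOne fun i => zLift (localChar χ (v i)) (continuous_localChar hχ)) x := by
  induction x using Finsupp.induction_linear with
  | zero => simp only [map_zero]
  | add x y hx hy => simp only [map_add, hx, hy]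
  | single g φ =>
    have e := capChain_const_single
      (properPairing (R ⧸ a) (coarsen h) (isProperMap_coarsen h) (coarsen_smul h))
      (Nat.zero_add (r + m))
      (charFun χ (placeSet v) hU hχ (Ideal.Quotient.mk a) continuous_quot_mk) g φ
    rw [e, capChain_single, capChain_single]
    refine (groupHomology.chainsMap_f_single _ _ _ _ _).trans ?_
    congr 1
    refine CompactlySupportedContinuousMap.ext fun z => ?_
    set P := (List.ofFn fun k : Fin r => g ⟨k, by omega⟩).prod
    let p : Fin r → Fˣ := fun i => Fin.partialProd (fun k : Fin r => g ⟨k, by omega⟩) i.castSucc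
    let g' : Fin r → Fˣ := fun k => g ⟨k, by omega⟩
    have e1 := externalProduct_zCocycle h hχ hU hIa hI h0 p g' φ (P⁻¹⁻¹ • z)
    have e2 := externalPairing_tprod (G := Fˣ) (multPairing h0)
      (fun i => (ccRep Fˣ ((v i).adicCompletion F) (IdealMod a (I i))).ρ (p i)
        (zCocycle (dChar χ (hI i) (hIa i)) (continuous_dChar χ hχ (hI i) (hIa i)) (g' i)))
      ((properPairing (R ⧸ a) (coarsen h) (isProperMap_coarsen h) (coarsen_smul h)).toFun
        (charFun χ (placeSet v) hU hχ (Ideal.Quotient.mk a) continuous_quot_mk) φ)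
    have e3 := charPairing_tprod h hχ hF hU
      (fun i => (twistRep (globalChar (localChar χ (v i))) ((v i).adicCompletion F)).ρ (p i)
        (zLift (localChar χ (v i)) (continuous_localChar hχ) (g' i))) φ
    exact (congrArg (fun t : C_c(MixedSpace v S, ↥(∏ i, I i)) => (t (P⁻¹⁻¹ • z) : R)) e2).trans
      (e1.trans (congrArg (fun t : C_c(MixedSpace v S, R) => t (P⁻¹⁻¹ • z)) e3.symm))

end Lifting

/-! ### The cap product with the cocycles `((1_{O_v} - 1_{x O_v}) χ_v)_!` -/

section PermSum

/-- A sum over the permutations of `Fin (r + m)` whose terms vanish unless the permutation fixes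
the first `r` elements is a sum over the permutations of `Fin m`. -/
theorem sum_perm_eq_sum_perm_natAdd {A : Type} [AddCommMonoid A] {r m : ℕ}
    (f : Equiv.Perm (Fin (r + m)) → A)
    (hf : ∀ π, (∃ i, π (Fin.castAdd m i) ≠ Fin.castAdd m i) → f π = 0) :
    ∑ π, f π = ∑ τ : Equiv.Perm (Fin m),
      f (finSumFinEquiv.permCongr (Equiv.Perm.sumCongr (1 : Equiv.Perm (Fin r)) τ)) := by
  symm
  refine Finset.sum_of_injOn (fun τ : Equiv.Perm (Fin m) =>
    finSumFinEquiv.permCongr (Equiv.Perm.sumCongr (1 : Equiv.Perm (Fin r)) τ)) ?_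
    (fun _ _ => Finset.mem_coe.2 (Finset.mem_univ _)) ?_ (fun _ _ => rfl)
  · intro τ _ τ' _ h
    have h1 := finSumFinEquiv.permCongr.injective h
    have h2 := Equiv.Perm.sumCongrHom_injective (a₁ := ((1 : Equiv.Perm (Fin r)), τ))
      (a₂ := (1, τ')) h1
    exact congrArg Prod.snd h2
  · intro π _ hπ
    apply hf
    by_contra! hfix
    apply hπ
    have h1 : ∀ i : Fin r, finSumFinEquiv.permCongr.symm π (Sum.inl i) =
        (Sum.inl i : Fin r ⊕ Fin m) := by
      intro i
      rw [Equiv.permCongr_symm, Equiv.permCongr_apply, Equiv.symm_symm, finSumFinEquiv_apply_left,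
        hfix, Equiv.symm_apply_eq, finSumFinEquiv_apply_left]
    obtain ⟨⟨ρ, τ⟩, hρ⟩ := Equiv.Perm.mem_sumCongrHom_range_of_perm_mapsTo_inl
      (σ := finSumFinEquiv.permCongr.symm π) (by rintro _ ⟨i, rfl⟩; exact ⟨i, (h1 i).symm⟩)
    have hρ1 : ρ = 1 := by
      refine Equiv.ext fun i => ?_
      have h2 := h1 i
      rw [← hρ] at h2
      exact Sum.inl_injective h2
    refine ⟨τ, Finset.mem_coe.2 (Finset.mem_univ _), ?_⟩
    subst hρ1
    exact (finSumFinEquiv.permCongr.eq_symm_apply).1 hρ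

end PermSum

section Vanishing

variable {k G : Type} [CommRing k] [Group G] {M N P : Rep.{0} k G}

theorem cupOne_eq_zero {r : ℕ} {M : Fin r → Rep.{0} k G} (z : ∀ i, G → M i) (g : Fin r → G)
    (i : Fin r) (h : z i (g i) = 0) : cupOne z g = 0 :=
  MultilinearMap.map_coord_zero (PiTensorProduct.tprod k) i
    ((congrArg ((M i).ρ (Fin.partialProd g i.castSucc)) h).trans (map_zero _))

theorem capChain_single_eq_zero (B : Pairing M N P) {i j m : ℕ} (h : i + j = m)
    (f : (Fin i → G) → M) (g : Fin m → G) (n : N)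
    (hf : (f fun k : Fin i => g ⟨k, by omega⟩) = 0) :
    capChain B h f (Finsupp.single g n) = 0 := by
  rw [capChain_single, hf, map_zero, LinearMap.zero_apply, map_zero, Finsupp.single_zero]

end Vanishing

section PartialProd

variable {F : Type} [Field F] [NumberField F] {r : ℕ}

theorem prod_ofFn_eq_partialProd_last {G : Type} [Monoid G] (e : Fin r → G) :
    (List.ofFn e).prod = Fin.partialProd e (Fin.last r) := by
  rw [Fin.partialProd, Fin.val_last, List.take_of_length_le (by simp)]

theorem ordAt_prod_ofFn (w : HeightOneSpectrum (𝓞 F)) (e : Fin r → Fˣ) (i : Fin r)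
    (h : ∀ j, i < j → ordAt w (e j) = 0) :
    ordAt w (List.ofFn e).prod = ordAt w (Fin.partialProd e i.castSucc) + ordAt w (e i) := by
  have h1 : ∀ j : Fin (r + 1), i.succ ≤ j →
      ordAt w (Fin.partialProd e j) = ordAt w (Fin.partialProd e i.succ) := by
    intro j
    induction j using Fin.induction with
    | zero => intro hj; exact absurd (Fin.le_zero_iff.1 hj) (Fin.succ_ne_zero i)
    | succ j ih =>
      intro hj
      rcases (Fin.succ_le_succ_iff.1 hj).eq_or_lt with rfl | hij
      · rfl
      · rw [Fin.partialProd_succ, ordAt_mul, h j hij, add_zero]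
        exact ih (Fin.succ_le_castSucc_iff.2 hij)
  rw [prod_ofFn_eq_partialProd_last, h1 _ (Fin.le_last _), Fin.partialProd_succ, ordAt_mul]

end PartialProd

section WCap

variable {F : Type} [Field F] [NumberField F] {R : Type} [CommRing R]
  [TopologicalSpace R] [IsTopologicalRing R]

/-- The translate by `p` of the value of `wCocycle` at `e` is `c` times the indicator function of
`ord p ≤ ord x < ord p + ord e`. -/
theorem globalChar_mul_wFun {v : HeightOneSpectrum (𝓞 F)} (c : (v.adicCompletion F)ˣ →* Rˣ)
    {e : Fˣ} (he : 0 < ordAt v e) (p : Fˣ) (x : (v.adicCompletion F)ˣ) :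
    (globalChar c p : R) *
      wFun c (finComp v (principal e)) (p⁻¹ • (x : v.adicCompletion F)) =
      if ordAt v p ≤ localOrd v x ∧ localOrd v x < ordAt v p + ordAt v e then (c x : R)
      else 0 := by
  classical
  set p' := finComp v (principal p) with hp'
  set e' := finComp v (principal e) with he'
  have hp : localOrd v p' = ordAt v p := localOrd_principal v p
  have hee : localOrd v e' = ordAt v e := localOrd_principal v e
  have h1 : p⁻¹ • (x : v.adicCompletion F) = ((p'⁻¹ * x : (v.adicCompletion F)ˣ) :
      v.adicCompletion F) := inv_smul_eq p _
  have h2 : localOrd v (p'⁻¹ * x) = localOrd v x - ordAt v p := by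
    have := localOrd_mul v p' (p'⁻¹ * x)
    rw [mul_inv_cancel_left, hp] at this
    omega
  have h3 : localOrd v (1 : (v.adicCompletion F)ˣ) = 0 :=
    (localOrd_eq_zero_iff v 1).2 (by rw [Units.val_one, map_one])
  have h4 : ∀ u : (v.adicCompletion F)ˣ,
      indicatorScaled u ((p'⁻¹ * x : (v.adicCompletion F)ˣ) : v.adicCompletion F) =
        if localOrd v u ≤ localOrd v x - ordAt v p then 1 else 0 := by
    intro u
    unfold indicatorScaled
    rw [← h2]
    exact if_congr (localOrd_le_iff v u _).symm rfl rfl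
  have h5 : (globalChar c p : R) * (c (p'⁻¹ * x) : R) = (c x : R) := by
    rw [← Units.val_mul]
    congr 1
    change c p' * c (p'⁻¹ * x) = c x
    rw [← map_mul, mul_inv_cancel_left]
  rw [h1, wFun, dif_neg (Units.ne_zero _), Units.mk0_val, h4, h4, h3, hee, mul_smul_comm, h5]
  by_cases ha : 0 ≤ localOrd v x - ordAt v p
  · by_cases hb : ordAt v e ≤ localOrd v x - ordAt v p
    · rw [if_pos ha, if_pos hb, if_neg (by omega), sub_self, zero_smul]
    · rw [if_pos ha, if_neg hb, if_pos (by omega), sub_zero, one_smul]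
  · rw [if_neg ha, if_neg (by omega), if_neg (by omega), sub_self, zero_smul]

variable [IsTotallyReal F] {r n : ℕ} {v : Fin r ↪ HeightOneSpectrum (𝓞 F)}
  {S : Finset (HeightOneSpectrum (𝓞 F))} {σ : Fin n → F →+* ℝ} {χ : Idele F →* Rˣ}

/-- A point of `∏ᵢ F_{vᵢ} × (𝔸^T)ˣ / U^S` with all local components nonzero lies in
`𝔸ˣ / U^S`. -/
theorem exists_toMixed_eq (h : placeSet v ⊆ S) (z : MixedSpace v S) (hz : ∀ i, z.1 i ≠ 0) :
    ∃ x : idelesAway (F := F) ∅, toMixed v h (quotientMk ∅ S x) = z := by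
  obtain ⟨y, hy⟩ := (isOpenQuotientMap_quotientMk (placeSet v) S).surjective z.2
  let q : (∀ i, ((v i).adicCompletion F)ˣ) × idelesAway (placeSet v) :=
    (fun i => Units.mk0 (z.1 i) (hz i), y)
  have hq : splitIdele v ((splitIdeleHomeo v).symm q) = q := (splitIdeleHomeo v).apply_symm_apply q
  refine ⟨⟨(splitIdeleHomeo v).symm q, fun w hw => absurd hw (Finset.notMem_empty w)⟩, ?_⟩
  refine Prod.ext (funext fun i => ?_) ?_
  · exact congrArg Units.val (congrFun (congrArg Prod.fst hq) i)
  · exact (congrArg (quotientMk (placeSet v) S) (congrArg Prod.snd hq)).trans hy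

/-- The indicator functions `1_{O_v} - 1_{ηᵢ O_v}`, translated successively, cut out the box. -/
theorem externalProduct_wCocycle (h : placeSet v ⊆ S) (hχ : Continuous χ)
    (hF : ∀ x : Fˣ, χ (principal x) = 1) (hU : ∀ x ∈ unitsAway S, χ x = 1)
    {η : Fin r → Additive (posUnits (placeSet v))}
    (hη : IsTriangular (fun i => ordHom (placeSet v) (v i)) η)
    (D₀ : ThetaData (F := F) ∅ Fin.elim0 σ) (D : ThetaData (placeSet v) v σ)
    (e : Fin r → Fˣ) (he : ∀ i, e i = ((η i).toMul : Fˣ)) (z : MixedSpace v S) :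
    externalProduct (mulProd R r) (X := fun i => (v i).adicCompletion F)
      (fun i => (twistRep (globalChar (localChar χ (v i))) ((v i).adicCompletion F)).ρ
        (Fin.partialProd e i.castSucc)
        (wCocycle (localChar χ (v i)) (continuous_localChar hχ) (e i)))
      (charMul h hχ hU (finsetIndicator D.domain)) ((List.ofFn e).prod • z) =
    extendZero (toMixed v h) (isOpenEmbedding_toMixed v h)
      (charMul (Finset.empty_subset S) hχ hU (finsetIndicator (boxThetaData hη D₀ D).domain))
      z := by
  classical
  set g := (List.ofFn e).prod with hg
  have hgT : g ∈ posUnits (placeSet v) := Subgroup.list_prod_mem _ fun x hx => by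
    obtain ⟨i, rfl⟩ := (List.mem_ofFn' e x).1 hx
    rw [he]
    exact (η i).toMul.2
  have hord : ∀ i j, ordAt (v j) (e i) = ordHom (placeSet v) (v j) (η i) := by
    intro i j
    rw [he]
    rfl
  change ((finsetIndicator D.domain (coarsen h (g • z.2)) •
      ((restrictChar χ hU (g • z.2) : Rˣ) : R)) *
    ∏ i, (((globalChar (localChar χ (v i)) (Fin.partialProd e i.castSucc) : Rˣ) : R) *
      wFun (localChar χ (v i)) (finComp (v i) (principal (e i)))
        ((Fin.partialProd e i.castSucc)⁻¹ • g • z.1 i))) = _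
  by_cases hz : ∀ i, z.1 i ≠ 0
  · obtain ⟨x, rfl⟩ := exists_toMixed_eq h z hz
    rw [extendZero_apply, charMul_apply]
    have e1 : ∀ i, (toMixed v h (quotientMk ∅ S x)).1 i =
      (finComp (v i) (x : Idele F) : (v i).adicCompletion F) := fun i => rfl
    have e2 : (toMixed v h (quotientMk ∅ S x)).2 = toQuotient (placeSet v) S (x : Idele F) := rfl
    have e3 : ∀ i, g • (finComp (v i) (x : Idele F) : (v i).adicCompletion F) =
        (finComp (v i) (principal g * (x : Idele F)) : (v i).adicCompletion F) := by
      intro i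
      rw [map_mul, Units.val_mul]
      exact Algebra.smul_def (g : F) _
    have e4 : g • toQuotient (placeSet v) S (x : Idele F) =
        toQuotient (placeSet v) S (principal g * (x : Idele F)) := by
      rw [smul_def, map_mul]
    have e5 : coarsen h (g • toQuotient (placeSet v) S (x : Idele F)) =
        projQuotient (placeSet v) (quotientMk ∅ ∅ x) := by
      rw [coarsen_smul]
      exact smul_posUnits ⟨g, hgT⟩ _
    have e6 : ((restrictChar χ hU (quotientMk ∅ S x) : Rˣ) : R) =
        (restrictChar χ hU (g • toQuotient (placeSet v) S (x : Idele F)) : R) *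
          ∏ i, ((localChar χ (v i) (finComp (v i) (principal g * (x : Idele F))) : Rˣ) : R) := by
      rw [e4, mul_comm, ← Units.coe_prod, ← Units.val_mul, prod_localChar_mul_restrictChar,
        map_mul, hF, one_mul]
      rfl
    have e7 : ∀ i, ordAt (v i) g = ordAt (v i) (Fin.partialProd e i.castSucc) +
        ordAt (v i) (e i) := fun i => ordAt_prod_ofFn (v i) e i fun j hij => by
      rw [hord]
      exact hη.eq_zero j i hij
    have e8 : ∀ i, localOrd (v i) (finComp (v i) (principal g * (x : Idele F))) =
        ordAt (v i) g + localOrd (v i) (finComp (v i) (x : Idele F)) := by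
      intro i
      rw [map_mul, localOrd_mul, localOrd_principal]
    have e9 : finsetIndicator (boxThetaData hη D₀ D).domain
        (coarsen (Finset.empty_subset S) (quotientMk ∅ S x)) =
        if projQuotient (placeSet v) (quotientMk ∅ ∅ x) ∈ D.domain ∧
          ∀ i, -ordHom (placeSet v) (v i) (η i) ≤ localOrd (v i) (finComp (v i) (x : Idele F)) ∧
            localOrd (v i) (finComp (v i) (x : Idele F)) < 0 then 1 else 0 :=
      if_congr (Set.Finite.mem_toFinset _) rfl rfl
    simp only [e1, e2, e3]
    rw [Finset.prod_congr rfl fun i _ => globalChar_mul_wFun (localChar χ (v i))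
      (by rw [hord]; exact hη.pos i) _ _, Finset.prod_ite_zero, e5, e9, e6]
    have e10 : (∀ i ∈ Finset.univ, ordAt (v i) (Fin.partialProd e i.castSucc) ≤
          localOrd (v i) (finComp (v i) (principal g * (x : Idele F))) ∧
        localOrd (v i) (finComp (v i) (principal g * (x : Idele F))) <
          ordAt (v i) (Fin.partialProd e i.castSucc) + ordAt (v i) (e i)) ↔
        ∀ i, -ordHom (placeSet v) (v i) (η i) ≤ localOrd (v i) (finComp (v i) (x : Idele F)) ∧
            localOrd (v i) (finComp (v i) (x : Idele F)) < 0 := by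
      simp only [Finset.mem_univ, true_imp_iff]
      refine forall_congr' fun i => ?_
      rw [e8, e7, ← hord i i]
      constructor <;> rintro ⟨_, _⟩ <;> constructor <;> omega
    have e11 : finsetIndicator D.domain (projQuotient (placeSet v) (quotientMk ∅ ∅ x)) =
      if projQuotient (placeSet v) (quotientMk ∅ ∅ x) ∈ D.domain then 1 else 0 := rfl
    rw [e11]
    by_cases hA : projQuotient (placeSet v) (quotientMk ∅ ∅ x) ∈ D.domain
    · by_cases hB : ∀ i, -ordHom (placeSet v) (v i) (η i) ≤
          localOrd (v i) (finComp (v i) (x : Idele F)) ∧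
            localOrd (v i) (finComp (v i) (x : Idele F)) < 0
      · rw [if_pos hA, if_pos (e10.2 hB), if_pos ⟨hA, hB⟩, one_smul, one_smul]
      · rw [if_neg (mt e10.1 hB), if_neg (mt And.right hB), mul_zero, zero_smul]
    · rw [if_neg hA, if_neg (mt And.left hA), zero_smul, zero_smul, zero_mul]
  · push Not at hz
    obtain ⟨i, hi⟩ := hz
    have h1 : z ∉ Set.range (toMixed v h) := by
      rintro ⟨u, rfl⟩
      exact Units.ne_zero _ hi
    rw [extendZero_apply' _ _ h1, Finset.prod_eq_zero (Finset.mem_univ i), mul_zero]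
    rw [hi, smul_zero, smul_zero, wFun, dif_pos rfl, mul_zero]

/-- The chain-level form of `ϑ = (u₁ ∪ … ∪ u_r) ∩ ϑ^T`, twisted by `χ`: among the permutations in
the fundamental chain of the adapted basis only those fixing the first `r` elements contribute,
since `wCocycle` vanishes on units. -/
theorem capChain_wCocycle (h : placeSet v ⊆ S) (hχ : Continuous χ)
    (hF : ∀ x : Fˣ, χ (principal x) = 1) (hU : ∀ x ∈ unitsAway S, χ x = 1)
    {η : Fin r → Additive (posUnits (placeSet v))}
    (hη : IsTriangular (fun i => ordHom (placeSet v) (v i)) η)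
    (D₀ : ThetaData (F := F) ∅ Fin.elim0 σ) (D : ThetaData (placeSet v) v σ) :
    capChain (charPairing h hχ hF hU) rfl
      (cupOne fun i => wCocycle (localChar χ (v i)) (continuous_localChar hχ))
      (fundamentalChain (ccRep Fˣ (AdelicQuotient (placeSet v) (placeSet v)) ℤ)
        (finsetIndicator D.domain) fun i => ((adaptedFamily η D₀ i).toMul : Fˣ)) =
    fundamentalChain (ccRep Fˣ (MixedSpace v S) R)
      (extendZero (toMixed v h) (isOpenEmbedding_toMixed v h)
        (charMul (Finset.empty_subset S) hχ hU (finsetIndicator (boxThetaData hη D₀ D).domain)))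
      fun l => ((D₀.basis (Fin.cast (Nat.zero_add _).symm l)).toMul : Fˣ) := by
  have hord : ∀ i l, ordAt (v i) ((inclUnits (placeSet v)
      (D₀.basis (Fin.cast (Nat.zero_add _).symm l))).toMul : Fˣ) = 0 := fun i l =>
    (mem_posUnits_empty_iff v (inclUnits (placeSet v)
      (D₀.basis (Fin.cast (Nat.zero_add _).symm l))).toMul.2).1
      (D₀.basis (Fin.cast (Nat.zero_add _).symm l)).toMul.2 i
  unfold fundamentalChain
  rw [map_sum, sum_perm_eq_sum_perm_natAdd]
  · refine Finset.sum_congr rfl fun τ _ => ?_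
    set π := finSumFinEquiv.permCongr (Equiv.Perm.sumCongr (1 : Equiv.Perm (Fin r)) τ) with hπ
    have hs : Equiv.Perm.sign π = Equiv.Perm.sign τ := by
      rw [hπ, Equiv.Perm.sign_permCongr, Equiv.Perm.sign_sumCongr, Equiv.Perm.sign_one, one_mul]
    have h1 : ∀ i : Fin r, π (Fin.castAdd (n - 1) i) = Fin.castAdd (n - 1) i := by
      intro i
      simp [hπ, Equiv.permCongr_apply]
    have h2 : ∀ l : Fin (n - 1), π (Fin.natAdd r l) = Fin.natAdd r (τ l) := by
      intro l
      simp [hπ, Equiv.permCongr_apply]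
    let e : Fin r → Fˣ := fun k => (adaptedFamily η D₀ (π ⟨k, by omega⟩)).toMul
    have he : ∀ i, e i = ((η i).toMul : Fˣ) := fun i =>
      congrArg (fun u => ((Additive.toMul u : posUnits (placeSet v)) : Fˣ))
        ((congrArg (adaptedFamily η D₀) (h1 i)).trans (Fin.append_left _ _ _))
    rw [map_smul, hs]
    congr 1
    refine (capChain_single _ _ _ _ _).trans ?_
    congr 1
    · funext l
      exact congrArg (fun u => ((Additive.toMul u : posUnits (placeSet v)) : Fˣ))
        ((congrArg (adaptedFamily η D₀) (h2 l)).trans (Fin.append_right _ _ _))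
    · refine CompactlySupportedContinuousMap.ext fun z => ?_
      have e1 := externalProduct_wCocycle h hχ hF hU hη D₀ D e he z
      have e2 := charPairing_tprod h hχ hF hU
        (fun i => (twistRep (globalChar (localChar χ (v i))) ((v i).adicCompletion F)).ρ
          (Fin.partialProd e i.castSucc)
          (wCocycle (localChar χ (v i)) (continuous_localChar hχ) (e i)))
        (finsetIndicator D.domain)
      rw [← inv_inv (List.ofFn e).prod] at e1
      exact (congrArg (fun t : C_c(MixedSpace v S, R) => t ((List.ofFn e).prod⁻¹⁻¹ • z)) e2).trans e1
  · rintro π ⟨i₀, hi₀⟩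
    -- At the first index where `π` is not the identity, it increases the index, so that the
    -- order of the corresponding basis element vanishes by triangularity.
    have h1 : ∃ i : Fin r,
        ordAt (v i) ((adaptedFamily η D₀ (π (Fin.castAdd (n - 1) i))).toMul : Fˣ) = 0 := by
      by_contra! hne
      have hfix : ∀ k (hk : k < r),
          π (Fin.castAdd (n - 1) ⟨k, hk⟩) = Fin.castAdd (n - 1) ⟨k, hk⟩ := by
        intro k
        induction k using Nat.strong_induction_on with
        | _ k ih =>
          intro hk
          have h2 := hne ⟨k, hk⟩
          generalize hq : π (Fin.castAdd (n - 1) ⟨k, hk⟩) = q at h2 ⊢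
          induction q using Fin.addCases with
          | left j =>
            rcases lt_trichotomy j ⟨k, hk⟩ with hj | hj | hj
            · have h3 := π.injective ((ih j hj j.2).trans hq.symm)
              exact absurd (Fin.castAdd_injective _ _ h3) hj.ne
            · rw [hj]
            · refine absurd ?_ h2
              unfold adaptedFamily
              rw [Fin.append_left]
              exact hη.eq_zero j ⟨k, hk⟩ hj
          | right l =>
            refine absurd ?_ h2
            unfold adaptedFamily
            rw [Fin.append_right]
            exact hord _ l
      exact hi₀ (hfix i₀ i₀.2)
    obtain ⟨i, hi⟩ := h1
    have h2 : wCocycle (localChar χ (v i)) (continuous_localChar hχ)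
        ((adaptedFamily η D₀ (π (Fin.castAdd (n - 1) i))).toMul : Fˣ) = 0 := by
      refine CompactlySupportedContinuousMap.ext fun y => wFun_eq_zero _ ?_ y
      rw [← localOrd_eq_zero_iff, localOrd_principal, hi]
    have h3 : cupOne (fun i => wCocycle (localChar χ (v i)) (continuous_localChar hχ))
        (fun k : Fin r => ((adaptedFamily η D₀ (π ⟨k, by omega⟩)).toMul : Fˣ)) = 0 :=
      cupOne_eq_zero _ _ i h2
    rw [map_smul]
    exact (congrArg _ (capChain_single_eq_zero _ _ _ _ _ h3)).trans (smul_zero _)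

end WCap

/-! ### Comparison of the classes -/

section CapInvariant

variable {k G : Type} [CommRing k] [Group G] {M N P : Rep.{0} k G}

theorem cap_invariantClass (B : Pairing M N P) {j m : ℕ} (h : 0 + j = m) (c : M)
    (hc : ∀ g, M.ρ g c = c) {x : (Fin m → G) →₀ N} (hx : IsCycle x) :
    cap B h (invariantClass c hc) (homologyClass x hx) =
      homologyClass (capChain B h (fun _ => c) x) ((isCocycle_const c hc).cap B h hx) :=
  cap_mk B h _ x _ hx

end CapInvariant

section Comparison

variable {F : Type} [Field F] [NumberField F] [IsTotallyReal F] {R : Type} [CommRing R]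
  [TopologicalSpace R] [IsTopologicalRing R] {r n : ℕ} {v : Fin r ↪ HeightOneSpectrum (𝓞 F)}
  {S : Finset (HeightOneSpectrum (𝓞 F))} {σ : Fin n → F →+* ℝ} {χ : Idele F →* Rˣ}

/-- The value of `κ` on the chain level. -/
theorem kappa_eq_homologyClass (h : placeSet v ⊆ S) (hχ : Continuous χ)
    (hF : ∀ x : Fˣ, χ (principal x) = 1) (hU : ∀ x ∈ unitsAway S, χ x = 1)
    (D₀ : ThetaData (F := F) ∅ Fin.elim0 σ)
    (hc : IsCycle (fundamentalChain (ccRep Fˣ (MixedSpace v S) R)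
      (extendZero (toMixed v h) (isOpenEmbedding_toMixed v h)
        (charMul (Finset.empty_subset S) hχ hU (finsetIndicator D₀.domain)))
      fun l => ((D₀.basis (Fin.cast (Nat.zero_add _).symm l)).toMul : Fˣ))) :
    kappa h hχ hF hU D₀ = homologyClass _ hc := by
  have hk := cap_invariantClass
    (properPairing R (coarsen (Finset.empty_subset S)) (isProperMap_coarsen _) (coarsen_smul _))
    rfl (charFun χ ∅ hU hχ (RingHom.id R) continuous_id)
    (charFun_invariant χ hU hχ hF _ _ fun v hv => absurd hv (Finset.notMem_empty v))
    (isCycle_fundamentalChain_units (finsetIndicator D₀.domain) fun i => (D₀.basis i).toMul)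
  unfold kappa characterClass
  rw [theta_eq_homologyClass]
  refine (congrArg _ hk).trans ?_
  rw [homologyMap_homologyClass]
  have h1 := capChain_const_fundamentalChain
    (properPairing R (coarsen (Finset.empty_subset S)) (isProperMap_coarsen _) (coarsen_smul _))
    rfl (charFun χ ∅ hU hχ (RingHom.id R) continuous_id) (finsetIndicator D₀.domain)
    (fun i => ((D₀.basis i).toMul : Fˣ))
  have h2 := (congrArg _ h1).trans (chainsMap_fundamentalChain
    (N := ccRep Fˣ (MixedSpace v S) R) (MonoidHom.id Fˣ)
    (extendZeroHom (toMixed v h) (isOpenEmbedding_toMixed v h) (toMixed_smul v h)) _ _)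
  exact homologyClass_congr h2 _ hc

/-- Replacing the cocycles `z_{dχ}` by the twisted cocycles `wCocycle`. -/
theorem homologyMap_cupCapKappaBar {a : Ideal R} {I : Fin r → Ideal R} (h : placeSet v ⊆ S)
    (hχ : Continuous χ) (hF : ∀ x : Fˣ, χ (principal x) = 1) (hU : ∀ x ∈ unitsAway S, χ x = 1)
    (hIa : ∀ i, I i ≤ a) (hI : ∀ i x, (localChar χ (v i) x : R) - 1 ∈ I i)
    (h0 : a * ∏ i, I i = ⊥) (D : ThetaData (placeSet v) v σ) :
    homologyMap (ccMap (Submodule.subtype (∏ i, I i)).toAddMonoidHom continuous_subtype_val)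
        (n - 1) (cupCapKappaBar h hχ hF hU hIa hI h0 D) =
      cap (charPairing h hχ hF hU) rfl
        (cohomologyClass
          (cupOne fun i => wCocycle (localChar χ (v i)) (continuous_localChar hχ))
          (isCocycle_cupOne _ fun _ => wCocycle_mul _ _))
        (theta D) := by
  have hz := cohomologyClass_cupOne_eq
    (fun i => wCocycle (localChar χ (v i)) (continuous_localChar hχ))
    (fun i => zLift (localChar χ (v i)) (continuous_localChar hχ))
    (fun _ => wCocycle_mul _ _) (fun _ => zLift_mul _ _)
    (fun i => integerIndicator (localChar χ (v i))) (fun _ _ => rfl)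
  unfold cupCapKappaBar cupClass kappaBar
  have hk := cap_invariantClass
    (properPairing (R ⧸ a) (coarsen h) (isProperMap_coarsen h) (coarsen_smul h))
    (Nat.zero_add _)
    (charFun χ (placeSet v) hU hχ (Ideal.Quotient.mk a) continuous_quot_mk)
    (charFun_invariant χ hU hχ hF _ _ (mk_char_eq_one hIa hI))
    (isCycle_fundamentalChain_units (finsetIndicator D.domain) fun i => (D.basis i).toMul)
  rw [← hz, theta_eq_homologyClass, hk, cap_mk, cap_mk, homologyMap_homologyClass]
  exact homologyClass_congr (capChain_zLift h hχ hF hU hIa hI h0 _) _ _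

theorem kappa_eq_homologyMap {a : Ideal R} {I : Fin r → Ideal R} (h : placeSet v ⊆ S)
    (hχ : Continuous χ) (hF : ∀ x : Fˣ, χ (principal x) = 1) (hU : ∀ x ∈ unitsAway S, χ x = 1)
    (hIa : ∀ i, I i ≤ a) (hI : ∀ i x, (localChar χ (v i) x : R) - 1 ∈ I i)
    (h0 : a * ∏ i, I i = ⊥) (D₀ : ThetaData (F := F) ∅ Fin.elim0 σ)
    (D : ThetaData (placeSet v) v σ) :
    kappa h hχ hF hU D₀ =
      homologyMap (ccMap (Submodule.subtype (∏ i, I i)).toAddMonoidHom continuous_subtype_val)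
        (n - 1) (cupCapKappaBar h hχ hF hU hIa hI h0 D) := by
  obtain ⟨η, hη⟩ := exists_isTriangular_ordHom v
  have h1 : kappa h hχ hF hU D₀ = kappa h hχ hF hU (boxThetaData hη D₀ D) := by
    unfold kappa characterClass
    rw [theta_eq D₀ (boxThetaData hη D₀ D)]
  rw [homologyMap_cupCapKappaBar, theta_eq D (adaptedThetaData hη D₀ D), theta_eq_homologyClass,
    cap_mk, h1]
  have h2 : ∀ i, (adaptedThetaData hη D₀ D).basis i = adaptedFamily η D₀ i :=
    congrFun (Module.Basis.coe_mk _ (span_adaptedFamily hη D₀))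
  have h3 : capChain (charPairing h hχ hF hU) rfl
      (cupOne fun i => wCocycle (localChar χ (v i)) (continuous_localChar hχ))
      (fundamentalChain (ccRep Fˣ (AdelicQuotient (placeSet v) (placeSet v)) ℤ)
        (finsetIndicator (adaptedThetaData hη D₀ D).domain)
        fun i => (((adaptedThetaData hη D₀ D).basis i).toMul : Fˣ)) =
      fundamentalChain (ccRep Fˣ (MixedSpace v S) R)
        (extendZero (toMixed v h) (isOpenEmbedding_toMixed v h)
          (charMul (Finset.empty_subset S) hχ hU (finsetIndicator (boxThetaData hη D₀ D).domain)))
        fun l => (((boxThetaData hη D₀ D).basis (Fin.cast (Nat.zero_add _).symm l)).toMul : Fˣ) := by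
    simp only [h2]
    exact capChain_wCocycle h hχ hF hU hη D₀ D
  rw [kappa_eq_homologyClass h hχ hF hU (boxThetaData hη D₀ D)
    (h3 ▸ (isCocycle_cupOne _ fun _ => wCocycle_mul _ _).cap _ _
      (isCycle_fundamentalChain_units _ _))]
  exact homologyClass_congr h3.symm _ _

/-- Homology with values in functions with values in the zero module vanishes. -/
theorem groupHomology_ccRep_eq_zero {G X A : Type} [Group G] [TopologicalSpace X] [MulAction G X]
    [ContinuousConstSMul G X] [AddCommGroup A] [TopologicalSpace A] [IsTopologicalAddGroup A]
    [Subsingleton A] {m : ℕ} (x : groupHomology (ccRep G X A) m) : x = 0 := by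
  obtain ⟨y, hy, rfl⟩ := exists_cycle x
  have h1 : y = 0 := Finsupp.ext fun g =>
    CompactlySupportedContinuousMap.ext fun _ => Subsingleton.elim _ _
  subst h1
  exact homologyClass_zero _

end Comparison

end HeckeClasses

theorem mainTheorem5 {F : Type} [Field F] [NumberField F] [IsTotallyReal F]
    {R : Type} [CommRing R] [TopologicalSpace R] [IsTopologicalRing R] [T2Space R]
    [LocallyCompactSpace R] [TotallyDisconnectedSpace R]
    (σ : Fin (Module.finrank ℚ F) ≃ (F →+* ℝ))
    {r : ℕ} (v : Fin r ↪ HeightOneSpectrum (𝓞 F)) (S : Finset (HeightOneSpectrum (𝓞 F)))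
    (hS : placeSet v ⊆ S)
    (χ : Idele F →* Rˣ) (hχ : Continuous χ) (hF : ∀ x : Fˣ, χ (principal x) = 1)
    (hU : ∀ x ∈ unitsAway S, χ x = 1)
    (a : Ideal R) (ha : IsClosed (a : Set R))
    (I : Fin r → Ideal R) (hIc : ∀ i, IsClosed (I i : Set R)) (hIa : ∀ i, I i ≤ a)
    (hI : ∀ i x, (localChar χ (v i) x : R) - 1 ∈ I i)
    (h0 : a * ∏ i, I i = ⊥)
    (D₀ : ThetaData ∅ Fin.elim0 σ) (D : ThetaData (placeSet v) v σ) :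
    kappa hS hχ hF hU D₀ =
        homologyMap (ccMap (Submodule.subtype (∏ i, I i)).toAddMonoidHom continuous_subtype_val)
          (Module.finrank ℚ F - 1) (cupCapKappaBar hS hχ hF hU hIa hI h0 D) ∧
      (∏ i, I i = ⊥ → kappa hS hχ hF hU D₀ = 0) := by
  refine ⟨kappa_eq_homologyMap hS hχ hF hU hIa hI h0 D₀ D, fun h => ?_⟩
  have : Subsingleton ↥(∏ i, I i) := by
    rw [h]
    infer_instance
  rw [kappa_eq_homologyMap hS hχ hF hU hIa hI h0 D₀ D, groupHomology_ccRep_eq_zero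
    (cupCapKappaBar hS hχ hF hU hIa hI h0 D)]
  exact map_zero _
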